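/- **Setting.** Let $n\ge 1$, $m>0$, and let $\mathcal D=C_0^\infty(\mathbb R^n)\oplus C_0^\infty(\mathbb R^n)$ (complex-valued functions), with the real scalar product $\langle Y,\Psi\rangle=\sum_{i=0,1}\mathrm{Re}\int Y^i(x)\overline{\Psi^i(x)}\,dx$. Let $\mathcal H=H^1_{\rm loc}(\mathbb R^n)\oplus L^2_{\rm loc}(\mathbb R^n)$ with the seminorms $\|(u,v)\|_R^2=\int_{|x|<R}(|v|^2+|\nabla u|^2+m^2|u|^2)\,dx$, and let $U_0(t):\mathcal H\to\mathcal H$ be the solution operator $Y(0)\mapsto Y(t)=(u(\cdot,t),\dot u(\cdot,t))$, $Y\in C(\mathbb R,\mathcal H)$, of the Klein–Gordon equation $\ddot u=\Delta u-m^2u$. Its formal adjoint $U_0'(t):\mathcal D\to\mathcal D$ is defined by $\langle Y,U_0'(t)\Psi\rangle=\langle U_0(t)Y,\Psi\rangle$ for all $Y\in\mathcal H$. Let $Y_0=(Y_0^0,Y_0^1)=(u_0,v_0)$ be a measurable random function with values in $\mathcal H$ on a probability space $(\Omega,\Sigma,P)$ with expectation $E$, such that * (S0) $EY_0(x)=0$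 for almost all $x$; * (S1) $E(Y_0^i(x)\otimes Y_0^j(y))=q_0^{ij}(x-y)$ for almost all $x,y$ and $i,j=0,1$ ($\otimes$ is the tensor product of real vectors, $\mathbb C=\mathbb R^2$); * (S2) $E(|v_0(x)|^2+|\nabla u_0(x)|^2+m^2|u_0(x)|^2)=e_0<\infty$ for almost all $x$; * (S3) $\varphi(r)\to0$ as $r\to\infty$ and $\overline\varphi:=\int_0^\infty r^{n-1}\varphi^{1/2}(r)\,dr<\infty$, where $$\varphi(r)=\sup\frac{|P(A\cap B)-P(A)P(B)|}{P(B)},$$ the supremum over all open bounded $\mathcal A,\mathcal B\subset\mathbb R^n$ at distance $\ge r$ and all $A\in\sigma(\mathcal A)$, $B\in\sigma(\mathcal B)$ with $P(B)>0$; here $\sigma(\mathcal A)$ is generated by the random variables $\langle Y_0,\Psi\rangle$, $\Psi\in\mathcal D$, $\mathrm{supp}\,\Psi\subset\mathcal A$. Assume moreover that for some $\Lambda$, almost surely, $|u_0(x)|+|v_0(x)|\le\Lambda$ for almost all $x\in\mathbb R^n$. For $t>0$ let $d_t\ge1$ and $\rho_t>0$ be arbitrary, put $h_t=d_t+\rho_t$,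 let $\chi_r^j$ be the indicator of the room $\{x\in\mathbb R^n: jh_t\le x^n\le jh_t+d_t\}$ ($x^n$ the last coordinate of $x$), and for $\Psi\in\mathcal D$ put $$r_t^j=\langle Y_0,\chi_r^j\,U_0'(t)\Psi\rangle,\qquad j\in\mathbb Z.$$ **Theorem.** For every $\Psi\in\mathcal D$ there is a constant $C(\Psi)$, depending only on $\Psi$, $n$, $m$ and an upper bound for $\overline\varphi$ (and not on $\Lambda$, $t$, $j$, $d_t$, $\rho_t$ or otherwise on $Y_0$), such that $$E|r_t^j|^4\le C(\Psi)\,\Lambda^4\,\frac{d_t^2}{t^2},\qquad t>1,\ j\in\mathbb Z .$$ Consequently, if $d_t\sim t/\ln t$ and $\rho_t\sim t^{1-\delta}$ as $t\to\infty$ for some $0<\delta<1$, then $\sum_{j\in\mathbb Z}E|r_t^j|^4\to0$ and the Lindeberg condition holds: for every $\varepsilon>0$, $$\sum_{j\in\mathbb Z}E\big(|r_t^j|^2\,\mathbf 1_{\{|r_t^j|>\varepsilon\}}\big)\to0,\qquad t\to\infty .$$ -/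

import Mathlib

open MeasureTheory Filter Topology Set
open scoped ENNReal NNReal Laplacian

noncomputable section

namespace KleinGordon

/-- `ℝⁿ` with its Euclidean norm. -/
abbrev E (n : ℕ) : Type := EuclideanSpace ℝ (Fin n)

/-- Pairs `Y = (Y⁰, Y¹) = (u, v)` of complex functions on `ℝⁿ`; `Y x 0 = u(x)`, `Y x 1 = v(x)`. -/
abbrev State (n : ℕ) : Type := E n → Fin 2 → ℂ

/-- Complex vector fields on `ℝⁿ`, the candidates for `∇u`. -/
abbrev GradField (n : ℕ) : Type := E n → EuclideanSpace ℂ (Fin n)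

variable {n : ℕ}

/-- `Ψ ∈ 𝒟 = C₀^∞(ℝⁿ) ⊕ C₀^∞(ℝⁿ)`. -/
def IsTestPair (Ψ : State n) : Prop := ContDiff ℝ (⊤ : ℕ∞) Ψ ∧ HasCompactSupport Ψ

/-- `⟨Y, Ψ⟩ = ⟨Y⁰, Ψ⁰⟩ + ⟨Y¹, Ψ¹⟩`, the real `L²` scalar product (with `ℂ = ℝ²`). -/
def pairing (Y Ψ : State n) : ℝ :=
  ∫ x, ∑ i, (Y x i * (starRingEnd ℂ) (Ψ x i)).re

/-! ### The phase space `ℋ = H¹_loc ⊕ L²_loc` -/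

/-- `g` is the weak gradient of `u`. -/
def HasWeakGradient (u : E n → ℂ) (g : GradField n) : Prop :=
  ∀ η : E n → ℝ, ContDiff ℝ (⊤ : ℕ∞) η → HasCompactSupport η → ∀ k : Fin n,
    ∫ x, (fderiv ℝ η x (EuclideanSpace.single k 1)) • u x = -∫ x, η x • g x k

/-- The energy density `|v|² + |∇u|² + m²|u|²` at a point, with `y = (u, v)` and `p = ∇u`. -/
def energyDensity (m : ℝ) (y : Fin 2 → ℂ) (p : EuclideanSpace ℂ (Fin n)) : ℝ≥0∞ :=
  ‖y 1‖ₑ ^ 2 + ‖p‖ₑ ^ 2 + ENNReal.ofReal (m ^ 2) * ‖y 0‖ₑ ^ 2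

/-- The squared local energy seminorm `‖Y‖_R²` of `Y = (u, v)`, where `g = ∇u`. -/
def localEnergy (m R : ℝ) (Y : State n) (g : GradField n) : ℝ≥0∞ :=
  ∫⁻ x in Metric.ball 0 R, energyDensity m (Y x) (g x)

/-- `Y = (u, v) ∈ ℋ`, with weak gradient `∇u = g`. -/
structure InPhaseSpace (m : ℝ) (Y : State n) (g : GradField n) : Prop where
  aestronglyMeasurable : AEStronglyMeasurable Y volume
  aestronglyMeasurable_grad : AEStronglyMeasurable g volume
  hasWeakGradient : HasWeakGradient (fun x => Y x 0) g
  localEnergy_lt_top : ∀ R : ℝ, 0 < R → localEnergy m R Y g < ∞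

/-! ### Klein–Gordon dynamics and the adjoint group -/

/-- The formal adjoint `𝒜₀' η = ((Δ - m²) η¹, η⁰)` of the generator `𝒜₀ (u, v) = (v, (Δ - m²) u)`. -/
def adjointGenerator (m : ℝ) (η : State n) : State n := fun x =>
  ![(Δ (fun y => η y 1)) x - (m : ℂ) ^ 2 * η x 1, η x 0]

/-- `Y ∈ C(ℝ, ℋ)` is a generalised solution of `Ẏ = 𝒜₀ Y`, i.e. of `ü = Δu - m²u` with
`Y = (u, u̇)`: the equation holds after pairing with every test pair. -/
def IsSolution (m : ℝ) (Y : ℝ → State n) : Prop :=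
  ∃ g : ℝ → GradField n,
    (∀ t, InPhaseSpace m (Y t) (g t)) ∧
    (∀ R : ℝ, 0 < R → ∀ s : ℝ,
      Tendsto (fun t => localEnergy m R (Y t - Y s) (g t - g s)) (𝓝 s) (𝓝 0)) ∧
    ∀ η : State n, IsTestPair η → ∀ t : ℝ,
      HasDerivAt (fun s => pairing (Y s) η) (pairing (Y t) (adjointGenerator m η)) t

/-- `Φ = U₀'(t) Ψ`: `Φ ∈ 𝒟` and `⟨Y₀, Φ⟩ = ⟨U₀(t) Y₀, Ψ⟩` for all `Y₀ ∈ ℋ`, where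
`U₀(t) : Y(0) ↦ Y(t)` is the solution operator. -/
def IsAdjointEvolution (m t : ℝ) (Ψ Φ : State n) : Prop :=
  IsTestPair Φ ∧ ∀ Y : ℝ → State n, IsSolution m Y → pairing (Y 0) Φ = pairing (Y t) Ψ

open Classical in
/-- `U₀'(t) Ψ`. The defining property has exactly one solution for every `Ψ ∈ 𝒟`, `t ∈ ℝ`. -/
def adjointGroup (m t : ℝ) (Ψ : State n) : State n :=
  if h : ∃ Φ, IsAdjointEvolution m t Ψ Φ then h.choose else 0

/-! ### Random initial data -/

variable {Ω : Type*} [MeasurableSpace Ω]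

/-- `Y₀` is a measurable random function with values in `ℋ`: it is measurable in `(ω, x)` for the
completed product `σ`-algebra, and `Y₀(ω, ·) ∈ ℋ` almost surely. -/
def IsRandomState (m : ℝ) (P : Measure Ω) (Y₀ : Ω → State n) : Prop :=
  AEMeasurable (fun p : Ω × E n => Y₀ p.1 p.2) (P.prod volume) ∧
    ∀ᵐ ω ∂P, ∃ g, InPhaseSpace m (Y₀ ω) g

/-- Zero expectation. -/
def CondS0 (P : Measure Ω) (Y₀ : Ω → State n) : Prop :=
  ∀ i : Fin 2, ∀ᵐ x : E n, ∫ ω, Y₀ ω x i ∂P = 0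

/-- The two coordinates of `z ∈ ℂ = ℝ²`. -/
def realCoord (a : Fin 2) (z : ℂ) : ℝ := if a = 0 then z.re else z.im

/-- The covariance function `Q₀^{ij}(x, y) = E (Y₀^i(x) ⊗ Y₀^j(y))`, tensor product of vectors of
`ℝ² = ℂ`. -/
def covariance (P : Measure Ω) (Y₀ : Ω → State n) (i j : Fin 2) (x y : E n) :
    Matrix (Fin 2) (Fin 2) ℝ :=
  Matrix.of fun a b => ∫ ω, realCoord a (Y₀ ω x i) * realCoord b (Y₀ ω y j) ∂P

/-- Translation-invariant covariance functions. -/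
def CondS1 (P : Measure Ω) (Y₀ : Ω → State n) : Prop :=
  ∃ q : Fin 2 → Fin 2 → E n → Matrix (Fin 2) (Fin 2) ℝ, ∀ i j : Fin 2,
    ∀ᵐ p : E n × E n, covariance P Y₀ i j p.1 p.2 = q i j (p.1 - p.2)

/-- Finite mean energy density: `E (|v₀(x)|² + |∇u₀(x)|² + m²|u₀(x)|²) = e₀ < ∞`. -/
def CondS2 (m : ℝ) (P : Measure Ω) (Y₀ : Ω → State n) : Prop :=
  ∃ g : Ω → GradField n,
    AEMeasurable (fun p : Ω × E n => g p.1 p.2) (P.prod volume) ∧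
    (∀ᵐ ω ∂P, HasWeakGradient (fun x => Y₀ ω x 0) (g ω)) ∧
    ∃ e₀ : ℝ≥0, ∀ᵐ x : E n, ∫⁻ ω, energyDensity m (Y₀ ω x) (g ω x) ∂P = e₀

/-- `σ(𝒜)`: the `σ`-algebra generated by the functionals `⟨Y₀, Ψ⟩`, `Ψ ∈ 𝒟`, `supp Ψ ⊆ 𝒜`. -/
@[reducible] def sigmaAlg (Y₀ : Ω → State n) (𝒜 : Set (E n)) : MeasurableSpace Ω :=
  ⨆ (Ψ : State n) (_ : IsTestPair Ψ ∧ tsupport Ψ ⊆ 𝒜),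
    MeasurableSpace.comap (fun ω => pairing (Y₀ ω) Ψ) (borel ℝ)

/-- The Ibragimov–Linnik mixing coefficient `φ(r)`. (The set is nonempty and contained in
`[0, 1]` when `P` is a probability measure.) -/
def mixingCoeff (P : Measure Ω) (Y₀ : Ω → State n) (r : ℝ) : ℝ :=
  sSup {c : ℝ | ∃ 𝒜 ℬ : Set (E n),
    IsOpen 𝒜 ∧ Bornology.IsBounded 𝒜 ∧ IsOpen ℬ ∧ Bornology.IsBounded ℬ ∧
    (∀ x ∈ 𝒜, ∀ y ∈ ℬ, r ≤ dist x y) ∧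
    ∃ A B : Set Ω, MeasurableSet[sigmaAlg Y₀ 𝒜] A ∧ MeasurableSet[sigmaAlg Y₀ ℬ] B ∧
      0 < P B ∧ c = |P.real (A ∩ B) - P.real A * P.real B| / P.real B}

/-- `φ̄ = ∫₀^∞ r^{n-1} φ^{1/2}(r) dr`. -/
def mixingIntegral (P : Measure Ω) (Y₀ : Ω → State n) : ℝ≥0∞ :=
  ∫⁻ r in Ioi (0 : ℝ), ENNReal.ofReal (r ^ (n - 1) * √(mixingCoeff P Y₀ r))

/-- Strong uniform Ibragimov–Linnik mixing with `φ̄ < ∞`. -/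
def CondS3 (P : Measure Ω) (Y₀ : Ω → State n) : Prop :=
  Tendsto (mixingCoeff P Y₀) atTop (𝓝 0) ∧ mixingIntegral P Y₀ < ∞

/-- `|u₀(x)| + |v₀(x)| ≤ Λ` almost surely. -/
def BoundedBy (P : Measure Ω) (Y₀ : Ω → State n) (Λ : ℝ) : Prop :=
  ∀ᵐ ω ∂P, ∀ᵐ x : E n, ‖Y₀ ω x 0‖ + ‖Y₀ ω x 1‖ ≤ Λ

/-! ### Rooms -/

/-- The room `R^j = {x : a^j ≤ xⁿ ≤ b^j}`, `a^j = j (d + ρ)`, `b^j = a^j + d`, where `xⁿ` is the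
last coordinate of `x`. -/
def room (hn : 1 ≤ n) (d ρ : ℝ) (j : ℤ) : Set (E n) :=
  {x | j * (d + ρ) ≤ x ⟨n - 1, by omega⟩ ∧ x ⟨n - 1, by omega⟩ ≤ j * (d + ρ) + d}

/-- The room variable `r_t^j = ⟨Y₀, χ_r^j Φ(·, t)⟩`, `Φ(·, t) = U₀'(t) Ψ`, for rooms of width `d`
and corridors of width `ρ`. -/
def roomVar (hn : 1 ≤ n) (m : ℝ) (Ψ : State n) (Y₀ : State n) (d ρ t : ℝ) (j : ℤ) : ℝ :=
  pairing Y₀ ((room hn d ρ j).indicator (adjointGroup m t Ψ))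

end KleinGordon

end

/-!
By duality `r_t^j` is the integral of `Y₀` against `U₀'(t) Ψ` restricted to the `j`-th room, so two
facts about the Klein–Gordon group and one about mixing fields suffice. Testing the definition of
`Φ = U₀'(t) Ψ` on the explicit plane-wave solutions `e^{κ·x}`, `κ ∈ ℂⁿ`, determines the Laplace
transform of `Φ`. Its growth in the real part of `κ` gives finite propagation speed
(Paley–Wiener), hence a room meets the support of `Φ` in a volume at most of order `d tⁿ⁻¹`.
Fourier inversion writes `Φ` as an integral of half-waves `e^{itω(w)} a(w)`. The square of such an
integral is the integral over `u` of the correlations of `e^{itω(w + u)} a(w + u)` with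
`e^{itω(w)} a(w)`; moving `w` into the complex domain makes their product decay exponentially in
`t |u|`, and integrating over `u` yields `|Φ| ≤ C t^{-n/2}`.

For a bounded centred field with mixing coefficient `φ`, a fourth moment `E X₁X₂X₃X₄` is controlled
by splitting off an isolated point or two separated pairs, and is bounded by sums of products
`φ^{1/2}(|xᵢ - xⱼ|) φ^{1/2}(|xₖ - xₗ|)`. Integrating over a set `S`, as `r^{n-1} φ^{1/2}(r)` is
integrable, bounds the fourth moment of the integral over `S` by a multiple of `|S|²`. Hence
`E |r_t^j|⁴ ≤ C (t^{-n/2})⁴ (d tⁿ⁻¹)² = C d² / t²`. Only `O(1 + t / d)` rooms meet the support, so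
for `d = o(t)` the fourth moments sum to `o(1)`, and the Lindeberg condition follows from
`r² 1_{|r| > ε} ≤ r⁴ / ε²`.
-/

noncomputable section

namespace KleinGordon

section CovarianceInequality

variable {Ω : Type*} [MeasurableSpace Ω] {P : Measure Ω} [IsProbabilityMeasure P]

lemma setIntegral_Ioc_indicator_Iio {a x : ℝ} (hx : |x| ≤ a) (w : ℝ) :
    ∫ s in Ioc (-a) a, (Iio x).indicator (fun _ => w) s = (x + a) * w := by
  obtain ⟨hax, hxa⟩ := abs_le.1 hx
  have hinter : Ioc (-a) a ∩ Iio x = Ioo (-a) x := by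
    ext s
    simp only [mem_inter_iff, mem_Ioc, mem_Iio, mem_Ioo]
    exact ⟨fun h => ⟨h.1.1, h.2⟩, fun h => ⟨⟨h.1, by linarith [h.2]⟩, h.2⟩⟩
  rw [setIntegral_indicator measurableSet_Iio, hinter, setIntegral_const, Real.volume_real_Ioo,
    smul_eq_mul, sub_neg_eq_add, max_eq_left (by linarith)]

-- Layer-cake: `X + a` is the integral over `s ∈ (-a, a]` of the indicator of `{s < X}`.
lemma abs_integral_mul_le_of_superlevel {X W : Ω → ℝ} (hX : AEMeasurable X P)
    (hW : Integrable W P) (hW0 : ∫ ω, W ω ∂P = 0) {a c : ℝ} (ha : ∀ᵐ ω ∂P, |X ω| ≤ a)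
    (h : ∀ s, |∫ ω in {ω | s < X ω}, W ω ∂P| ≤ c) :
    |∫ ω, X ω * W ω ∂P| ≤ 2 * a * c := by
  have ha0 : 0 ≤ a := by
    obtain ⟨ω, hω⟩ := ha.exists
    exact (abs_nonneg _).trans hω
  have hlevel (s : ℝ) : NullMeasurableSet {ω | s < X ω} P :=
    nullMeasurableSet_lt aemeasurable_const hX
  set F : Ω → ℝ → ℝ := fun ω => (Iio (X ω)).indicator fun _ => W ω
  have hFint : Integrable F.uncurry (P.prod (volume.restrict (Ioc (-a) a))) := by
    have hFeq : F.uncurry = {p : Ω × ℝ | p.2 < X p.1}.indicator fun p => W p.1 := rfl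
    rw [hFeq]
    exact (hW.comp_fst _).indicator₀ (nullMeasurableSet_lt measurable_snd.aemeasurable
      (hX.comp_quasiMeasurePreserving Measure.quasiMeasurePreserving_fst))
  have hXW : Integrable (fun ω => X ω * W ω) P :=
    hW.bdd_mul hX.aestronglyMeasurable (by simpa only [Real.norm_eq_abs] using ha)
  have hlayer : ∫ ω, X ω * W ω ∂P = ∫ s in (-a)..a, ∫ ω in {ω | s < X ω}, W ω ∂P := by
    calc ∫ ω, X ω * W ω ∂P
        = ∫ ω, (X ω + a) * W ω ∂P := by
          simp only [add_mul]
          rw [integral_add hXW (hW.const_mul a), integral_const_mul, hW0, mul_zero, add_zero]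
      _ = ∫ ω, (∫ s in Ioc (-a) a, F ω s) ∂P := by
          refine integral_congr_ae ?_
          filter_upwards [ha] with ω hω using (setIntegral_Ioc_indicator_Iio hω _).symm
      _ = ∫ s in Ioc (-a) a, ∫ ω, F ω s ∂P := integral_integral_swap hFint
      _ = ∫ s in (-a)..a, ∫ ω in {ω | s < X ω}, W ω ∂P := by
          rw [intervalIntegral.integral_of_le (by linarith)]
          exact integral_congr_ae (.of_forall fun s => integral_indicator₀ (hlevel s))
  rw [hlayer]
  refine (intervalIntegral.norm_integral_le_of_norm_le_const (C := c) fun s _ =>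
    (Real.norm_eq_abs _).trans_le (h s)).trans_eq ?_
  rw [sub_neg_eq_add, abs_of_nonneg (by linarith)]
  ring

lemma abs_integral_mul_sub_le_of_superlevel {X Z : Ω → ℝ} (hX : AEMeasurable X P)
    (hZ : AEMeasurable Z P) {a b c : ℝ} (ha : ∀ᵐ ω ∂P, |X ω| ≤ a) (hb : ∀ᵐ ω ∂P, |Z ω| ≤ b)
    (h : ∀ s u : ℝ, |P.real ({ω | s < X ω} ∩ {ω | u < Z ω})
      - P.real {ω | s < X ω} * P.real {ω | u < Z ω}| ≤ c) :
    |∫ ω, X ω * Z ω ∂P - (∫ ω, X ω ∂P) * ∫ ω, Z ω ∂P| ≤ 4 * a * b * c := by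
  have hXi : Integrable X P := .of_bound hX.aestronglyMeasurable a ha
  have hZi : Integrable Z P := .of_bound hZ.aestronglyMeasurable b hb
  have hXZ : Integrable (fun ω => X ω * Z ω) P := hXi.mul_bdd hZ.aestronglyMeasurable hb
  have hlevel {V : Ω → ℝ} (hV : AEMeasurable V P) (s : ℝ) : NullMeasurableSet {ω | s < V ω} P :=
    nullMeasurableSet_lt aemeasurable_const hV
  have hcentered {V : Ω → ℝ} (hV : Integrable V P) :
      Integrable (fun ω => V ω - ∫ η, V η ∂P) P ∧ ∫ ω, (V ω - ∫ η, V η ∂P) ∂P = 0 := by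
    refine ⟨hV.sub (integrable_const _), ?_⟩
    rw [integral_sub hV (integrable_const _), integral_const, probReal_univ, one_smul, sub_self]
  have hinner (s : ℝ) : |∫ ω in {ω | s < X ω}, (Z ω - ∫ η, Z η ∂P) ∂P| ≤ 2 * b * c := by
    set V : Ω → ℝ := {ω | s < X ω}.indicator fun _ => 1 with hV
    have hVi : Integrable V P := (integrable_const 1).indicator₀ (hlevel hX s)
    have hVmean : ∫ ω, V ω ∂P = P.real {ω | s < X ω} := by
      rw [integral_indicator₀ (hlevel hX s), setIntegral_one_eq_measureReal]
    have hswap : ∫ ω in {ω | s < X ω}, (Z ω - ∫ η, Z η ∂P) ∂P =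
        ∫ ω, Z ω * (V ω - ∫ η, V η ∂P) ∂P := by
      have hZV : (fun ω => Z ω * V ω) = {ω | s < X ω}.indicator Z := by
        ext ω
        simp only [hV, indicator_apply, mul_ite, mul_one, mul_zero]
      simp only [mul_sub]
      rw [integral_sub (hZi.mono_measure Measure.restrict_le_self) (integrable_const _),
        integral_sub (hZV ▸ hZi.indicator₀ (hlevel hX s)) (hZi.mul_const _), hZV,
        integral_indicator₀ (hlevel hX s), integral_mul_const, hVmean, setIntegral_const,
        smul_eq_mul, mul_comm (∫ η, Z η ∂P)]
    rw [hswap]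
    refine abs_integral_mul_le_of_superlevel hZ (hcentered hVi).1 (hcentered hVi).2 hb fun u => ?_
    have hXu : NullMeasurableSet {ω | s < X ω} (P.restrict {ω | u < Z ω}) :=
      (hlevel hX s).mono Measure.restrict_le_self
    rw [integral_sub hVi.integrableOn (integrable_const _), integral_indicator₀ hXu,
      Measure.restrict_restrict₀ hXu, setIntegral_one_eq_measureReal, setIntegral_const, hVmean,
      smul_eq_mul, mul_comm (P.real {ω | u < Z ω})]
    exact h s u
  have hcov : ∫ ω, X ω * Z ω ∂P - (∫ ω, X ω ∂P) * ∫ ω, Z ω ∂P =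
      ∫ ω, X ω * (Z ω - ∫ η, Z η ∂P) ∂P := by
    simp only [mul_sub]
    rw [integral_sub hXZ (hXi.mul_const _), integral_mul_const]
  rw [hcov]
  refine (abs_integral_mul_le_of_superlevel hX (hcentered hZi).1 (hcentered hZi).2 ha
    hinner).trans_eq ?_
  ring

end CovarianceInequality

section MixingCoefficient

variable {n : ℕ} {Ω : Type*}

lemma sigmaAlg_mono {Y₀ : Ω → State n} : Monotone (sigmaAlg Y₀) := fun _ _ h =>
  iSup_mono fun _ => iSup_mono' fun hΨ => ⟨⟨hΨ.1, hΨ.2.trans h⟩, le_rfl⟩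

variable [MeasurableSpace Ω] {P : Measure Ω} {Y₀ : Ω → State n} {r : ℝ}

lemma mixingCoeff_nonneg : 0 ≤ mixingCoeff P Y₀ r := by
  refine Real.sSup_nonneg ?_
  rintro c ⟨𝒜, ℬ, -, -, -, -, -, A, B, -, -, -, rfl⟩
  exact div_nonneg (abs_nonneg _) measureReal_nonneg

variable [IsProbabilityMeasure P]

lemma abs_measureReal_inter_sub_mul_div_le_one (A B : Set Ω) :
    |P.real (A ∩ B) - P.real A * P.real B| / P.real B ≤ 1 := by
  refine div_le_one_of_le₀ (abs_sub_le_iff.2 ⟨?_, ?_⟩) measureReal_nonneg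
  · have : 0 ≤ P.real A * P.real B := mul_nonneg measureReal_nonneg measureReal_nonneg
    linarith [measureReal_mono (μ := P) (inter_subset_right (s := A) (t := B))]
  · have : P.real A * P.real B ≤ P.real B :=
      mul_le_of_le_one_left measureReal_nonneg measureReal_le_one
    linarith [measureReal_nonneg (μ := P) (s := A ∩ B)]

lemma mixingCoeff_le_one : mixingCoeff P Y₀ r ≤ 1 := by
  refine Real.sSup_le ?_ zero_le_one
  rintro c ⟨𝒜, ℬ, -, -, -, -, -, A, B, -, -, -, rfl⟩
  exact abs_measureReal_inter_sub_mul_div_le_one A B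

lemma abs_measureReal_inter_sub_mul_div_le_mixingCoeff {𝒜 ℬ : Set (E n)} (h𝒜 : IsOpen 𝒜)
    (h𝒜' : Bornology.IsBounded 𝒜) (hℬ : IsOpen ℬ) (hℬ' : Bornology.IsBounded ℬ)
    (hr : ∀ x ∈ 𝒜, ∀ y ∈ ℬ, r ≤ dist x y) {A B : Set Ω}
    (hA : MeasurableSet[sigmaAlg Y₀ 𝒜] A) (hB : MeasurableSet[sigmaAlg Y₀ ℬ] B) (hPB : 0 < P B) :
    |P.real (A ∩ B) - P.real A * P.real B| / P.real B ≤ mixingCoeff P Y₀ r := by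
  refine le_csSup ⟨1, ?_⟩ ⟨𝒜, ℬ, h𝒜, h𝒜', hℬ, hℬ', hr, A, B, hA, hB, hPB, rfl⟩
  rintro c ⟨_, _, -, -, -, -, -, A, B, -, -, -, rfl⟩
  exact abs_measureReal_inter_sub_mul_div_le_one A B

lemma abs_measureReal_inter_sub_mul_le_mixingCoeff {𝒜 ℬ : Set (E n)} (h𝒜 : IsOpen 𝒜)
    (h𝒜' : Bornology.IsBounded 𝒜) (hℬ : IsOpen ℬ) (hℬ' : Bornology.IsBounded ℬ)
    (hr : ∀ x ∈ 𝒜, ∀ y ∈ ℬ, r ≤ dist x y) {A B : Set Ω}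
    (hA : MeasurableSet[sigmaAlg Y₀ 𝒜] A) (hB : MeasurableSet[sigmaAlg Y₀ ℬ] B) :
    |P.real (A ∩ B) - P.real A * P.real B| ≤ mixingCoeff P Y₀ r := by
  rcases eq_zero_or_pos (P B) with hPB | hPB
  · have hB0 : P.real B = 0 := by rw [Measure.real, hPB, ENNReal.toReal_zero]
    have hAB0 : P.real (A ∩ B) = 0 := by
      rw [Measure.real, measure_mono_null inter_subset_right hPB, ENNReal.toReal_zero]
    rw [hB0, hAB0, mul_zero, sub_zero, abs_zero]
    exact mixingCoeff_nonneg
  · have hB0 : 0 < P.real B := ENNReal.toReal_pos hPB.ne' (measure_ne_top _ _)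
    exact ((div_le_iff₀ hB0).1 (abs_measureReal_inter_sub_mul_div_le_mixingCoeff h𝒜 h𝒜' hℬ hℬ' hr
      hA hB hPB)).trans (mul_le_of_le_one_right mixingCoeff_nonneg measureReal_le_one)

lemma mixingCoeff_antitone : Antitone (mixingCoeff P Y₀) := by
  intro r s hrs
  refine Real.sSup_le ?_ mixingCoeff_nonneg
  rintro c ⟨𝒜, ℬ, h𝒜, h𝒜', hℬ, hℬ', hdist, A, B, hA, hB, hPB, rfl⟩
  exact abs_measureReal_inter_sub_mul_div_le_mixingCoeff h𝒜 h𝒜' hℬ hℬ'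
    (fun x hx y hy => hrs.trans (hdist x hx y hy)) hA hB hPB

lemma abs_covariance_le_mixingCoeff {𝒜 ℬ : Set (E n)} (h𝒜 : IsOpen 𝒜)
    (h𝒜' : Bornology.IsBounded 𝒜) (hℬ : IsOpen ℬ) (hℬ' : Bornology.IsBounded ℬ)
    (hr : ∀ x ∈ 𝒜, ∀ y ∈ ℬ, r ≤ dist x y) {X Z : Ω → ℝ}
    (hX : Measurable[sigmaAlg Y₀ 𝒜] X) (hZ : Measurable[sigmaAlg Y₀ ℬ] Z)
    (hX' : AEMeasurable X P) (hZ' : AEMeasurable Z P) {a b : ℝ}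
    (ha : ∀ᵐ ω ∂P, |X ω| ≤ a) (hb : ∀ᵐ ω ∂P, |Z ω| ≤ b) :
    |∫ ω, X ω * Z ω ∂P - (∫ ω, X ω ∂P) * ∫ ω, Z ω ∂P| ≤ 4 * a * b * mixingCoeff P Y₀ r :=
  abs_integral_mul_sub_le_of_superlevel hX' hZ' ha hb fun _ _ =>
    abs_measureReal_inter_sub_mul_le_mixingCoeff h𝒜 h𝒜' hℬ hℬ' hr
      (hX measurableSet_Ioi) (hZ measurableSet_Ioi)

end MixingCoefficient

section FourPoints

lemma sub_le_dist_of_mem_ball {M : Type*} [PseudoMetricSpace M] {x y p q : M} {δ r : ℝ}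
    (hp : p ∈ Metric.ball x δ) (hq : q ∈ Metric.ball y δ) (h : r ≤ dist x y) :
    r - 2 * δ ≤ dist p q := by
  rw [Metric.mem_ball] at hp hq
  linarith [dist_triangle4_left p q x y]

-- With `D` the diameter, attained at two of the points: if neither of them is `D / 3`-isolated,
-- each of the other two points lies `D / 3`-close to exactly one of them.
lemma exists_perm_isolated_or_paired {M : Type*} [PseudoMetricSpace M] (p : Fin 4 → M) :
    ∃ (σ : Equiv.Perm (Fin 4)) (r : ℝ), (∀ i j, dist (p i) (p j) / 3 ≤ r) ∧
      ((∀ j ≠ 0, r ≤ dist (p (σ 0)) (p (σ j))) ∨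
        ∀ i ∈ ({0, 1} : Finset (Fin 4)), ∀ j ∉ ({0, 1} : Finset (Fin 4)),
          r ≤ dist (p (σ i)) (p (σ j))) := by
  have hperm : ∀ a b : Fin 4, a ≠ b → ∃ τ : Equiv.Perm (Fin 4), τ 0 = a ∧ τ 1 = b := by decide
  obtain ⟨σ, hσ⟩ := Finite.exists_max fun σ : Equiv.Perm (Fin 4) => dist (p (σ 0)) (p (σ 1))
  set q : Fin 4 → M := p ∘ σ
  set D := dist (q 0) (q 1)
  have hmax (i j : Fin 4) : dist (p i) (p j) ≤ D := by
    rcases eq_or_ne i j with rfl | hij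
    · exact (dist_self _).trans_le dist_nonneg
    · obtain ⟨τ, rfl, rfl⟩ := hperm i j hij
      exact hσ τ
  have hdiam (i j : Fin 4) : dist (p i) (p j) / 3 ≤ D / 3 := by linarith [hmax i j]
  by_cases hisolated₀ : ∀ j ≠ 0, D / 3 ≤ dist (q 0) (q j)
  · exact ⟨σ, D / 3, hdiam, .inl hisolated₀⟩
  by_cases hisolated₁ : ∀ j ≠ 1, D / 3 ≤ dist (q 1) (q j)
  · refine ⟨σ * Equiv.swap 0 1, D / 3, hdiam, .inl fun j hj => ?_⟩
    rw [Equiv.Perm.mul_apply, Equiv.swap_apply_left]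
    refine hisolated₁ _ fun h => hj ?_
    rwa [Equiv.swap_apply_eq_iff, Equiv.swap_apply_right] at h
  push Not at hisolated₀ hisolated₁
  obtain ⟨j, hj0, hj⟩ := hisolated₀
  obtain ⟨k, hk1, hk⟩ := hisolated₁
  have hD0 : 0 ≤ D := dist_nonneg
  have hj1 : j ≠ 1 := by rintro rfl; linarith
  have hk0 : k ≠ 0 := by rintro rfl; rw [dist_comm] at hk; linarith
  have hjk : j ≠ k := by rintro rfl; linarith [dist_triangle_right (q 0) (q 1) (q j)]
  have hpairing : ∀ j k : Fin 4, j ≠ 0 → j ≠ 1 → k ≠ 0 → k ≠ 1 → j ≠ k →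
      ∃ τ : Equiv.Perm (Fin 4), τ 0 = 0 ∧ τ 1 = j ∧ τ 2 = 1 ∧ τ 3 = k := by decide
  obtain ⟨τ, h0, h1, h2, h3⟩ := hpairing j k hj0 hj1 hk0 hk1 hjk
  refine ⟨σ * τ, D / 3, hdiam, .inr ?_⟩
  change ∀ i ∈ _, ∀ l ∉ _, D / 3 ≤ dist (q (τ i)) (q (τ l))
  have hcompl : ∀ l : Fin 4, l ∉ ({0, 1} : Finset (Fin 4)) → l = 2 ∨ l = 3 := by decide
  intro i hi l hl
  rw [Finset.mem_insert, Finset.mem_singleton] at hi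
  have hjk' := dist_triangle4 (q 0) (q j) (q k) (q 1)
  rw [dist_comm (q k)] at hjk'
  rcases hi with rfl | rfl <;> rcases hcompl l hl with rfl | rfl <;> simp only [h0, h1, h2, h3]
  · linarith
  · linarith [dist_triangle_right (q 0) (q 1) (q k)]
  · linarith [dist_triangle (q 0) (q j) (q 1)]
  · linarith

variable {n : ℕ} {Ω : Type*} [MeasurableSpace Ω] {P : Measure Ω} {Y₀ : Ω → State n}
  {X : E n → Ω → ℝ} {δ a : ℝ}

/-- A bounded centred random field whose value at `x` is determined by the initial data in the
`δ`-ball around `x`. -/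
structure IsLocalField (P : Measure Ω) (Y₀ : Ω → State n) (X : E n → Ω → ℝ) (δ a : ℝ) : Prop where
  measurable : ∀ x, Measurable[sigmaAlg Y₀ (Metric.ball x δ)] (X x)
  aemeasurable : ∀ x, AEMeasurable (X x) P
  bound : ∀ᵐ ω ∂P, ∀ x, |X x ω| ≤ a
  mean_zero : ∀ x, ∫ ω, X x ω ∂P = 0

/-- The weight `φ(|x - y| / 3 - 2δ)^{1/2}` which a pair of points contributes to the bound on the
four-point function of a `δ`-local field: four points of diameter `D` split into two clusters at
distance `D / 3`, of which a `δ`-local field sees the `δ`-neighbourhoods. -/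
def pairWeight (P : Measure Ω) (Y₀ : Ω → State n) (δ : ℝ) (x y : E n) : ℝ :=
  √(mixingCoeff P Y₀ (dist x y / 3 - 2 * δ))

lemma pairWeight_nonneg (x y : E n) : 0 ≤ pairWeight P Y₀ δ x y := Real.sqrt_nonneg _

section

variable [IsProbabilityMeasure P]

lemma mixingCoeff_le_pairWeight_mul {r : ℝ} {x y z w : E n} (hxy : dist x y / 3 ≤ r)
    (hzw : dist z w / 3 ≤ r) :
    mixingCoeff P Y₀ (r - 2 * δ) ≤ pairWeight P Y₀ δ x y * pairWeight P Y₀ δ z w := by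
  rw [← Real.mul_self_sqrt (mixingCoeff_nonneg (P := P) (Y₀ := Y₀) (r := r - 2 * δ))]
  have hsqrt {u v : E n} (h : dist u v / 3 ≤ r) :
      √(mixingCoeff P Y₀ (r - 2 * δ)) ≤ pairWeight P Y₀ δ u v :=
    Real.sqrt_le_sqrt (mixingCoeff_antitone (by linarith))
  exact mul_le_mul (hsqrt hxy) (hsqrt hzw) (Real.sqrt_nonneg _) (pairWeight_nonneg _ _)

lemma mixingCoeff_le_pairWeight (x y : E n) :
    mixingCoeff P Y₀ (dist x y - 2 * δ) ≤ pairWeight P Y₀ δ x y := by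
  have hdist : dist x y / 3 - 2 * δ ≤ dist x y - 2 * δ := by
    linarith [dist_nonneg (x := x) (y := y)]
  refine (mixingCoeff_antitone hdist).trans (Real.le_sqrt_of_sq_le ?_)
  exact pow_le_of_le_one mixingCoeff_nonneg mixingCoeff_le_one two_ne_zero

end

namespace IsLocalField

variable {ι : Type*} (hX : IsLocalField P Y₀ X δ a)
include hX

lemma measurable_prod (p : ι → E n) (s : Finset ι) :
    Measurable[sigmaAlg Y₀ (⋃ i ∈ s, Metric.ball (p i) δ)] fun ω => ∏ i ∈ s, X (p i) ω := by
  refine Finset.measurable_fun_prod s fun i hi => (hX.measurable (p i)).mono ?_ le_rfl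
  exact sigmaAlg_mono (subset_biUnion_of_mem (u := fun i => Metric.ball (p i) δ) hi)

lemma ae_abs_prod_le (p : ι → E n) (s : Finset ι) :
    ∀ᵐ ω ∂P, |∏ i ∈ s, X (p i) ω| ≤ a ^ s.card := by
  filter_upwards [hX.bound] with ω hω
  rw [Finset.abs_prod]
  exact (Finset.prod_le_prod (fun _ _ => abs_nonneg _) fun i _ => hω (p i)).trans_eq
    (Finset.prod_const a)

variable [IsProbabilityMeasure P]

lemma nonneg : 0 ≤ a := by
  obtain ⟨ω, hω⟩ := hX.bound.exists
  exact (abs_nonneg _).trans (hω 0)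

variable [Fintype ι]

lemma abs_integral_prod_sub_le_of_separated [DecidableEq ι] (p : ι → E n) (s : Finset ι) {r : ℝ}
    (hr : ∀ i ∈ s, ∀ j ∉ s, r ≤ dist (p i) (p j)) :
    |∫ ω, ∏ i, X (p i) ω ∂P - (∫ ω, ∏ i ∈ s, X (p i) ω ∂P) * ∫ ω, ∏ i ∈ sᶜ, X (p i) ω ∂P| ≤
      4 * a ^ Fintype.card ι * mixingCoeff P Y₀ (r - 2 * δ) := by
  have hopen (t : Finset ι) : IsOpen (⋃ i ∈ t, Metric.ball (p i) δ) :=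
    isOpen_biUnion fun _ _ => Metric.isOpen_ball
  have hbdd (t : Finset ι) : Bornology.IsBounded (⋃ i ∈ t, Metric.ball (p i) δ) :=
    (Bornology.isBounded_biUnion_finset t).2 fun _ _ => Metric.isBounded_ball
  have haem (t : Finset ι) : AEMeasurable (fun ω => ∏ i ∈ t, X (p i) ω) P :=
    Finset.aemeasurable_fun_prod t fun i _ => hX.aemeasurable (p i)
  have hdist : ∀ x ∈ ⋃ i ∈ s, Metric.ball (p i) δ, ∀ y ∈ ⋃ i ∈ sᶜ, Metric.ball (p i) δ,
      r - 2 * δ ≤ dist x y := by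
    intro x hx y hy
    obtain ⟨i, hi, hxi⟩ := mem_iUnion₂.1 hx
    obtain ⟨j, hj, hyj⟩ := mem_iUnion₂.1 hy
    exact sub_le_dist_of_mem_ball hxi hyj (hr i hi j (Finset.mem_compl.1 hj))
  have hcov := abs_covariance_le_mixingCoeff (hopen s) (hbdd s) (hopen sᶜ) (hbdd sᶜ) hdist
    (hX.measurable_prod p s) (hX.measurable_prod p sᶜ) (haem s) (haem sᶜ)
    (hX.ae_abs_prod_le p s) (hX.ae_abs_prod_le p sᶜ)
  simpa only [Finset.prod_mul_prod_compl, mul_assoc, ← pow_add, Finset.card_add_card_compl]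
    using hcov

lemma abs_integral_prod_le_of_isolated (p : ι → E n) (i : ι) {r : ℝ}
    (hr : ∀ j ≠ i, r ≤ dist (p i) (p j)) :
    |∫ ω, ∏ j, X (p j) ω ∂P| ≤ 4 * a ^ Fintype.card ι * mixingCoeff P Y₀ (r - 2 * δ) := by
  classical
  have hsep : ∀ k ∈ ({i} : Finset ι), ∀ j ∉ ({i} : Finset ι), r ≤ dist (p k) (p j) := by
    simpa only [Finset.mem_singleton, forall_eq] using hr
  simpa only [Finset.prod_singleton, hX.mean_zero, zero_mul, sub_zero] using
    hX.abs_integral_prod_sub_le_of_separated p {i} hsep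

omit [Fintype ι]

lemma abs_integral_two_le (x y : E n) :
    |∫ ω, X x ω * X y ω ∂P| ≤ 4 * a ^ 2 * pairWeight P Y₀ δ x y := by
  have hr : ∀ j ≠ (0 : Fin 2), dist x y ≤ dist (![x, y] 0) (![x, y] j) := by
    rw [Fin.forall_fin_two]
    exact ⟨fun h => (h rfl).elim, fun _ => le_rfl⟩
  have htwo := hX.abs_integral_prod_le_of_isolated ![x, y] 0 hr
  simp only [Fin.prod_univ_two, Fintype.card_fin] at htwo
  exact htwo.trans (mul_le_mul_of_nonneg_left (mixingCoeff_le_pairWeight x y)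
    (show 0 ≤ 4 * a ^ 2 by positivity))

lemma abs_integral_four_le_of_separated (p : Fin 4 → E n) {r : ℝ}
    (hdiam : ∀ i j, dist (p i) (p j) / 3 ≤ r)
    (hr : ∀ i ∈ ({0, 1} : Finset (Fin 4)), ∀ j ∉ ({0, 1} : Finset (Fin 4)),
      r ≤ dist (p i) (p j)) :
    |∫ ω, ∏ i, X (p i) ω ∂P| ≤
      20 * a ^ 4 * (pairWeight P Y₀ δ (p 0) (p 1) * pairWeight P Y₀ δ (p 2) (p 3)) := by
  have hcompl : ({0, 1} : Finset (Fin 4))ᶜ = {2, 3} := by decide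
  have hcov := hX.abs_integral_prod_sub_le_of_separated p {0, 1} hr
  rw [hcompl] at hcov
  simp only [Finset.prod_pair (show (0 : Fin 4) ≠ 1 by decide),
    Finset.prod_pair (show (2 : Fin 4) ≠ 3 by decide), Fintype.card_fin] at hcov
  have hpairs := mul_le_mul (hX.abs_integral_two_le (p 0) (p 1))
    (hX.abs_integral_two_le (p 2) (p 3)) (abs_nonneg _)
    ((abs_nonneg _).trans (hX.abs_integral_two_le _ _))
  have hmix := mul_le_mul_of_nonneg_left (mixingCoeff_le_pairWeight_mul (P := P) (Y₀ := Y₀)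
    (δ := δ) (hdiam 0 1) (hdiam 2 3)) (show 0 ≤ 4 * a ^ 4 by have := hX.nonneg; positivity)
  rw [← abs_mul] at hpairs
  have htriangle := abs_sub_abs_le_abs_sub (∫ ω, ∏ i, X (p i) ω ∂P)
    ((∫ ω, X (p 0) ω * X (p 1) ω ∂P) * ∫ ω, X (p 2) ω * X (p 3) ω ∂P)
  linarith

lemma exists_perm_abs_integral_four_le (p : Fin 4 → E n) :
    ∃ σ : Equiv.Perm (Fin 4), |∫ ω, ∏ i, X (p i) ω ∂P| ≤ 20 * a ^ 4 *
      (pairWeight P Y₀ δ (p (σ 0)) (p (σ 1)) * pairWeight P Y₀ δ (p (σ 2)) (p (σ 3))) := by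
  obtain ⟨σ, r, hdiam, hσ⟩ := exists_perm_isolated_or_paired p
  have hperm : (fun ω => ∏ i, X (p i) ω) = fun ω => ∏ i, X ((p ∘ σ) i) ω :=
    funext fun ω => (Equiv.prod_comp σ fun i => X (p i) ω).symm
  refine ⟨σ, ?_⟩
  rw [hperm]
  rcases hσ with hisolated | hpaired
  · have hmix := mixingCoeff_le_pairWeight_mul (P := P) (Y₀ := Y₀) (δ := δ)
      (hdiam (σ 0) (σ 1)) (hdiam (σ 2) (σ 3))
    refine (hX.abs_integral_prod_le_of_isolated (p ∘ σ) 0 hisolated).trans ?_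
    rw [Fintype.card_fin]
    gcongr
    · exact mixingCoeff_nonneg
    · norm_num
  · exact hX.abs_integral_four_le_of_separated (p ∘ σ) (fun _ _ => hdiam _ _) hpaired

end IsLocalField

end FourPoints

section FourthMoment

lemma measurePreserving_prod_prod_perm {α : Type*} [MeasurableSpace α] (μ : Measure α)
    [SigmaFinite μ] (σ : Equiv.Perm (Fin 4)) :
    MeasurePreserving
      (fun (p : (α × α) × (α × α)) i => ![p.1.1, p.1.2, p.2.1, p.2.2] (σ.symm i))
      ((μ.prod μ).prod (μ.prod μ)) (Measure.pi fun _ => μ) := by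
  have hmeas : Measurable fun (p : (α × α) × (α × α)) (i : Fin 4) =>
      ![p.1.1, p.1.2, p.2.1, p.2.2] (σ.symm i) := by
    refine measurable_pi_lambda _ fun i => ?_
    generalize σ.symm i = k
    fin_cases k
    exacts [measurable_fst.fst, measurable_fst.snd, measurable_snd.fst, measurable_snd.snd]
  refine ⟨hmeas, (Measure.pi_eq fun s hs => ?_).symm⟩
  have hpre : (fun (p : (α × α) × (α × α)) i => ![p.1.1, p.1.2, p.2.1, p.2.2] (σ.symm i)) ⁻¹'
      univ.pi s = (s (σ 0) ×ˢ s (σ 1)) ×ˢ (s (σ 2) ×ˢ s (σ 3)) := by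
    ext p
    rw [mem_preimage, mem_univ_pi, ← σ.forall_congr_right]
    simp [Fin.forall_fin_succ, and_assoc]
  rw [Measure.map_apply hmeas (.univ_pi hs), hpre, Measure.prod_prod, Measure.prod_prod,
    Measure.prod_prod, ← Equiv.prod_comp σ, Fin.prod_univ_four]
  ring

lemma measurable_mul_perm {α : Type*} [MeasurableSpace α] {V : α → α → ℝ≥0∞}
    (hV : Measurable V.uncurry) (σ : Equiv.Perm (Fin 4)) :
    Measurable fun q : Fin 4 → α => V (q (σ 0)) (q (σ 1)) * V (q (σ 2)) (q (σ 3)) := by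
  have hVeval (i j : Fin 4) : Measurable fun q : Fin 4 → α => V (q i) (q j) :=
    hV.comp (f := fun q : Fin 4 → α => (q i, q j)) (by fun_prop)
  exact (hVeval _ _).mul (hVeval _ _)

lemma lintegral_pi_mul_perm {α : Type*} [MeasurableSpace α] (μ : Measure α) [SigmaFinite μ]
    {V : α → α → ℝ≥0∞} (hV : Measurable V.uncurry) (σ : Equiv.Perm (Fin 4)) :
    ∫⁻ q, V (q (σ 0)) (q (σ 1)) * V (q (σ 2)) (q (σ 3)) ∂(Measure.pi fun _ => μ) =
      (∫⁻ x, ∫⁻ y, V x y ∂μ ∂μ) ^ 2 := by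
  rw [← (measurePreserving_prod_prod_perm μ σ).lintegral_comp (measurable_mul_perm hV σ)]
  simp only [Equiv.symm_apply_apply]
  exact (lintegral_prod_mul hV.aemeasurable hV.aemeasurable).trans
    (by rw [sq, lintegral_prod _ hV.aemeasurable]; rfl)

variable {n : ℕ} {Ω : Type*} [MeasurableSpace Ω] {P : Measure Ω} [IsProbabilityMeasure P]
  {Y₀ : Ω → State n}

/-- The bound for the integral of the pair weight with respect to one of its points, when `φ̄ ≤ K`:
the unit ball accounts for the range where the weight is bounded only by `1`, and `6ⁿ` for the
comparison `|z| / 3 - 2δ ≥ |z| / 6` outside it. -/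
def pairBound (n : ℕ) (K : ℝ) : ℝ :=
  volume.real (Metric.closedBall (0 : E n) 1) +
    6 ^ n * (n * (volume.real (Metric.ball (0 : E n) 1) * K))

lemma pairBound_nonneg (n : ℕ) {K : ℝ} (hK : 0 ≤ K) : 0 ≤ pairBound n K := by
  unfold pairBound; positivity

lemma measurable_sqrt_mixingCoeff : Measurable fun r => √(mixingCoeff P Y₀ r) :=
  mixingCoeff_antitone.measurable.sqrt

lemma integrableOn_and_setIntegral_sqrt_mixingCoeff_le {K : ℝ≥0}
    (hK : mixingIntegral P Y₀ ≤ K) :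
    IntegrableOn (fun r : ℝ => r ^ (n - 1) * √(mixingCoeff P Y₀ r)) (Ioi 0) ∧
      ∫ r in Ioi (0 : ℝ), r ^ (n - 1) * √(mixingCoeff P Y₀ r) ≤ K := by
  have hmeas : Measurable fun r : ℝ => r ^ (n - 1) * √(mixingCoeff P Y₀ r) :=
    (measurable_id.pow_const _).mul measurable_sqrt_mixingCoeff
  have hnonneg : 0 ≤ᵐ[volume.restrict (Ioi 0)]
      fun r : ℝ => r ^ (n - 1) * √(mixingCoeff P Y₀ r) := by
    filter_upwards [ae_restrict_mem measurableSet_Ioi] with r hr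
    exact mul_nonneg (pow_nonneg (le_of_lt hr) _) (Real.sqrt_nonneg _)
  refine ⟨⟨hmeas.aestronglyMeasurable, ?_⟩, ?_⟩
  · rw [hasFiniteIntegral_iff_ofReal hnonneg]
    exact hK.trans_lt ENNReal.coe_lt_top
  · rw [integral_eq_lintegral_of_nonneg_ae hnonneg hmeas.aestronglyMeasurable]
    exact ENNReal.toReal_le_coe_of_le_coe hK

lemma lintegral_sqrt_mixingCoeff_norm_le (hn : 1 ≤ n) {K : ℝ≥0} (hK : mixingIntegral P Y₀ ≤ K) :
    ∫⁻ x : E n, ENNReal.ofReal √(mixingCoeff P Y₀ (‖x‖ / 6)) ≤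
      ENNReal.ofReal (6 ^ n * (n * (volume.real (Metric.ball (0 : E n) 1) * K))) := by
  have : Nonempty (Fin n) := ⟨⟨0, hn⟩⟩
  obtain ⟨hradial, hradial_le⟩ := integrableOn_and_setIntegral_sqrt_mixingCoeff_le hK
  have hdim : Module.finrank ℝ (E n) = n := finrank_euclideanSpace_fin
  have hint : Integrable fun x : E n => √(mixingCoeff P Y₀ ‖x‖) := by
    rw [integrable_fun_norm_addHaar volume (f := fun r => √(mixingCoeff P Y₀ r)), hdim]
    exact hradial
  have hscale : (fun x : E n => √(mixingCoeff P Y₀ (‖x‖ / 6))) =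
      fun x => √(mixingCoeff P Y₀ ‖(6 : ℝ)⁻¹ • x‖) := by
    ext x
    rw [norm_smul, norm_inv, Real.norm_ofNat, div_eq_inv_mul]
  have hint' : Integrable fun x : E n => √(mixingCoeff P Y₀ (‖x‖ / 6)) := by
    rw [hscale]
    exact hint.comp_smul (by norm_num)
  rw [← ofReal_integral_eq_lintegral_ofReal hint' (.of_forall fun x => Real.sqrt_nonneg _), hscale,
    Measure.integral_comp_inv_smul volume fun y : E n => √(mixingCoeff P Y₀ ‖y‖),
    integral_fun_norm_addHaar volume fun r => √(mixingCoeff P Y₀ r), hdim,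
    abs_of_nonneg (by positivity)]
  simp only [smul_eq_mul, nsmul_eq_mul]
  gcongr

lemma measurable_pairWeight (δ : ℝ) :
    Measurable fun p : E n × E n => ENNReal.ofReal (pairWeight P Y₀ δ p.1 p.2) :=
  ENNReal.measurable_ofReal.comp (measurable_sqrt_mixingCoeff.comp (by fun_prop))

lemma lintegral_pairWeight_le (hn : 1 ≤ n) {K : ℝ≥0} (hK : mixingIntegral P Y₀ ≤ K) {δ : ℝ}
    (hδ : δ ≤ 1 / 12) (x : E n) :
    ∫⁻ y, ENNReal.ofReal (pairWeight P Y₀ δ x y) ≤ ENNReal.ofReal (pairBound n K) := by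
  let H : E n → ℝ≥0∞ := fun y => (Metric.closedBall (0 : E n) 1).indicator 1 y +
    ENNReal.ofReal √(mixingCoeff P Y₀ (‖y‖ / 6))
  have hle (y : E n) : ENNReal.ofReal (pairWeight P Y₀ δ x y) ≤ H (y - x) := by
    simp only [pairWeight, H, dist_comm x y, dist_eq_norm]
    by_cases hy : ‖y - x‖ ≤ 1
    · refine le_add_right ?_
      rw [indicator_of_mem (mem_closedBall_zero_iff.2 hy), Pi.one_apply, ← ENNReal.ofReal_one]
      exact ENNReal.ofReal_le_ofReal (Real.sqrt_le_one.2 mixingCoeff_le_one)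
    · exact le_add_left (ENNReal.ofReal_le_ofReal (Real.sqrt_le_sqrt (mixingCoeff_antitone
        (by linarith))))
  calc ∫⁻ y, ENNReal.ofReal (pairWeight P Y₀ δ x y) ≤ ∫⁻ y, H (y - x) := lintegral_mono hle
    _ = ∫⁻ y, H y := lintegral_sub_right_eq_self H x
    _ = volume (Metric.closedBall (0 : E n) 1) +
        ∫⁻ y : E n, ENNReal.ofReal √(mixingCoeff P Y₀ (‖y‖ / 6)) := by
      rw [lintegral_add_left (measurable_one.indicator measurableSet_closedBall),
        lintegral_indicator_one measurableSet_closedBall]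
    _ ≤ ENNReal.ofReal (pairBound n K) := by
      unfold pairBound
      rw [ENNReal.ofReal_add (by positivity) (by positivity),
        ofReal_measureReal measure_closedBall_lt_top.ne]
      gcongr
      exact lintegral_sqrt_mixingCoeff_norm_le hn hK

/-- The pair weight with its first point confined to `S`, as a kernel for integrals over pairs of
points. -/
def confinedPairWeight (P : Measure Ω) (Y₀ : Ω → State n) (δ : ℝ) (S : Set (E n)) (x y : E n) :
    ℝ≥0∞ :=
  S.indicator (fun x => ENNReal.ofReal (pairWeight P Y₀ δ x y)) x

lemma measurable_confinedPairWeight {δ : ℝ} {S : Set (E n)} (hS : MeasurableSet S) :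
    Measurable (confinedPairWeight P Y₀ δ S).uncurry :=
  (measurable_pairWeight δ).indicator (measurable_fst hS)

lemma lintegral_confinedPairWeight_le (hn : 1 ≤ n) {K : ℝ≥0} (hK : mixingIntegral P Y₀ ≤ K)
    {δ : ℝ} (hδ : δ ≤ 1 / 12) {S : Set (E n)} (hS : MeasurableSet S) :
    ∫⁻ x, ∫⁻ y, confinedPairWeight P Y₀ δ S x y ≤
      volume S * ENNReal.ofReal (pairBound n K) := by
  calc ∫⁻ x, ∫⁻ y, confinedPairWeight P Y₀ δ S x y
      ≤ ∫⁻ x, S.indicator (fun _ => ENNReal.ofReal (pairBound n K)) x := by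
        refine lintegral_mono fun x => ?_
        by_cases hx : x ∈ S
        · simpa only [confinedPairWeight, indicator_of_mem hx] using
            lintegral_pairWeight_le hn hK hδ x
        · simp only [confinedPairWeight, indicator_of_notMem hx, lintegral_zero, le_refl]
    _ = volume S * ENNReal.ofReal (pairBound n K) := by
        rw [lintegral_indicator_const hS, mul_comm]

namespace IsLocalField

variable {X : E n → Ω → ℝ} {δ a : ℝ} (hX : IsLocalField P Y₀ X δ a) {S : Set (E n)}
  (hXS : ∀ x ∉ S, ∀ ω, X x ω = 0)
include hX hXS

lemma enorm_integral_four_le (q : Fin 4 → E n) :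
    ‖∫ ω, ∏ i, X (q i) ω ∂P‖ₑ ≤ ENNReal.ofReal (20 * a ^ 4) * ∑ σ : Equiv.Perm (Fin 4),
      confinedPairWeight P Y₀ δ S (q (σ 0)) (q (σ 1)) *
        confinedPairWeight P Y₀ δ S (q (σ 2)) (q (σ 3)) := by
  by_cases hqS : ∀ i, q i ∈ S
  · obtain ⟨σ, hσ⟩ := hX.exists_perm_abs_integral_four_le q
    refine le_trans ?_ (mul_le_mul_right (Finset.single_le_sum (fun _ _ => zero_le)
      (Finset.mem_univ σ)) _)
    simp only [confinedPairWeight, indicator_of_mem (hqS _)]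
    rw [← ENNReal.ofReal_mul (pairWeight_nonneg _ _), ← ENNReal.ofReal_mul (by positivity),
      Real.enorm_eq_ofReal_abs]
    exact ENNReal.ofReal_le_ofReal hσ
  · push Not at hqS
    obtain ⟨i, hi⟩ := hqS
    have hzero (ω : Ω) : ∏ i, X (q i) ω = 0 :=
      Finset.prod_eq_zero (Finset.mem_univ i) (hXS _ hi ω)
    simp only [hzero, integral_zero, enorm_zero, zero_le]

lemma integrable_prod (hS : MeasurableSet S) (hSv : volume S < ∞)
    (hXm : AEStronglyMeasurable (fun p : Ω × E n => X p.2 p.1) (P.prod volume)) (k : ℕ) :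
    Integrable (fun p : Ω × (Fin k → E n) => ∏ i, X (p.2 i) p.1) (P.prod volume) := by
  have hSk : MeasurableSet (univ.pi fun _ : Fin k => S) := .univ_pi fun _ => hS
  have hmeas : AEStronglyMeasurable (fun p : Ω × (Fin k → E n) => ∏ i, X (p.2 i) p.1)
      (P.prod volume) :=
    Finset.aestronglyMeasurable_fun_prod _ fun i _ => hXm.comp_quasiMeasurePreserving
      (f := Prod.map id fun x : Fin k → E n => x i)
      (MeasureTheory.QuasiMeasurePreserving.prodMap (.id P)
        (Measure.quasiMeasurePreserving_eval (fun _ => volume) i))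
  refine Integrable.mono' (g := (univ ×ˢ univ.pi fun _ => S).indicator fun _ => a ^ k) ?_ hmeas ?_
  · rw [integrable_indicator_iff (MeasurableSet.univ.prod hSk)]
    refine integrableOn_const ?_
    rw [Measure.prod_prod, volume_pi_pi, Finset.prod_const]
    exact ENNReal.mul_ne_top (measure_ne_top _ _) (ENNReal.pow_ne_top hSv.ne)
  · filter_upwards [Measure.quasiMeasurePreserving_fst.ae hX.bound] with p hp
    by_cases hpS : p.2 ∈ univ.pi fun _ => S
    · rw [indicator_of_mem (mk_mem_prod (mem_univ _) hpS), Real.norm_eq_abs, Finset.abs_prod]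
      refine (Finset.prod_le_prod (fun _ _ => abs_nonneg _) fun i _ => hp (p.2 i)).trans_eq ?_
      rw [Finset.prod_const, Finset.card_univ, Fintype.card_fin]
    · rw [indicator_of_notMem fun h => hpS h.2]
      simp only [mem_univ_pi, not_forall] at hpS
      obtain ⟨i, hi⟩ := hpS
      rw [Finset.prod_eq_zero (Finset.mem_univ i) (hXS _ hi _), norm_zero]

lemma integral_fourth_le (hn : 1 ≤ n) {K : ℝ≥0} (hK : mixingIntegral P Y₀ ≤ K) (hδ : δ ≤ 1 / 12)
    (hS : MeasurableSet S) (hSv : volume S < ∞)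
    (hXm : AEStronglyMeasurable (fun p : Ω × E n => X p.2 p.1) (P.prod volume)) :
    ∫ ω, (∫ x, X x ω) ^ 4 ∂P ≤ 480 * a ^ 4 * (volume.real S * pairBound n K) ^ 2 := by
  have hpow (ω : Ω) : (∫ x, X x ω) ^ 4 = ∫ q : Fin 4 → E n, ∏ i, X (q i) ω := by
    rw [integral_fintype_prod_volume_eq_pow (fun x => X x ω), Fintype.card_fin]
  simp only [hpow]
  rw [integral_integral_swap (hX.integrable_prod hXS hS hSv hXm 4)]
  have hpairBound : 0 ≤ pairBound n K := pairBound_nonneg n K.coe_nonneg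
  refine (le_abs_self _).trans ((ENNReal.ofReal_le_ofReal_iff (by positivity)).1 ?_)
  rw [← Real.enorm_eq_ofReal_abs]
  have hV := measurable_confinedPairWeight (P := P) (Y₀ := Y₀) (δ := δ) hS
  calc ‖∫ q : Fin 4 → E n, ∫ ω, ∏ i, X (q i) ω ∂P‖ₑ
      ≤ ∫⁻ q : Fin 4 → E n, ‖∫ ω, ∏ i, X (q i) ω ∂P‖ₑ := enorm_integral_le_lintegral_enorm _
    _ ≤ ENNReal.ofReal (20 * a ^ 4) * ∑ _σ : Equiv.Perm (Fin 4),
          (∫⁻ x, ∫⁻ y, confinedPairWeight P Y₀ δ S x y) ^ 2 := by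
        refine (lintegral_mono (hX.enorm_integral_four_le hXS)).trans_eq ?_
        rw [lintegral_const_mul' _ _ ENNReal.ofReal_ne_top,
          lintegral_finsetSum _ fun σ _ => measurable_mul_perm hV σ]
        simp only [volume_pi, lintegral_pi_mul_perm volume hV]
    _ ≤ ENNReal.ofReal (20 * a ^ 4) * ∑ _σ : Equiv.Perm (Fin 4),
          (volume S * ENNReal.ofReal (pairBound n K)) ^ 2 := by
        gcongr
        exact lintegral_confinedPairWeight_le hn hK hδ hS
    _ = ENNReal.ofReal (480 * a ^ 4 * (volume.real S * pairBound n K) ^ 2) := by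
        rw [← ofReal_measureReal hSv.ne, ← ENNReal.ofReal_mul measureReal_nonneg,
          ← ENNReal.ofReal_pow (by positivity), Finset.sum_const, Finset.card_univ,
          Fintype.card_perm, Fintype.card_fin, ← ENNReal.ofReal_nsmul,
          ← ENNReal.ofReal_mul (by positivity)]
        congr 1
        simp [Nat.factorial]
        ring

end IsLocalField

end FourthMoment

section DotProduct

/-- The real scalar product `∑ Re (yᵢ c̄ᵢ)` on `ℂ²`, as a linear form in `c`: the integrand of
`pairing`. -/
def dotCLM (y : Fin 2 → ℂ) : (Fin 2 → ℂ) →L[ℝ] ℝ :=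
  ∑ i, Complex.reCLM ∘L (ContinuousLinearMap.mul ℝ ℂ (y i)) ∘L
    (Complex.conjCLE : ℂ →L[ℝ] ℂ) ∘L ContinuousLinearMap.proj i

lemma dotCLM_apply (y c : Fin 2 → ℂ) :
    dotCLM y c = ∑ i, (y i * (starRingEnd ℂ) (c i)).re := by
  simp [dotCLM]

attribute [irreducible] dotCLM

lemma dotCLM_comm (y c : Fin 2 → ℂ) : dotCLM y c = dotCLM c y := by
  simp only [dotCLM_apply, Complex.mul_re, Complex.conj_re, Complex.conj_im]
  congr 1; ext i; ring

lemma abs_dotCLM_le (y c : Fin 2 → ℂ) : |dotCLM y c| ≤ (‖y 0‖ + ‖y 1‖) * ‖c‖ := by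
  have hterm (i : Fin 2) : |(y i * (starRingEnd ℂ) (c i)).re| ≤ ‖y i‖ * ‖c‖ := by
    refine (Complex.abs_re_le_norm _).trans ?_
    rw [norm_mul, RCLike.norm_conj]
    exact mul_le_mul_of_nonneg_left (norm_le_pi_norm c i) (norm_nonneg _)
  rw [dotCLM_apply, Fin.sum_univ_two, add_mul]
  exact (abs_add_le _ _).trans (add_le_add (hterm 0) (hterm 1))

lemma continuous_dotCLM : Continuous fun p : (Fin 2 → ℂ) × (Fin 2 → ℂ) => dotCLM p.1 p.2 := by
  simp only [dotCLM_apply]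
  fun_prop

lemma aestronglyMeasurable_dotCLM {α : Type*} [MeasurableSpace α] {μ : Measure α}
    {f g : α → Fin 2 → ℂ} (hf : AEStronglyMeasurable f μ) (hg : AEStronglyMeasurable g μ) :
    AEStronglyMeasurable (fun p => dotCLM (f p) (g p)) μ :=
  continuous_dotCLM.comp_aestronglyMeasurable (hf.prodMk hg)

variable {n : ℕ}

lemma pairing_eq_integral_dotCLM (Y f : State n) : pairing Y f = ∫ x, dotCLM (Y x) (f x) := by
  simp only [pairing, dotCLM_apply]

lemma abs_pairing_le {Y f : State n} {Λ M : ℝ} (hY : ∀ᵐ x : E n, ‖Y x 0‖ + ‖Y x 1‖ ≤ Λ)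
    (hM : ∀ x, ‖f x‖ ≤ M) {S : Set (E n)} (hSv : volume S < ∞) (hfS : ∀ x ∉ S, f x = 0) :
    |pairing Y f| ≤ Λ * M * volume.real S := by
  rw [pairing_eq_integral_dotCLM, ← setIntegral_eq_integral_of_forall_compl_eq_zero (s := S)
    fun x hx => by rw [hfS x hx, map_zero], ← Real.norm_eq_abs]
  refine norm_setIntegral_le_of_norm_le_const_ae' hSv ?_
  filter_upwards [hY] with x hx _
  exact (abs_dotCLM_le _ _).trans (mul_le_mul hx (hM x) (norm_nonneg _)
    ((add_nonneg (norm_nonneg _) (norm_nonneg _)).trans hx))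

end DotProduct

section Mollification

open scoped Convolution

variable {n : ℕ} {Y f : State n} {Λ M : ℝ} {S : Set (E n)} (φ : ContDiffBump (0 : E n))

lemma normed_sub_eq_zero {x y : E n} (h : φ.rOut ≤ dist y x) : φ.normed volume (y - x) = 0 := by
  rw [← Function.notMem_support, φ.support_normed_eq, mem_ball_zero_iff, ← dist_eq_norm]
  exact h.not_gt

lemma integral_normed_sub_right (x : E n) : ∫ y, φ.normed volume (y - x) = 1 := by
  rw [integral_sub_right_eq_self (fun y => φ.normed volume y), φ.integral_normed]

lemma integral_normed_sub_left (y : E n) : ∫ x, φ.normed volume (y - x) = 1 := by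
  rw [integral_sub_left_eq_self (fun y => φ.normed volume y), φ.integral_normed]

lemma abs_dotCLM_normed_smul_le {y c : Fin 2 → ℂ} (hy : ‖y 0‖ + ‖y 1‖ ≤ Λ) (z : E n) :
    |dotCLM y (φ.normed volume z • c)| ≤ Λ * (‖c‖ * φ.normed volume z) := by
  refine (abs_dotCLM_le _ _).trans ?_
  rw [norm_smul, Real.norm_of_nonneg (φ.nonneg_normed _), mul_comm (φ.normed volume z)]
  exact mul_le_mul_of_nonneg_right hy (mul_nonneg (norm_nonneg _) (φ.nonneg_normed _))

/-- The test pair `y ↦ φ(y - x) c` made from a normalised bump function `φ`. -/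
def bumpPair (φ : ContDiffBump (0 : E n)) (x : E n) (c : Fin 2 → ℂ) : State n :=
  fun y => φ.normed volume (y - x) • c

lemma tsupport_bumpPair_subset (x : E n) (c : Fin 2 → ℂ) :
    tsupport (bumpPair φ x c) ⊆ Metric.closedBall x φ.rOut := by
  refine closure_minimal (fun y hy => ?_) Metric.isClosed_closedBall
  contrapose! hy
  rw [Metric.mem_closedBall, not_le] at hy
  rw [Function.notMem_support, bumpPair, normed_sub_eq_zero φ hy.le, zero_smul]

lemma isTestPair_bumpPair (x : E n) (c : Fin 2 → ℂ) : IsTestPair (bumpPair φ x c) :=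
  ⟨(φ.contDiff_normed.comp (contDiff_id.sub contDiff_const)).smul contDiff_const,
    .of_support_subset_isCompact (isCompact_closedBall x φ.rOut)
      ((subset_tsupport _).trans (tsupport_bumpPair_subset φ x c))⟩

/-- `x ↦ ⟨Y, φ(· - x) f(x)⟩`: the local density of the pairing of `f` with the mollification
of `Y`. -/
def mollified (Y : State n) (φ : ContDiffBump (0 : E n)) (f : State n) (x : E n) : ℝ :=
  pairing Y (bumpPair φ x (f x))

lemma mollified_eq_zero {x : E n} (hx : f x = 0) : mollified Y φ f x = 0 := by
  simp only [mollified, pairing_eq_integral_dotCLM, bumpPair, hx, smul_zero, map_zero,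
    integral_zero]

lemma abs_mollified_le (hY : ∀ᵐ x : E n, ‖Y x 0‖ + ‖Y x 1‖ ≤ Λ) (x : E n) :
    |mollified Y φ f x| ≤ Λ * ‖f x‖ := by
  have hint : Integrable fun y => Λ * (‖f x‖ * φ.normed volume (y - x)) :=
    ((φ.integrable_normed.comp_sub_right x).const_mul _).const_mul _
  rw [mollified, pairing_eq_integral_dotCLM, ← Real.norm_eq_abs]
  refine (norm_integral_le_of_norm_le hint ?_).trans_eq ?_
  · filter_upwards [hY] with y hy using abs_dotCLM_normed_smul_le φ hy _
  · rw [integral_const_mul, integral_const_mul, integral_normed_sub_right, mul_one]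

lemma abs_mollified_le_of_norm_le (hY : ∀ᵐ x : E n, ‖Y x 0‖ + ‖Y x 1‖ ≤ Λ)
    (hM : ∀ x, ‖f x‖ ≤ M) (x : E n) : |mollified Y φ f x| ≤ Λ * M := by
  obtain ⟨y, hy⟩ := hY.exists
  exact (abs_mollified_le φ hY x).trans (mul_le_mul_of_nonneg_left (hM x)
    ((add_nonneg (norm_nonneg _) (norm_nonneg _)).trans hy))

lemma abs_integral_mollified_le (hY : ∀ᵐ x : E n, ‖Y x 0‖ + ‖Y x 1‖ ≤ Λ)
    (hM : ∀ x, ‖f x‖ ≤ M) (hSv : volume S < ∞) (hfS : ∀ x ∉ S, f x = 0) :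
    |∫ x, mollified Y φ f x| ≤ Λ * M * volume.real S := by
  rw [← setIntegral_eq_integral_of_forall_compl_eq_zero (s := S)
    fun x hx => mollified_eq_zero φ (hfS x hx), ← Real.norm_eq_abs]
  exact norm_setIntegral_le_of_norm_le_const hSv
    fun x _ => abs_mollified_le_of_norm_le φ hY hM x

lemma convolution_normed_eq (f : State n) (y : E n) :
    (φ.normed volume ⋆[ContinuousLinearMap.lsmul ℝ ℝ, volume] f) y =
      ∫ x, φ.normed volume (y - x) • f x := by
  rw [convolution_eq_swap]
  rfl

lemma norm_convolution_normed_le (hM : ∀ x, ‖f x‖ ≤ M) (y : E n) :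
    ‖(φ.normed volume ⋆[ContinuousLinearMap.lsmul ℝ ℝ, volume] f) y‖ ≤ M := by
  rw [convolution_normed_eq]
  refine (norm_integral_le_of_norm_le (((φ.integrable_normed).comp_sub_left y).mul_const M)
    (.of_forall fun x => ?_)).trans_eq ?_
  · rw [norm_smul, Real.norm_of_nonneg (φ.nonneg_normed _)]
    exact mul_le_mul_of_nonneg_left (hM x) (φ.nonneg_normed _)
  · rw [integral_mul_const, integral_normed_sub_left, one_mul]

lemma convolution_normed_eq_zero (hfS : ∀ x ∉ S, f x = 0) {y : E n}
    (hy : y ∉ Metric.thickening φ.rOut S) :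
    (φ.normed volume ⋆[ContinuousLinearMap.lsmul ℝ ℝ, volume] f) y = 0 := by
  rw [convolution_normed_eq]
  refine integral_eq_zero_of_ae (.of_forall fun x => ?_)
  by_cases hx : x ∈ S
  · have hdist : φ.rOut ≤ dist y x :=
      not_lt.1 fun h => hy (Metric.mem_thickening_iff.2 ⟨x, hx, h⟩)
    simp only [normed_sub_eq_zero φ hdist, zero_smul, Pi.zero_apply]
  · simp only [hfS x hx, smul_zero, Pi.zero_apply]

lemma integrable_dotCLM_normed_smul (hYm : AEStronglyMeasurable Y volume)
    (hY : ∀ᵐ x : E n, ‖Y x 0‖ + ‖Y x 1‖ ≤ Λ) (hf : Integrable f) :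
    Integrable (fun p : E n × E n => dotCLM (Y p.1) (φ.normed volume (p.1 - p.2) • f p.2))
      (volume.prod volume) := by
  have hdom : Integrable (fun p : E n × E n => ‖f p.2‖ * φ.normed volume (p.1 - p.2))
      (volume.prod volume) :=
    hf.norm.convolution_integrand (ContinuousLinearMap.mul ℝ ℝ) φ.integrable_normed
  have hφm : AEStronglyMeasurable (fun p : E n × E n => φ.normed volume (p.1 - p.2))
      (volume.prod volume) :=
    (φ.continuous_normed.comp (continuous_fst.sub continuous_snd)).aestronglyMeasurable
  refine Integrable.mono' (hdom.const_mul Λ) (aestronglyMeasurable_dotCLM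
    (hYm.comp_fst (ν := volume)) (hφm.smul hf.aestronglyMeasurable.comp_snd)) ?_
  filter_upwards [Measure.quasiMeasurePreserving_fst.ae hY] with p hp
  exact abs_dotCLM_normed_smul_le φ hp _

lemma integral_mollified_eq (hYm : AEStronglyMeasurable Y volume)
    (hY : ∀ᵐ x : E n, ‖Y x 0‖ + ‖Y x 1‖ ≤ Λ) (hf : Integrable f) :
    ∫ x, mollified Y φ f x =
      pairing Y (φ.normed volume ⋆[ContinuousLinearMap.lsmul ℝ ℝ, volume] f) := by
  have hsmul (y : E n) : Integrable fun x => φ.normed volume (y - x) • f x := by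
    obtain ⟨C, hC⟩ := φ.hasCompactSupport_normed.exists_bound_of_continuous
      (φ.continuous_normed (μ := volume))
    exact hf.bdd_smul C (φ.continuous_normed.comp
      (continuous_const.sub continuous_id)).aestronglyMeasurable (.of_forall fun x => hC _)
  simp only [mollified, pairing_eq_integral_dotCLM, bumpPair]
  rw [integral_integral_swap
    (f := fun x y => dotCLM (Y y) (φ.normed volume (y - x) • f x))
    (integrable_dotCLM_normed_smul φ hYm hY hf).swap]
  congr 1; ext y
  rw [ContinuousLinearMap.integral_comp_comm _ (hsmul y), convolution_normed_eq]

/-- Bump functions shrinking to the origin, with supports small enough for `lintegral_pairWeight_le`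
to apply to fields mollified by them. -/
def shrinkingBump (n k : ℕ) : ContDiffBump (0 : E n) where
  rIn := 1 / (48 * (k + 1))
  rOut := 1 / (24 * (k + 1))
  rIn_pos := by positivity
  rIn_lt_rOut := by
    apply one_div_lt_one_div_of_lt <;> nlinarith [show (0 : ℝ) ≤ k by positivity]

lemma shrinkingBump_rOut_le (n k : ℕ) : (shrinkingBump n k).rOut ≤ 1 / 24 :=
  one_div_le_one_div_of_le (by norm_num) (by linarith [show (0 : ℝ) ≤ k by positivity])

lemma tendsto_shrinkingBump_rOut (n : ℕ) :
    Tendsto (fun k => (shrinkingBump n k).rOut) atTop (𝓝 0) := by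
  have hrOut : (fun k => (shrinkingBump n k).rOut) = fun k : ℕ => 1 / 24 * (1 / ((k : ℝ) + 1)) := by
    ext k; simp only [shrinkingBump]; field_simp
  rw [hrOut, ← mul_zero (1 / 24 : ℝ)]
  exact tendsto_one_div_add_atTop_nhds_zero_nat.const_mul _

lemma ae_tendsto_convolution_shrinkingBump (hf : LocallyIntegrable f) :
    ∀ᵐ y, Tendsto (fun k => ((shrinkingBump n k).normed volume
      ⋆[ContinuousLinearMap.lsmul ℝ ℝ, volume] f) y) atTop (𝓝 (f y)) :=
  ContDiffBump.ae_convolution_tendsto_right_of_locallyIntegrable (K := 2)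
    (tendsto_shrinkingBump_rOut n)
    (.of_forall fun k => by simp only [shrinkingBump]; apply le_of_eq; field_simp; norm_num) hf

lemma tendsto_integral_mollified (hYm : AEStronglyMeasurable Y volume)
    (hY : ∀ᵐ x : E n, ‖Y x 0‖ + ‖Y x 1‖ ≤ Λ) (hf : Integrable f) (hM : ∀ x, ‖f x‖ ≤ M)
    (hSb : Bornology.IsBounded S) (hfS : ∀ x ∉ S, f x = 0) :
    Tendsto (fun k => ∫ x, mollified Y (shrinkingBump n k) f x) atTop (𝓝 (pairing Y f)) := by
  simp only [integral_mollified_eq _ hYm hY hf, pairing_eq_integral_dotCLM]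
  refine tendsto_integral_of_dominated_convergence
    ((Metric.thickening 1 S).indicator fun _ => Λ * M) (fun k => ?_) ?_ (fun k => ?_) ?_
  · exact aestronglyMeasurable_dotCLM hYm
      ((shrinkingBump n k).hasCompactSupport_normed.contDiff_convolution_left _
        (shrinkingBump n k).contDiff_normed hf.locallyIntegrable
        (n := 0)).continuous.aestronglyMeasurable
  · rw [integrable_indicator_iff Metric.isOpen_thickening.measurableSet]
    exact integrableOn_const hSb.thickening.measure_lt_top.ne
  · filter_upwards [hY] with y hy
    by_cases hyS : y ∈ Metric.thickening 1 S
    · rw [indicator_of_mem hyS]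
      exact (abs_dotCLM_le _ _).trans (mul_le_mul hy (norm_convolution_normed_le _ hM _)
        (norm_nonneg _) ((add_nonneg (norm_nonneg _) (norm_nonneg _)).trans hy))
    · have hsmall : (shrinkingBump n k).rOut ≤ 1 := by linarith [shrinkingBump_rOut_le n k]
      rw [indicator_of_notMem hyS, convolution_normed_eq_zero _ hfS
        fun h => hyS (Metric.thickening_mono hsmall S h), map_zero, norm_zero]
  · filter_upwards [ae_tendsto_convolution_shrinkingBump hf.locallyIntegrable] with y hy
    exact ((dotCLM (Y y)).continuous.tendsto _).comp hy

end Mollification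

section PairingFourthMoment

variable {n : ℕ} {Ω : Type*} {Y₀ : Ω → State n}

lemma measurable_pairing_sigmaAlg {Ψ : State n} (hΨ : IsTestPair Ψ) {𝒜 : Set (E n)}
    (h : tsupport Ψ ⊆ 𝒜) : Measurable[sigmaAlg Y₀ 𝒜] fun ω => pairing (Y₀ ω) Ψ := by
  rw [measurable_iff_comap_le, BorelSpace.measurable_eq (α := ℝ)]
  exact le_iSup₂_of_le Ψ ⟨hΨ, h⟩ le_rfl

variable [MeasurableSpace Ω] {P : Measure Ω} {Λ : ℝ}

lemma BoundedBy.nonneg [IsProbabilityMeasure P] (hb : BoundedBy P Y₀ Λ) : 0 ≤ Λ := by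
  obtain ⟨ω, hω⟩ := hb.exists
  obtain ⟨x, hx⟩ := hω.exists
  exact (add_nonneg (norm_nonneg _) (norm_nonneg _)).trans hx

variable (hY : AEMeasurable (fun p : Ω × E n => Y₀ p.1 p.2) (P.prod volume))

include hY

lemma BoundedBy.ae_prod (hb : BoundedBy P Y₀ Λ) :
    ∀ᵐ p : Ω × E n ∂(P.prod volume), ‖Y₀ p.1 p.2 0‖ + ‖Y₀ p.1 p.2 1‖ ≤ Λ := by
  have hmk : MeasurableSet {p : Ω × E n | ‖hY.mk _ p 0‖ + ‖hY.mk _ p 1‖ ≤ Λ} :=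
    measurableSet_le ((measurable_pi_iff.1 hY.measurable_mk 0).norm.add
      (measurable_pi_iff.1 hY.measurable_mk 1).norm) measurable_const
  have hmk_le : ∀ᵐ p : Ω × E n ∂(P.prod volume), ‖hY.mk _ p 0‖ + ‖hY.mk _ p 1‖ ≤ Λ := by
    refine (Measure.ae_prod_mem_iff_ae_ae_mem hmk).2 ?_
    filter_upwards [hb, Measure.ae_ae_of_ae_prod hY.ae_eq_mk] with ω hω hω_eq
    filter_upwards [hω, hω_eq] with x hx hx_eq
    exact hx_eq ▸ hx
  filter_upwards [hmk_le, hY.ae_eq_mk] with p hp hp_eq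
  rwa [hp_eq]

lemma aestronglyMeasurable_dotCLM_prod {f : State n} (hf : AEStronglyMeasurable f volume) :
    AEStronglyMeasurable (fun p : Ω × E n => dotCLM (Y₀ p.1 p.2) (f p.2)) (P.prod volume) :=
  aestronglyMeasurable_dotCLM hY.aestronglyMeasurable hf.comp_snd

lemma aestronglyMeasurable_pairing {f : State n} (hf : AEStronglyMeasurable f volume) :
    AEStronglyMeasurable (fun ω => pairing (Y₀ ω) f) P := by
  simp only [pairing_eq_integral_dotCLM]
  exact (aestronglyMeasurable_dotCLM_prod hY hf).integral_prod_right'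

variable [IsProbabilityMeasure P]

lemma aestronglyMeasurable_mollified (φ : ContDiffBump (0 : E n)) {f : State n}
    (hf : AEStronglyMeasurable f volume) :
    AEStronglyMeasurable (fun p : Ω × E n => mollified (Y₀ p.1) φ f p.2) (P.prod volume) := by
  simp only [mollified, pairing_eq_integral_dotCLM, bumpPair]
  have hY' : AEStronglyMeasurable (fun q : (Ω × E n) × E n => Y₀ q.1.1 q.2)
      ((P.prod volume).prod volume) :=
    hY.aestronglyMeasurable.comp_quasiMeasurePreserving (f := Prod.map Prod.fst id)
      (MeasureTheory.QuasiMeasurePreserving.prodMap Measure.quasiMeasurePreserving_fst (.id volume))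
  have hφ : AEStronglyMeasurable (fun q : (Ω × E n) × E n => φ.normed volume (q.2 - q.1.2))
      ((P.prod volume).prod volume) :=
    (φ.continuous_normed.measurable.comp
      (measurable_snd.sub (measurable_snd.comp measurable_fst))).aestronglyMeasurable
  exact (aestronglyMeasurable_dotCLM hY' (hφ.smul hf.comp_snd.comp_fst)).integral_prod_right'

lemma integral_dotCLM_eq_zero (h0 : CondS0 P Y₀) (hb : BoundedBy P Y₀ Λ) :
    ∀ᵐ x : E n, ∀ c, ∫ ω, dotCLM (Y₀ ω x) c ∂P = 0 := by
  have hmeas : ∀ᵐ x : E n, AEStronglyMeasurable (fun ω => Y₀ ω x) P :=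
    hY.aestronglyMeasurable.prod_swap.prodMk_left
  have hbound : ∀ᵐ x : E n, ∀ᵐ ω ∂P, ‖Y₀ ω x 0‖ + ‖Y₀ ω x 1‖ ≤ Λ :=
    Measure.ae_ae_of_ae_prod
      (Measure.measurePreserving_swap.quasiMeasurePreserving.ae (hb.ae_prod hY))
  filter_upwards [hmeas, hbound, ae_all_iff.2 h0] with x hx_meas hx_bound hx_mean c
  have hint : Integrable (fun ω => Y₀ ω x) P := by
    refine .of_bound hx_meas Λ ?_
    filter_upwards [hx_bound] with ω hω
    refine (pi_norm_le_iff_of_nonneg hb.nonneg).2 (Fin.forall_fin_two.2 ⟨?_, ?_⟩)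
    · linarith [norm_nonneg (Y₀ ω x 1)]
    · linarith [norm_nonneg (Y₀ ω x 0)]
  have hmean : ∫ ω, Y₀ ω x ∂P = 0 := by
    ext i
    rw [eval_integral fun i => hint.eval i, hx_mean i, Pi.zero_apply]
  simp only [dotCLM_comm _ c]
  rw [ContinuousLinearMap.integral_comp_comm _ hint, hmean, map_zero]

lemma integral_mollified_eq_zero (h0 : CondS0 P Y₀) (hb : BoundedBy P Y₀ Λ)
    (φ : ContDiffBump (0 : E n)) (f : State n) (x : E n) :
    ∫ ω, mollified (Y₀ ω) φ f x ∂P = 0 := by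
  have hdom : Integrable
      (fun p : Ω × E n => Λ * (1 * (‖f x‖ * φ.normed volume (p.2 - x)))) (P.prod volume) :=
    ((integrable_const _).mul_prod
      ((φ.integrable_normed.comp_sub_right x).const_mul _)).const_mul _
  have hint : Integrable (fun p : Ω × E n => dotCLM (Y₀ p.1 p.2) (bumpPair φ x (f x) p.2))
      (P.prod volume) := by
    refine hdom.mono' (aestronglyMeasurable_dotCLM_prod hY
      (isTestPair_bumpPair φ x (f x)).1.continuous.aestronglyMeasurable) ?_
    filter_upwards [hb.ae_prod hY] with p hp
    rw [one_mul]
    exact abs_dotCLM_normed_smul_le φ hp _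
  simp only [mollified, pairing_eq_integral_dotCLM]
  rw [integral_integral_swap hint]
  refine integral_eq_zero_of_ae ?_
  filter_upwards [integral_dotCLM_eq_zero hY h0 hb] with y hy using hy _

lemma isLocalField_mollified (h0 : CondS0 P Y₀) (hb : BoundedBy P Y₀ Λ)
    (φ : ContDiffBump (0 : E n)) {f : State n} {M : ℝ} (hM : ∀ x, ‖f x‖ ≤ M) :
    IsLocalField P Y₀ (fun x ω => mollified (Y₀ ω) φ f x) (2 * φ.rOut) (Λ * M) where
  measurable x := measurable_pairing_sigmaAlg (isTestPair_bumpPair φ x (f x))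
    ((tsupport_bumpPair_subset φ x (f x)).trans
      (Metric.closedBall_subset_ball (by linarith [φ.rOut_pos])))
  aemeasurable x := (aestronglyMeasurable_pairing hY
    (isTestPair_bumpPair φ x (f x)).1.continuous.aestronglyMeasurable).aemeasurable
  bound := by
    filter_upwards [hb] with ω hω using abs_mollified_le_of_norm_le φ hω hM
  mean_zero := integral_mollified_eq_zero hY h0 hb φ f

lemma integrable_abs_pairing_pow (hb : BoundedBy P Y₀ Λ) {f : State n}
    (hf : AEStronglyMeasurable f volume) {M : ℝ} (hM : ∀ x, ‖f x‖ ≤ M) {S : Set (E n)}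
    (hSv : volume S < ∞) (hfS : ∀ x ∉ S, f x = 0) (k : ℕ) :
    Integrable (fun ω => |pairing (Y₀ ω) f| ^ k) P := by
  refine .of_bound ((aestronglyMeasurable_pairing hY hf).norm.pow k)
    ((Λ * M * volume.real S) ^ k) ?_
  filter_upwards [hb] with ω hω
  rw [norm_pow, Real.norm_eq_abs, abs_abs]
  exact pow_le_pow_left₀ (abs_nonneg _) (abs_pairing_le hω hM hSv hfS) k

theorem integral_pairing_fourth_le (hn : 1 ≤ n) {K : ℝ≥0} (hK : mixingIntegral P Y₀ ≤ K)
    (h0 : CondS0 P Y₀) (hb : BoundedBy P Y₀ Λ) {f : State n}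
    (hf : AEStronglyMeasurable f volume) {M : ℝ} (hM : ∀ x, ‖f x‖ ≤ M) {S : Set (E n)}
    (hS : MeasurableSet S) (hSb : Bornology.IsBounded S) (hfS : ∀ x ∉ S, f x = 0) :
    ∫ ω, pairing (Y₀ ω) f ^ 4 ∂P ≤ 480 * (Λ * M) ^ 4 * (volume.real S * pairBound n K) ^ 2 := by
  have hSv : volume S < ∞ := hSb.measure_lt_top
  have hfi : Integrable f :=
    (integrableOn_iff_integrable_of_support_subset fun x hx => not_imp_comm.1 (hfS x) hx).1
      (.of_bound hSv hf.restrict M (.of_forall hM))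
  let φ := shrinkingBump n
  have hfourth (k : ℕ) : ∫ ω, (∫ x, mollified (Y₀ ω) (φ k) f x) ^ 4 ∂P ≤
      480 * (Λ * M) ^ 4 * (volume.real S * pairBound n K) ^ 2 :=
    (isLocalField_mollified hY h0 hb (φ k) hM).integral_fourth_le
      (fun x hx ω => mollified_eq_zero _ (hfS x hx)) hn hK
      (by linarith [shrinkingBump_rOut_le n k]) hS hSv (aestronglyMeasurable_mollified hY (φ k) hf)
  refine le_of_tendsto (tendsto_integral_of_dominated_convergence
    (fun _ => (Λ * M * volume.real S) ^ 4)
    (fun k => (aestronglyMeasurable_mollified hY (φ k) hf).integral_prod_right'.pow 4)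
    (integrable_const _) (fun k => ?_) ?_) (.of_forall hfourth)
  · filter_upwards [hb] with ω hω
    refine (norm_pow _ 4).trans_le ?_
    exact pow_le_pow_left₀ (norm_nonneg _) (abs_integral_mollified_le (φ k) hω hM hSv hfS) 4
  · filter_upwards [hb, hY.aestronglyMeasurable.prodMk_left] with ω hω hωm
    exact (tendsto_integral_mollified hωm hω hfi hM hSb hfS).pow 4

end PairingFourthMoment

section PlaneWaves

variable {n : ℕ}

/-- The plane wave `x ↦ exp (κ · x)` with complex wave vector `κ`. -/
def wave (κ : Fin n → ℂ) (x : E n) : ℂ := Complex.exp (∑ k, κ k * (x k : ℂ))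

lemma contDiff_wave (κ : Fin n → ℂ) : ContDiff ℝ (⊤ : ℕ∞) (wave κ) := by
  refine Complex.contDiff_exp.comp (ContDiff.sum fun k _ => contDiff_const.mul ?_)
  exact Complex.ofRealCLM.contDiff.comp (EuclideanSpace.proj (𝕜 := ℝ) k).contDiff

lemma continuous_wave (κ : Fin n → ℂ) : Continuous (wave κ) := (contDiff_wave κ).continuous

lemma differentiable_wave (κ : Fin n → ℂ) : Differentiable ℝ (wave κ) :=
  (contDiff_wave κ).differentiable (by simp)

/-- The partial derivative `∂ₖ φ`. -/
def partialDeriv (k : Fin n) (φ : E n → ℂ) : E n → ℂ :=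
  fun x => fderiv ℝ φ x (EuclideanSpace.single k 1)

lemma partialDeriv_wave (κ : Fin n → ℂ) (k : Fin n) :
    partialDeriv k (wave κ) = fun x => κ k * wave κ x := by
  funext x
  have hphase : HasFDerivAt (fun x : E n => ∑ k, κ k * (x k : ℂ))
      (∑ k, κ k • (Complex.ofRealCLM ∘L (EuclideanSpace.proj (𝕜 := ℝ) k : E n →L[ℝ] ℝ))) x :=
    HasFDerivAt.fun_sum fun k _ => (Complex.ofRealCLM ∘L
      (EuclideanSpace.proj (𝕜 := ℝ) k : E n →L[ℝ] ℝ)).hasFDerivAt.const_mul (κ k)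
  have hwave : HasFDerivAt (wave κ) _ x := hphase.cexp
  rw [partialDeriv, hwave.fderiv]
  have hsum : ∑ j, κ j * ((if j = k then 1 else 0 : ℝ) : ℂ) = κ k := by
    simp [apply_ite Complex.ofReal]
  simp [wave, hsum, mul_comm]

lemma contDiff_partialDeriv {φ : E n → ℂ} {r : ℕ} (hφ : ContDiff ℝ (r + 1 : ℕ) φ) (k : Fin n) :
    ContDiff ℝ r (partialDeriv k φ) :=
  (hφ.fderiv_right le_rfl).clm_apply contDiff_const

lemma hasCompactSupport_partialDeriv {φ : E n → ℂ} (hc : HasCompactSupport φ) (k : Fin n) :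
    HasCompactSupport (partialDeriv k φ) :=
  hc.fderiv_apply (𝕜 := ℝ) _

lemma laplacian_eq_sum_partialDeriv {φ : E n → ℂ} (hφ : ContDiff ℝ 2 φ) :
    Δ φ = fun x => ∑ k, partialDeriv k (partialDeriv k φ) x := by
  funext x
  rw [InnerProductSpace.laplacian_eq_iteratedFDeriv_orthonormalBasis φ
    (EuclideanSpace.basisFun (Fin n) ℝ)]
  refine Finset.sum_congr rfl fun k _ => ?_
  have hd : DifferentiableAt ℝ (fderiv ℝ φ) x :=
    (hφ.fderiv_right (m := 1) (by norm_num)).differentiable one_ne_zero x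
  unfold partialDeriv
  rw [iteratedFDeriv_two_apply, fderiv_clm_apply hd (differentiableAt_const _)]
  simp

lemma continuous_laplacian {φ : E n → ℂ} (hφ : ContDiff ℝ 2 φ) : Continuous (Δ φ) := by
  rw [laplacian_eq_sum_partialDeriv hφ]
  exact continuous_finsetSum _ fun k _ =>
    (contDiff_partialDeriv (r := 0) (contDiff_partialDeriv (r := 1) hφ k) k).continuous

lemma hasCompactSupport_laplacian {φ : E n → ℂ} (hc : HasCompactSupport φ) :
    HasCompactSupport (Δ φ) := by
  refine hc.mono' fun x hx => ?_
  by_contra hxφ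
  have hzero : φ =ᶠ[𝓝 x] fun _ => 0 := notMem_tsupport_iff_eventuallyEq.1 hxφ
  refine hx ?_
  rw [(InnerProductSpace.laplacian_congr_nhds hzero).eq_of_nhds]
  simp

/-- The two-sided Laplace transform `∫ exp (κ · x) φ(x) dx`. -/
def laplaceTransform (φ : E n → ℂ) (κ : Fin n → ℂ) : ℂ := ∫ x, wave κ x * φ x

lemma integrable_wave_mul {φ : E n → ℂ} (hφ : Continuous φ) (hc : HasCompactSupport φ)
    (κ : Fin n → ℂ) : Integrable fun x => wave κ x * φ x :=
  ((continuous_wave κ).mul hφ).integrable_of_hasCompactSupport hc.mul_left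

lemma laplaceTransform_partialDeriv {φ : E n → ℂ} (hφ : ContDiff ℝ 1 φ)
    (hc : HasCompactSupport φ) (κ : Fin n → ℂ) (k : Fin n) :
    laplaceTransform (partialDeriv k φ) κ = -κ k * laplaceTransform φ κ := by
  have hwave (x : E n) : fderiv ℝ (wave κ) x (EuclideanSpace.single k 1) = κ k * wave κ x :=
    congrFun (partialDeriv_wave κ k) x
  have hint := integrable_wave_mul hφ.continuous hc κ
  unfold laplaceTransform partialDeriv
  rw [integral_mul_fderiv_eq_neg_fderiv_mul_of_integrable (𝕜 := ℂ) (hfg := hint)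
    (hf := fun x _ => differentiable_wave κ x)
    (hg := fun x _ => hφ.differentiable one_ne_zero x)]
  · simp only [hwave, mul_assoc, integral_const_mul, neg_mul]
  · simp only [hwave, mul_assoc]
    exact hint.const_mul _
  · exact integrable_wave_mul (contDiff_partialDeriv (r := 0) hφ k).continuous
      (hasCompactSupport_partialDeriv hc k) κ

lemma laplaceTransform_laplacian {φ : E n → ℂ} (hφ : ContDiff ℝ 2 φ)
    (hc : HasCompactSupport φ) (κ : Fin n → ℂ) :
    laplaceTransform (Δ φ) κ = (∑ k, κ k ^ 2) * laplaceTransform φ κ := by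
  have hsmooth (k : Fin n) : ContDiff ℝ 1 (partialDeriv k φ) :=
    contDiff_partialDeriv (r := 1) hφ k
  have hsupp (k : Fin n) := hasCompactSupport_partialDeriv hc k
  calc laplaceTransform (Δ φ) κ
      = ∑ k, laplaceTransform (partialDeriv k (partialDeriv k φ)) κ := by
        unfold laplaceTransform
        simp only [laplacian_eq_sum_partialDeriv hφ, Finset.mul_sum]
        exact integral_finsetSum _ fun k _ => integrable_wave_mul
          (contDiff_partialDeriv (r := 0) (hsmooth k) k).continuous
          (hasCompactSupport_partialDeriv (hsupp k) k) κ
    _ = ∑ k, κ k ^ 2 * laplaceTransform φ κ := by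
        refine Finset.sum_congr rfl fun k _ => ?_
        rw [laplaceTransform_partialDeriv (hsmooth k) (hsupp k),
          laplaceTransform_partialDeriv (hφ.of_le (by norm_num)) hc]
        ring
    _ = (∑ k, κ k ^ 2) * laplaceTransform φ κ := (Finset.sum_mul ..).symm

/-- The transform `∫ exp (κ · x) conj φ(x) dx`, holomorphic in `κ`, which appears when a plane
wave is paired with `φ`. -/
def conjTransform (κ : Fin n → ℂ) (φ : E n → ℂ) : ℂ :=
  laplaceTransform (fun x => (starRingEnd ℂ) (φ x)) κ

lemma conjTransform_eq_conj (κ : Fin n → ℂ) (φ : E n → ℂ) :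
    conjTransform κ φ =
      (starRingEnd ℂ) (laplaceTransform φ (fun k => (starRingEnd ℂ) (κ k))) := by
  unfold conjTransform laplaceTransform
  rw [← integral_conj]
  congr 1; ext x
  simp only [wave, map_mul, ← Complex.exp_conj, map_sum, Complex.conj_conj, Complex.conj_ofReal]

lemma integrable_wave_mul_conj {φ : E n → ℂ} (hφ : Continuous φ) (hc : HasCompactSupport φ)
    (κ : Fin n → ℂ) : Integrable fun x => wave κ x * (starRingEnd ℂ) (φ x) :=
  integrable_wave_mul (Complex.continuous_conj.comp hφ)
    (hc.comp_left (g := starRingEnd ℂ) (map_zero _)) κ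

lemma conjTransform_laplacian {φ : E n → ℂ} (hφ : ContDiff ℝ 2 φ) (hc : HasCompactSupport φ)
    (κ : Fin n → ℂ) : conjTransform κ (Δ φ) = (∑ k, κ k ^ 2) * conjTransform κ φ := by
  simp only [conjTransform_eq_conj, laplaceTransform_laplacian hφ hc, map_mul, map_sum, map_pow,
    Complex.conj_conj]

/-- The state `(a e^{κ·x}, b e^{κ·x})`. -/
def waveState (κ : Fin n → ℂ) (a b : ℂ) : State n := fun x => ![a * wave κ x, b * wave κ x]

/-- The gradient of `a e^{κ·x}`. -/
def waveGrad (κ : Fin n → ℂ) (a : ℂ) : GradField n := fun x => (a * wave κ x) • WithLp.toLp 2 κ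

lemma continuous_waveState (κ : Fin n → ℂ) (a b : ℂ) : Continuous (waveState κ a b) :=
  continuous_pi <| Fin.forall_fin_two.2
    ⟨(continuous_wave κ).const_mul a, (continuous_wave κ).const_mul b⟩

lemma continuous_waveGrad (κ : Fin n → ℂ) (a : ℂ) : Continuous (waveGrad κ a) :=
  ((continuous_wave κ).const_mul a).smul continuous_const

lemma hasWeakGradient_waveState (κ : Fin n → ℂ) (a b : ℂ) :
    HasWeakGradient (fun x => waveState κ a b x 0) (waveGrad κ a) := by
  intro η hη hc k
  have hderiv (x : E n) : fderiv ℝ (fun x => a * wave κ x) x (EuclideanSpace.single k 1) =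
      waveGrad κ a x k := by
    have hwave : fderiv ℝ (wave κ) x (EuclideanSpace.single k 1) = κ k * wave κ x :=
      congrFun (partialDeriv_wave κ k) x
    rw [fderiv_const_mul (differentiable_wave κ x), smul_apply, hwave]
    simp only [waveGrad, PiLp.smul_apply, smul_eq_mul]
    ring
  have hwave : Continuous fun x => a * wave κ x := (continuous_wave κ).const_mul a
  have hgrad : Continuous fun x => waveGrad κ a x k :=
    (EuclideanSpace.proj (𝕜 := ℂ) k).continuous.comp (continuous_waveGrad κ a)
  have hη' : Continuous fun x => fderiv ℝ η x (EuclideanSpace.single k 1) :=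
    (hη.continuous_fderiv (by simp)).clm_apply continuous_const
  have hparts := integral_smul_fderiv_eq_neg_fderiv_smul_of_integrable (μ := volume) (𝕜 := ℝ)
    (f := η) (g := fun x => a * wave κ x) (v := EuclideanSpace.single k 1)
    ((hη'.smul hwave).integrable_of_hasCompactSupport (hc.fderiv_apply (𝕜 := ℝ) _).smul_right)
    (by
      simp only [hderiv]
      exact (hη.continuous.smul hgrad).integrable_of_hasCompactSupport hc.smul_right)
    ((hη.continuous.smul hwave).integrable_of_hasCompactSupport hc.smul_right)
    (fun x _ => hη.differentiable (by simp) x)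
    (fun x _ => (differentiable_wave κ x).const_mul a)
  simp only [hderiv] at hparts
  simp only [waveState, Matrix.cons_val_zero, hparts, neg_neg]

lemma localEnergy_waveState (m R : ℝ) (κ : Fin n → ℂ) (a b : ℂ) :
    localEnergy m R (waveState κ a b) (waveGrad κ a) =
      (∫⁻ x in Metric.ball (0 : E n) R, ‖wave κ x‖ₑ ^ 2) *
        (‖b‖ₑ ^ 2 + (‖a‖ₑ * ‖WithLp.toLp 2 κ‖ₑ) ^ 2 + ENNReal.ofReal (m ^ 2) * ‖a‖ₑ ^ 2) := by
  unfold localEnergy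
  rw [← lintegral_mul_const _ ((continuous_wave κ).measurable.enorm.pow_const 2)]
  congr 1; ext x
  simp only [energyDensity, waveState, waveGrad, Matrix.cons_val_one, Matrix.cons_val_zero,
    enorm_smul, enorm_mul]
  ring

lemma lintegral_wave_lt_top (κ : Fin n → ℂ) (R : ℝ) :
    ∫⁻ x in Metric.ball (0 : E n) R, ‖wave κ x‖ₑ ^ 2 < ∞ := by
  obtain ⟨C, hC⟩ := (isCompact_closedBall (0 : E n) R).exists_bound_of_continuousOn
    (continuous_wave κ).continuousOn
  refine setLIntegral_lt_top_of_le_nnreal measure_ball_lt_top.ne ⟨C.toNNReal ^ 2, fun x hx => ?_⟩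
  rw [ENNReal.coe_pow, ← ofReal_norm]
  gcongr
  exact ENNReal.ofReal_le_ofReal (hC x (Metric.ball_subset_closedBall hx))

lemma inPhaseSpace_waveState (m : ℝ) (κ : Fin n → ℂ) (a b : ℂ) :
    InPhaseSpace m (waveState κ a b) (waveGrad κ a) where
  aestronglyMeasurable := (continuous_waveState κ a b).aestronglyMeasurable
  aestronglyMeasurable_grad := (continuous_waveGrad κ a).aestronglyMeasurable
  hasWeakGradient := hasWeakGradient_waveState κ a b
  localEnergy_lt_top R _ := by
    rw [localEnergy_waveState]
    refine ENNReal.mul_lt_top (lintegral_wave_lt_top κ R) ?_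
    refine ENNReal.add_lt_top.2 ⟨ENNReal.add_lt_top.2 ⟨?_, ?_⟩, ?_⟩
    · exact ENNReal.pow_lt_top enorm_lt_top
    · exact ENNReal.pow_lt_top (ENNReal.mul_lt_top enorm_lt_top enorm_lt_top)
    · exact ENNReal.mul_lt_top ENNReal.ofReal_lt_top (ENNReal.pow_lt_top enorm_lt_top)

lemma tendsto_localEnergy_waveState_sub (m R : ℝ) (κ : Fin n → ℂ) {c c' : ℝ → ℂ} {s : ℝ}
    (hc : ContinuousAt c s) (hc' : ContinuousAt c' s) :
    Tendsto (fun t => localEnergy m R (waveState κ (c t) (c' t) - waveState κ (c s) (c' s))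
      (waveGrad κ (c t) - waveGrad κ (c s))) (𝓝 s) (𝓝 0) := by
  have hsub (t : ℝ) : localEnergy m R (waveState κ (c t) (c' t) - waveState κ (c s) (c' s))
      (waveGrad κ (c t) - waveGrad κ (c s)) =
      localEnergy m R (waveState κ (c t - c s) (c' t - c' s)) (waveGrad κ (c t - c s)) := by
    congr 1
    · ext x i
      fin_cases i <;> simp [waveState, sub_mul]
    · ext x i
      simp [waveGrad, sub_mul]
  have henorm {f : ℝ → ℂ} (hf : ContinuousAt f s) :
      Tendsto (fun t => ‖f t - f s‖ₑ) (𝓝 s) (𝓝 0) := by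
    simpa using (hf.tendsto.sub_const (f s)).enorm
  have hfactor : Tendsto (fun t => ‖c' t - c' s‖ₑ ^ 2 +
      (‖c t - c s‖ₑ * ‖WithLp.toLp 2 κ‖ₑ) ^ 2 +
      ENNReal.ofReal (m ^ 2) * ‖c t - c s‖ₑ ^ 2) (𝓝 s) (𝓝 0) := by
    have hkinetic := ENNReal.Tendsto.pow (n := 2) (henorm hc')
    have hgrad := ENNReal.Tendsto.pow (n := 2) (ENNReal.Tendsto.mul_const
      (b := ‖WithLp.toLp 2 κ‖ₑ) (henorm hc) (Or.inr enorm_ne_top))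
    have hmass := ENNReal.Tendsto.const_mul (a := ENNReal.ofReal (m ^ 2))
      (ENNReal.Tendsto.pow (n := 2) (henorm hc)) (Or.inr ENNReal.ofReal_ne_top)
    simpa using (hkinetic.add hgrad).add hmass
  simp only [hsub, localEnergy_waveState]
  simpa using ENNReal.Tendsto.const_mul hfactor (Or.inr (lintegral_wave_lt_top κ R).ne)

lemma pairing_waveState (κ : Fin n → ℂ) (a b : ℂ) {η : State n}
    (hη : Continuous η) (hc : HasCompactSupport η) :
    pairing (waveState κ a b) η =
      (a * conjTransform κ (fun x => η x 0) + b * conjTransform κ (fun x => η x 1)).re := by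
  have hint (i : Fin 2) : Integrable fun x => wave κ x * (starRingEnd ℂ) (η x i) :=
    integrable_wave_mul_conj ((continuous_apply i).comp hη)
      (hc.comp_left (g := fun v : Fin 2 → ℂ => v i) rfl) κ
  unfold pairing conjTransform laplaceTransform
  rw [← integral_const_mul, ← integral_const_mul, ← integral_add ((hint 0).const_mul _)
    ((hint 1).const_mul _)]
  refine Eq.trans ?_ (Complex.reCLM.integral_comp_comm
    (((hint 0).const_mul a).add ((hint 1).const_mul b)))
  congr 1; ext x
  simp only [Fin.sum_univ_two, waveState, Matrix.cons_val_zero, Matrix.cons_val_one, mul_assoc,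
    Complex.reCLM_apply, Complex.add_re]

lemma IsTestPair.contDiff_component {η : State n} (h : IsTestPair η) (i : Fin 2) :
    ContDiff ℝ (⊤ : ℕ∞) fun x => η x i :=
  contDiff_pi.1 h.1 i

lemma IsTestPair.hasCompactSupport_component {η : State n} (h : IsTestPair η) (i : Fin 2) :
    HasCompactSupport fun x => η x i :=
  h.2.comp_left (g := fun v : Fin 2 → ℂ => v i) rfl

lemma IsTestPair.continuous_adjointGenerator {η : State n} (h : IsTestPair η) (m : ℝ) :
    Continuous (adjointGenerator m η) :=
  continuous_pi <| Fin.forall_fin_two.2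
    ⟨(continuous_laplacian ((h.contDiff_component 1).of_le (by norm_cast))).sub
      ((h.contDiff_component 1).continuous.const_mul _), (h.contDiff_component 0).continuous⟩

lemma IsTestPair.hasCompactSupport_adjointGenerator {η : State n} (h : IsTestPair η) (m : ℝ) :
    HasCompactSupport (adjointGenerator m η) := by
  refine h.2.mono' fun x hx => ?_
  by_contra hxη
  have hzero : η =ᶠ[𝓝 x] fun _ => 0 := notMem_tsupport_iff_eventuallyEq.1 hxη
  have hzero₁ : (fun y => η y 1) =ᶠ[𝓝 x] fun _ => (0 : ℂ) := hzero.mono fun y hy => by simp [hy]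
  refine hx ?_
  unfold adjointGenerator
  rw [(InnerProductSpace.laplacian_congr_nhds hzero₁).eq_of_nhds, hzero.eq_of_nhds]
  simp

lemma IsTestPair.conjTransform_adjointGenerator {η : State n} (h : IsTestPair η) (m : ℝ)
    (κ : Fin n → ℂ) : conjTransform κ (fun x => adjointGenerator m η x 0) =
      ((∑ k, κ k ^ 2) - (m : ℂ) ^ 2) * conjTransform κ fun x => η x 1 := by
  have hsmooth : ContDiff ℝ 2 fun x => η x 1 := (h.contDiff_component 1).of_le (by norm_cast)
  have hsupp := h.hasCompactSupport_component 1
  rw [sub_mul, ← conjTransform_laplacian hsmooth hsupp]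
  unfold conjTransform laplaceTransform
  rw [← integral_const_mul, ← integral_sub
    (integrable_wave_mul_conj (continuous_laplacian hsmooth) (hasCompactSupport_laplacian hsupp) κ)
    ((integrable_wave_mul_conj hsmooth.continuous hsupp κ).const_mul _)]
  congr 1; ext x
  simp only [adjointGenerator, Matrix.cons_val_zero, map_sub, map_mul, map_pow,
    Complex.conj_ofReal]
  ring

lemma isSolution_waveState (m : ℝ) (κ : Fin n → ℂ) {c c' : ℝ → ℂ}
    (hc : ∀ s, HasDerivAt c (c' s) s)
    (hc' : ∀ s, HasDerivAt c' (-((m : ℂ) ^ 2 - ∑ k, κ k ^ 2) * c s) s) :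
    IsSolution m fun s => waveState κ (c s) (c' s) := by
  refine ⟨fun s => waveGrad κ (c s), fun s => inPhaseSpace_waveState m κ _ _,
    fun R _ s => tendsto_localEnergy_waveState_sub m R κ (hc s).continuousAt (hc' s).continuousAt,
    fun η hη t => ?_⟩
  have hderiv := Complex.reCLM.hasFDerivAt.comp_hasDerivAt t
    (((hc t).mul_const (conjTransform κ fun x => η x 0)).add
      ((hc' t).mul_const (conjTransform κ fun x => η x 1)))
  simp only [pairing_waveState κ _ _ hη.1.continuous hη.2,
    pairing_waveState κ _ _ (hη.continuous_adjointGenerator m)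
      (hη.hasCompactSupport_adjointGenerator m), hη.conjTransform_adjointGenerator]
  refine hderiv.congr_deriv ?_
  simp only [adjointGenerator, Matrix.cons_val_one, Matrix.cons_val_fin_one,
    Complex.reCLM_apply]
  congr 1
  ring

lemma IsAdjointEvolution.conjTransform_eq {m t : ℝ} {Ψ Φ : State n} (hΨ : IsTestPair Ψ)
    (h : IsAdjointEvolution m t Ψ Φ) (κ : Fin n → ℂ) {c c' : ℝ → ℂ}
    (hc : ∀ s, HasDerivAt c (c' s) s)
    (hc' : ∀ s, HasDerivAt c' (-((m : ℂ) ^ 2 - ∑ k, κ k ^ 2) * c s) s) :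
    c 0 * conjTransform κ (fun x => Φ x 0) + c' 0 * conjTransform κ (fun x => Φ x 1) =
      c t * conjTransform κ (fun x => Ψ x 0) + c' t * conjTransform κ (fun x => Ψ x 1) := by
  -- The pairing is real, so the complex identity is read off from the amplitudes `c` and `i c`.
  have hre (z : ℂ) : (z * (c 0 * conjTransform κ (fun x => Φ x 0) +
      c' 0 * conjTransform κ (fun x => Φ x 1))).re =
      (z * (c t * conjTransform κ (fun x => Ψ x 0) +
        c' t * conjTransform κ (fun x => Ψ x 1))).re := by
    have hpair := h.2 _ (isSolution_waveState m κ (c := fun s => z * c s)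
      (c' := fun s => z * c' s) (fun s => (hc s).const_mul z)
      fun s => ((hc' s).const_mul z).congr_deriv (mul_left_comm ..))
    simpa only [pairing_waveState κ _ _ h.1.1.continuous h.1.2,
      pairing_waveState κ _ _ hΨ.1.continuous hΨ.2, mul_add, mul_assoc] using hpair
  apply Complex.ext
  · simpa using hre 1
  · simpa only [Complex.I_mul_re, neg_inj] using hre Complex.I

end PlaneWaves

section TransformDecay

variable {n : ℕ}

/-- The complex wave vector with real part `η` and imaginary part `ξ`. -/
def cvec (η ξ : E n) : Fin n → ℂ := fun k => (η k : ℂ) + (ξ k : ℂ) * Complex.I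

lemma inner_eq_sum_mul (x y : E n) : inner ℝ x y = ∑ k, x k * y k := by
  simp [PiLp.inner_apply, mul_comm]

lemma wave_cvec (η ξ x : E n) :
    wave (cvec η ξ) x = Complex.exp ((inner ℝ η x : ℂ) + (inner ℝ ξ x : ℂ) * Complex.I) := by
  rw [wave, inner_eq_sum_mul, inner_eq_sum_mul]
  push_cast
  rw [Finset.sum_mul, ← Finset.sum_add_distrib]
  congr 1
  refine Finset.sum_congr rfl fun k _ => ?_
  rw [cvec]
  ring

lemma norm_wave_cvec (η ξ x : E n) : ‖wave (cvec η ξ) x‖ = Real.exp (inner ℝ η x) := by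
  rw [wave_cvec, Complex.norm_exp]
  simp

lemma norm_laplaceTransform_le {φ : E n → ℂ} (hφ : Continuous φ) {R : ℝ}
    (hs : tsupport φ ⊆ Metric.closedBall 0 R) (η ξ : E n) :
    ‖laplaceTransform φ (cvec η ξ)‖ ≤ (∫ x, ‖φ x‖) * Real.exp (R * ‖η‖) := by
  have hc : HasCompactSupport φ :=
    (isCompact_closedBall (0 : E n) R).of_isClosed_subset (isClosed_tsupport φ) hs
  rw [← integral_mul_const]
  refine norm_integral_le_of_norm_le ((hφ.integrable_of_hasCompactSupport hc).norm.mul_const _)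
    (Eventually.of_forall fun x => ?_)
  rw [norm_mul, norm_wave_cvec, mul_comm]
  by_cases hx : φ x = 0
  · simp [hx]
  · have hxR : ‖x‖ ≤ R := by simpa using hs (subset_tsupport φ hx)
    gcongr
    calc inner ℝ η x ≤ ‖η‖ * ‖x‖ := real_inner_le_norm η x
      _ ≤ R * ‖η‖ := by rw [mul_comm]; gcongr

lemma exists_norm_pow_mul_laplaceTransform_le {φ : E n → ℂ} (hφ : ContDiff ℝ (⊤ : ℕ∞) φ) {R : ℝ}
    (hs : tsupport φ ⊆ Metric.closedBall 0 R) (k : Fin n) (N : ℕ) :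
    ∃ C, 0 ≤ C ∧ ∀ η ξ : E n,
      ‖cvec η ξ k‖ ^ N * ‖laplaceTransform φ (cvec η ξ)‖ ≤ C * Real.exp (R * ‖η‖) := by
  induction N generalizing φ with
  | zero =>
    refine ⟨∫ x, ‖φ x‖, integral_nonneg fun _ => norm_nonneg _, fun η ξ => ?_⟩
    simpa using norm_laplaceTransform_le hφ.continuous hs η ξ
  | succ N ih =>
    have hc : HasCompactSupport φ :=
      (isCompact_closedBall (0 : E n) R).of_isClosed_subset (isClosed_tsupport φ) hs
    obtain ⟨C, hC, hle⟩ := ih (φ := partialDeriv k φ)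
      ((hφ.fderiv_right (m := (⊤ : ℕ∞)) (by norm_cast)).clm_apply contDiff_const)
      ((tsupport_fderiv_apply_subset ℝ _).trans hs)
    refine ⟨C, hC, fun η ξ => ?_⟩
    have hderiv := hle η ξ
    rw [laplaceTransform_partialDeriv (hφ.of_le (by norm_cast)) hc, norm_mul, norm_neg] at hderiv
    rwa [pow_succ, mul_assoc]

lemma one_add_norm_pow_le (N : ℕ) (ξ : E n) :
    (1 + ‖ξ‖) ^ N ≤ ((n : ℝ) + 1) ^ N * (1 + ∑ k, |ξ k| ^ N) := by
  rcases isEmpty_or_nonempty (Fin n) with hempty | hnonempty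
  · simpa [Subsingleton.elim ξ 0] using one_le_pow₀ (n := N) (by simp : (1 : ℝ) ≤ n + 1)
  obtain ⟨k, hk⟩ := Finite.exists_max fun j => |ξ j|
  have hnorm : ‖ξ‖ ≤ n * |ξ k| := by
    calc ‖ξ‖ = ‖∑ j, EuclideanSpace.single j (ξ j)‖ := by
          congr 1; ext i; simp [Finset.sum_apply, Pi.single_apply]
      _ ≤ ∑ j, |ξ j| := (norm_sum_le _ _).trans_eq (by simp)
      _ ≤ n * |ξ k| := (Finset.sum_le_sum fun j _ => hk j).trans_eq (by simp)
  have hmax : 1 + ‖ξ‖ ≤ (n + 1) * max 1 |ξ k| := by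
    have hn : (n : ℝ) * |ξ k| ≤ n * max 1 |ξ k| := by gcongr; exact le_max_right ..
    linarith [le_max_left 1 |ξ k|]
  have hpow : max 1 |ξ k| ^ N ≤ 1 + |ξ k| ^ N := by
    rcases max_choice 1 |ξ k| with h | h <;> rw [h] <;> simp
  calc (1 + ‖ξ‖) ^ N ≤ ((n + 1) * max 1 |ξ k|) ^ N := by gcongr
    _ = ((n : ℝ) + 1) ^ N * max 1 |ξ k| ^ N := mul_pow ..
    _ ≤ ((n : ℝ) + 1) ^ N * (1 + ∑ k, |ξ k| ^ N) := by
      refine mul_le_mul_of_nonneg_left (hpow.trans ?_) (by positivity)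
      gcongr
      exact Finset.single_le_sum (f := fun k => |ξ k| ^ N) (fun _ _ => by positivity)
        (Finset.mem_univ k)

lemma exists_one_add_norm_pow_mul_laplaceTransform_le {φ : E n → ℂ}
    (hφ : ContDiff ℝ (⊤ : ℕ∞) φ) {R : ℝ} (hs : tsupport φ ⊆ Metric.closedBall 0 R) (N : ℕ) :
    ∃ C, 0 ≤ C ∧ ∀ η ξ : E n,
      (1 + ‖ξ‖) ^ N * ‖laplaceTransform φ (cvec η ξ)‖ ≤ C * Real.exp (R * ‖η‖) := by
  choose C hC hle using fun k => exists_norm_pow_mul_laplaceTransform_le hφ hs k N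
  have hsum : 0 ≤ ∑ k, C k := Finset.sum_nonneg fun k _ => hC k
  refine ⟨((n : ℝ) + 1) ^ N * ((∫ x, ‖φ x‖) + ∑ k, C k), by positivity, fun η ξ => ?_⟩
  have hcoord (k : Fin n) :
      |ξ k| ^ N * ‖laplaceTransform φ (cvec η ξ)‖ ≤ C k * Real.exp (R * ‖η‖) := by
    refine le_trans ?_ (hle k η ξ)
    gcongr
    simpa [cvec] using Complex.abs_im_le_norm (cvec η ξ k)
  calc (1 + ‖ξ‖) ^ N * ‖laplaceTransform φ (cvec η ξ)‖
      ≤ ((n : ℝ) + 1) ^ N * (1 + ∑ k, |ξ k| ^ N) * ‖laplaceTransform φ (cvec η ξ)‖ := by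
        gcongr
        exact one_add_norm_pow_le N ξ
    _ = ((n : ℝ) + 1) ^ N * (‖laplaceTransform φ (cvec η ξ)‖ +
        ∑ k, |ξ k| ^ N * ‖laplaceTransform φ (cvec η ξ)‖) := by
        rw [← Finset.sum_mul]; ring
    _ ≤ ((n : ℝ) + 1) ^ N * ((∫ x, ‖φ x‖) * Real.exp (R * ‖η‖) +
        ∑ k, C k * Real.exp (R * ‖η‖)) := by
        refine mul_le_mul_of_nonneg_left (add_le_add ?_ ?_) (by positivity)
        · exact norm_laplaceTransform_le hφ.continuous hs η ξ
        · exact Finset.sum_le_sum fun k _ => hcoord k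
    _ = ((n : ℝ) + 1) ^ N * ((∫ x, ‖φ x‖) + ∑ k, C k) * Real.exp (R * ‖η‖) := by
        rw [← Finset.sum_mul]; ring

lemma continuous_laplaceTransform {φ : E n → ℂ} (hφ : Continuous φ)
    (hc : HasCompactSupport φ) :
    Continuous fun p : E n × E n => laplaceTransform φ (cvec p.1 p.2) := by
  have hset (p : E n × E n) : laplaceTransform φ (cvec p.1 p.2) =
      ∫ x in tsupport φ, Complex.exp ((inner ℝ p.1 x : ℂ) + (inner ℝ p.2 x : ℂ) * Complex.I) *
        φ x := by
    unfold laplaceTransform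
    simp only [wave_cvec]
    refine (setIntegral_eq_integral_of_forall_compl_eq_zero fun x hx => ?_).symm
    rw [image_eq_zero_of_notMem_tsupport hx, mul_zero]
  simp only [hset]
  refine continuous_parametric_integral_of_continuous ?_ hc
  have : Continuous fun q : (E n × E n) × E n => φ q.2 := hφ.comp continuous_snd
  simp only [Function.uncurry_def]
  fun_prop

/-- The weight `(1 + ‖x‖)⁻ᴺ`, integrable on `ℝⁿ` for `N = n + 1`. -/
def decayWeight (N : ℕ) (x : E n) : ℝ := ((1 + ‖x‖) ^ N)⁻¹

lemma decayWeight_nonneg (N : ℕ) (x : E n) : 0 ≤ decayWeight N x := by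
  unfold decayWeight; positivity

lemma integrable_decayWeight : Integrable (decayWeight (n := n) (n + 1)) := by
  refine (integrable_one_add_norm (E := E n) (μ := volume) (r := (n : ℝ) + 1) (by simp)).congr
    (Eventually.of_forall fun x => ?_)
  simp only [decayWeight]
  rw [Real.rpow_neg (by positivity)]
  norm_cast

lemma le_mul_decayWeight {N : ℕ} {a C : ℝ} (ha : 0 ≤ a) {w : E n}
    (h : (1 + ‖-(2 * Real.pi) • w‖) ^ N * a ≤ C) : a ≤ C * decayWeight N w := by
  have hw : ‖w‖ ≤ ‖-(2 * Real.pi) • w‖ := by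
    rw [norm_smul, norm_neg, Real.norm_of_nonneg (by positivity)]
    nlinarith [norm_nonneg w, Real.pi_gt_three]
  rw [decayWeight, ← div_eq_mul_inv, le_div_iff₀ (by positivity), mul_comm]
  refine le_trans ?_ h
  gcongr

open scoped FourierTransform

lemma fourier_wave_mul (φ : E n → ℂ) (η w : E n) :
    𝓕 (fun x => wave (cvec η 0) x * φ x) w =
      laplaceTransform φ (cvec η (-(2 * Real.pi) • w)) := by
  rw [Real.fourier_eq]
  unfold laplaceTransform
  congr 1; ext x
  rw [wave_cvec, wave_cvec, Circle.smul_def, smul_eq_mul, ← mul_assoc, Real.fourierChar_apply,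
    ← Complex.exp_add]
  congr 2
  simp only [inner_zero_left, inner_smul_left, real_inner_comm, conj_trivial]
  push_cast
  ring

lemma integrable_laplaceTransform {φ : E n → ℂ} (hφ : ContDiff ℝ (⊤ : ℕ∞) φ)
    (hc : HasCompactSupport φ) (η : E n) :
    Integrable fun w : E n => laplaceTransform φ (cvec η (-(2 * Real.pi) • w)) := by
  obtain ⟨R, hs⟩ := hc.isCompact.isBounded.subset_closedBall 0
  obtain ⟨C, -, hle⟩ := exists_one_add_norm_pow_mul_laplaceTransform_le hφ hs (n + 1)
  refine Integrable.mono' (integrable_decayWeight.const_mul (C * Real.exp (R * ‖η‖))) ?_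
    (Eventually.of_forall fun w => le_mul_decayWeight (norm_nonneg _) (hle η _))
  exact ((continuous_laplaceTransform hφ.continuous hc).comp
    (by fun_prop : Continuous fun w : E n => (η, -(2 * Real.pi) • w))).aestronglyMeasurable

/-- The Fourier character `e^{2πi⟨w, x⟩}`. -/
def character (w x : E n) : ℂ := Complex.exp ((2 * Real.pi * inner ℝ w x : ℝ) * Complex.I)

lemma norm_character (w x : E n) : ‖character w x‖ = 1 := Complex.norm_exp_ofReal_mul_I _

lemma wave_mul_eq_integral {φ : E n → ℂ} (hφ : ContDiff ℝ (⊤ : ℕ∞) φ)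
    (hc : HasCompactSupport φ) (η x : E n) :
    wave (cvec η 0) x * φ x =
      ∫ w, character w x * laplaceTransform φ (cvec η (-(2 * Real.pi) • w)) := by
  have hfourier : 𝓕 (fun x => wave (cvec η 0) x * φ x) =
      fun w => laplaceTransform φ (cvec η (-(2 * Real.pi) • w)) :=
    funext fun w => fourier_wave_mul φ η w
  have hcont : Continuous fun x => wave (cvec η 0) x * φ x :=
    (continuous_wave _).mul hφ.continuous
  have hinv := hcont.fourierInv_fourier_eq
    (integrable_wave_mul hφ.continuous hc (cvec η 0))
    (by rw [hfourier]; exact integrable_laplaceTransform hφ hc η)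
  rw [hfourier] at hinv
  rw [← congrFun hinv x, Real.fourierInv_eq']
  rfl

lemma exp_inner_mul_norm_le {φ : E n → ℂ} (hφ : ContDiff ℝ (⊤ : ℕ∞) φ)
    (hc : HasCompactSupport φ) {η : E n} {A : ℝ}
    (h : ∀ w : E n, ‖laplaceTransform φ (cvec η (-(2 * Real.pi) • w))‖ ≤
      A * decayWeight (n + 1) w) (x : E n) :
    Real.exp (inner ℝ η x) * ‖φ x‖ ≤ A * ∫ w : E n, decayWeight (n + 1) w := by
  rw [← norm_wave_cvec η 0 x, ← norm_mul, wave_mul_eq_integral hφ hc, ← integral_const_mul]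
  refine norm_integral_le_of_norm_le (integrable_decayWeight.const_mul A)
    (Eventually.of_forall fun w => ?_)
  rw [norm_mul, norm_character, one_mul]
  exact h w

end TransformDecay

section FinitePropagation

variable {n : ℕ}

lemma sum_cvec_sq (η ξ : E n) :
    ∑ k, cvec η ξ k ^ 2 = ((‖η‖ ^ 2 - ‖ξ‖ ^ 2 : ℝ) : ℂ) + 2 * (inner ℝ η ξ : ℝ) * Complex.I := by
  rw [← real_inner_self_eq_norm_sq, ← real_inner_self_eq_norm_sq, inner_eq_sum_mul,
    inner_eq_sum_mul, inner_eq_sum_mul]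
  push_cast
  rw [Finset.mul_sum, Finset.sum_mul, ← Finset.sum_sub_distrib, ← Finset.sum_add_distrib]
  refine Finset.sum_congr rfl fun k _ => ?_
  rw [cvec]
  linear_combination (ξ k : ℂ) ^ 2 * Complex.I_sq

/-- The dispersion relation `ω² = m² - κ·κ`: a plane wave `e^{κ·x}` evolves with frequency `ω`. -/
def IsFrequency (m : ℝ) (κ : Fin n → ℂ) (ω : ℂ) : Prop :=
  ω ^ 2 = (m : ℂ) ^ 2 - ∑ k, κ k ^ 2

lemma exists_isFrequency (m : ℝ) (κ : Fin n → ℂ) : ∃ ω, IsFrequency m κ ω :=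
  IsAlgClosed.exists_pow_nat_eq _ two_pos

lemma IsFrequency.abs_im_le {m : ℝ} {η ξ : E n} {ω : ℂ} (hω : IsFrequency m (cvec η ξ) ω) :
    |ω.im| ≤ ‖η‖ := by
  rw [IsFrequency, sum_cvec_sq] at hω
  have hre : ω.re ^ 2 - ω.im ^ 2 = m ^ 2 - (‖η‖ ^ 2 - ‖ξ‖ ^ 2) := by
    simpa [sq] using congrArg Complex.re hω
  have him : ω.re * ω.im = -inner ℝ η ξ := by
    have h := congrArg Complex.im hω
    simp [sq] at h
    linarith
  have hcauchy : (ω.re * ω.im) ^ 2 ≤ ‖η‖ ^ 2 * ‖ξ‖ ^ 2 := by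
    rw [him, neg_sq, ← mul_pow]
    exact sq_le_sq.2 ((abs_real_inner_le_norm η ξ).trans (le_abs_self _))
  refine abs_le_of_sq_le_sq ?_ (norm_nonneg _)
  by_contra! hlt
  have hξ : ‖ξ‖ ^ 2 < ω.re ^ 2 := by nlinarith [sq_nonneg m]
  nlinarith [mul_lt_mul'' hlt hξ (sq_nonneg _) (sq_nonneg _)]

lemma IsFrequency.norm_le {m : ℝ} {η ξ : E n} {ω : ℂ} (hω : IsFrequency m (cvec η ξ) ω) :
    ‖ω‖ ≤ |m| + ‖η‖ + ‖ξ‖ := by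
  refine le_of_sq_le_sq ?_ (by positivity)
  rw [← norm_pow, hω, sum_cvec_sq]
  have hreal : ‖((‖η‖ ^ 2 - ‖ξ‖ ^ 2 : ℝ) : ℂ)‖ ≤ ‖η‖ ^ 2 + ‖ξ‖ ^ 2 := by
    rw [Complex.norm_real, Real.norm_eq_abs]
    exact abs_le.2 ⟨by nlinarith [sq_nonneg ‖η‖], by nlinarith [sq_nonneg ‖ξ‖]⟩
  have himag : ‖2 * ((inner ℝ η ξ : ℝ) : ℂ) * Complex.I‖ ≤ 2 * (‖η‖ * ‖ξ‖) := by
    simp only [norm_mul, Complex.norm_I, mul_one, Complex.norm_ofNat, Complex.norm_real]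
    gcongr
    exact abs_real_inner_le_norm η ξ
  calc _ ≤ ‖(m : ℂ) ^ 2‖ + (‖((‖η‖ ^ 2 - ‖ξ‖ ^ 2 : ℝ) : ℂ)‖ +
        ‖2 * ((inner ℝ η ξ : ℝ) : ℂ) * Complex.I‖) :=
        (norm_sub_le _ _).trans (add_le_add_right (norm_add_le _ _) _)
    _ ≤ |m| ^ 2 + (‖η‖ ^ 2 + ‖ξ‖ ^ 2 + 2 * (‖η‖ * ‖ξ‖)) := by
        rw [norm_pow, Complex.norm_real, Real.norm_eq_abs]
        gcongr
    _ = |m| ^ 2 + (‖η‖ + ‖ξ‖) ^ 2 := by ring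
    _ ≤ (|m| + ‖η‖ + ‖ξ‖) ^ 2 := by
        rw [add_assoc, add_sq |m|]
        nlinarith [mul_nonneg (abs_nonneg m) (add_nonneg (norm_nonneg η) (norm_nonneg ξ))]

lemma norm_exp_mul_I_le (z : ℂ) : ‖Complex.exp (z * Complex.I)‖ ≤ Real.exp |z.im| := by
  rw [Complex.norm_exp]
  simp [neg_le_abs]

lemma norm_cos_le_exp (z : ℂ) : ‖Complex.cos z‖ ≤ Real.exp |z.im| := by
  have hneg := norm_exp_mul_I_le (-z)
  rw [Complex.neg_im, abs_neg] at hneg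
  rw [Complex.cos, norm_div, Complex.norm_ofNat]
  linarith [norm_add_le (Complex.exp (z * Complex.I)) (Complex.exp (-z * Complex.I)),
    norm_exp_mul_I_le z]

lemma norm_sin_le_exp (z : ℂ) : ‖Complex.sin z‖ ≤ Real.exp |z.im| := by
  have hneg := norm_exp_mul_I_le (-z)
  rw [Complex.neg_im, abs_neg] at hneg
  rw [Complex.sin, norm_div, Complex.norm_ofNat, norm_mul, Complex.norm_I, mul_one]
  linarith [norm_sub_le (Complex.exp (-z * Complex.I)) (Complex.exp (z * Complex.I)),
    norm_exp_mul_I_le z]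

lemma hasDerivAt_mul_ofReal (ω : ℂ) (s : ℝ) : HasDerivAt (fun s : ℝ => ω * (s : ℂ)) ω s := by
  simpa using (Complex.ofRealCLM.hasDerivAt (x := s)).const_mul ω

lemma hasDerivAt_cos_mul (ω : ℂ) (s : ℝ) :
    HasDerivAt (fun s : ℝ => Complex.cos (ω * s)) (-ω * Complex.sin (ω * s)) s := by
  have hcomp := (Complex.hasDerivAt_cos (ω * s)).scomp s (hasDerivAt_mul_ofReal ω s)
  rwa [smul_eq_mul, mul_neg, ← neg_mul] at hcomp

lemma hasDerivAt_sin_mul (ω : ℂ) (s : ℝ) :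
    HasDerivAt (fun s : ℝ => Complex.sin (ω * s)) (ω * Complex.cos (ω * s)) s := by
  have hcomp := (Complex.hasDerivAt_sin (ω * s)).scomp s (hasDerivAt_mul_ofReal ω s)
  exact hcomp

/-- `sin (ω s) / ω`, written as an integral so that it also covers `ω = 0`. It is the solution of
`c'' = -ω² c` with `c 0 = 0` and `c' 0 = 1`. -/
def sinDiv (ω : ℂ) (s : ℝ) : ℂ := ∫ u in (0 : ℝ)..s, Complex.cos (ω * u)

lemma hasDerivAt_sinDiv (ω : ℂ) (s : ℝ) : HasDerivAt (sinDiv ω) (Complex.cos (ω * s)) s := by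
  have hcont : Continuous fun u : ℝ => Complex.cos (ω * u) := by fun_prop
  exact (hcont.integral_hasStrictDerivAt 0 s).hasDerivAt

lemma mul_sinDiv (ω : ℂ) (s : ℝ) : ω * sinDiv ω s = Complex.sin (ω * s) := by
  have hcont : Continuous fun u : ℝ => ω * Complex.cos (ω * u) := by fun_prop
  rw [sinDiv, ← intervalIntegral.integral_const_mul,
    intervalIntegral.integral_eq_sub_of_hasDerivAt (fun u _ => hasDerivAt_sin_mul ω u)
      (hcont.intervalIntegrable 0 s)]
  simp

lemma norm_cos_mul_le {ω : ℂ} {b : ℝ} (hω : |ω.im| ≤ b) (s : ℝ) :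
    ‖Complex.cos (ω * s)‖ ≤ Real.exp (|s| * b) := by
  refine (norm_cos_le_exp _).trans (Real.exp_le_exp.2 ?_)
  rw [Complex.im_mul_ofReal, abs_mul, mul_comm]
  gcongr

lemma norm_sin_mul_le {ω : ℂ} {b : ℝ} (hω : |ω.im| ≤ b) (s : ℝ) :
    ‖Complex.sin (ω * s)‖ ≤ Real.exp (|s| * b) := by
  refine (norm_sin_le_exp _).trans (Real.exp_le_exp.2 ?_)
  rw [Complex.im_mul_ofReal, abs_mul, mul_comm]
  gcongr

lemma norm_sinDiv_le {ω : ℂ} {b : ℝ} (hω : |ω.im| ≤ b) (s : ℝ) :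
    ‖sinDiv ω s‖ ≤ |s| * Real.exp (|s| * b) := by
  have hb : 0 ≤ b := (abs_nonneg _).trans hω
  have hbound := intervalIntegral.norm_integral_le_of_norm_le_const (a := 0) (b := s)
    (f := fun u : ℝ => Complex.cos (ω * u)) (C := Real.exp (|s| * b)) fun u hu => by
      refine (norm_cos_mul_le hω u).trans (Real.exp_le_exp.2 ?_)
      exact mul_le_mul_of_nonneg_right
        (by simpa using abs_sub_left_of_mem_uIcc (uIoc_subset_uIcc hu)) hb
  rwa [sub_zero, mul_comm] at hbound

lemma IsAdjointEvolution.conjTransform_zero {m t : ℝ} {Ψ Φ : State n} (hΨ : IsTestPair Ψ)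
    (h : IsAdjointEvolution m t Ψ Φ) {κ : Fin n → ℂ} {ω : ℂ} (hω : IsFrequency m κ ω) :
    conjTransform κ (fun x => Φ x 0) = Complex.cos (ω * t) * conjTransform κ (fun x => Ψ x 0) -
      ω * Complex.sin (ω * t) * conjTransform κ (fun x => Ψ x 1) := by
  have htest := h.conjTransform_eq hΨ κ (hasDerivAt_cos_mul ω) fun s => by
    rw [← hω]
    exact ((hasDerivAt_sin_mul ω s).const_mul (-ω)).congr_deriv (by ring)
  simp only [Complex.ofReal_zero, mul_zero, Complex.cos_zero, Complex.sin_zero, one_mul,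
    zero_mul, add_zero] at htest
  rw [htest]
  ring

lemma IsAdjointEvolution.conjTransform_one {m t : ℝ} {Ψ Φ : State n} (hΨ : IsTestPair Ψ)
    (h : IsAdjointEvolution m t Ψ Φ) {κ : Fin n → ℂ} {ω : ℂ} (hω : IsFrequency m κ ω) :
    conjTransform κ (fun x => Φ x 1) = sinDiv ω t * conjTransform κ (fun x => Ψ x 0) +
      Complex.cos (ω * t) * conjTransform κ (fun x => Ψ x 1) := by
  have htest := h.conjTransform_eq hΨ κ (hasDerivAt_sinDiv ω) fun s => by
    refine (hasDerivAt_cos_mul ω s).congr_deriv ?_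
    rw [← hω, ← mul_sinDiv]
    ring
  simpa [sinDiv] using htest

lemma IsTestPair.contDiff_conj_component {Ψ : State n} (h : IsTestPair Ψ) (i : Fin 2) :
    ContDiff ℝ (⊤ : ℕ∞) fun x => (starRingEnd ℂ) (Ψ x i) :=
  Complex.conjCLE.contDiff.comp (h.contDiff_component i)

lemma IsTestPair.hasCompactSupport_conj_component {Ψ : State n} (h : IsTestPair Ψ) (i : Fin 2) :
    HasCompactSupport fun x => (starRingEnd ℂ) (Ψ x i) :=
  (h.hasCompactSupport_component i).comp_left (g := starRingEnd ℂ) (map_zero _)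

lemma tsupport_conj_component_subset (Ψ : State n) (i : Fin 2) :
    tsupport (fun x => (starRingEnd ℂ) (Ψ x i)) ⊆ tsupport Ψ :=
  closure_mono fun x hx hzero => hx (by simp [hzero])

lemma IsAdjointEvolution.norm_conjTransform_le {m t : ℝ} {Ψ Φ : State n} (hΨ : IsTestPair Ψ)
    (h : IsAdjointEvolution m t Ψ Φ) (i : Fin 2) (η ξ : E n) :
    ‖conjTransform (cvec η ξ) fun x => Φ x i‖ ≤
      (1 + |t| + |m| + ‖η‖) * (1 + ‖ξ‖) * Real.exp (|t| * ‖η‖) *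
        (‖conjTransform (cvec η ξ) fun x => Ψ x 0‖ +
          ‖conjTransform (cvec η ξ) fun x => Ψ x 1‖) := by
  obtain ⟨ω, hω⟩ := exists_isFrequency m (cvec η ξ)
  set a := ‖conjTransform (cvec η ξ) fun x => Ψ x 0‖
  set b := ‖conjTransform (cvec η ξ) fun x => Ψ x 1‖
  set G := Real.exp (|t| * ‖η‖)
  set Q := (1 + |t| + |m| + ‖η‖) * (1 + ‖ξ‖)
  have hrest : 0 ≤ (|t| + |m| + ‖η‖) * ‖ξ‖ := by positivity
  have hη := norm_nonneg η
  have hξ := norm_nonneg ξ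
  have hone : 1 ≤ Q := by linarith [abs_nonneg t, abs_nonneg m]
  have htime : |t| ≤ Q := by linarith [abs_nonneg m]
  have hfreq : ‖ω‖ ≤ Q := by linarith [hω.norm_le, abs_nonneg t]
  have hcos : ‖Complex.cos (ω * t)‖ ≤ G := norm_cos_mul_le hω.abs_im_le t
  have hsin : ‖Complex.sin (ω * t)‖ ≤ G := norm_sin_mul_le hω.abs_im_le t
  have hsinDiv : ‖sinDiv ω t‖ ≤ |t| * G := norm_sinDiv_le hω.abs_im_le t
  fin_cases i
  · calc ‖conjTransform (cvec η ξ) fun x => Φ x 0‖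
        ≤ ‖Complex.cos (ω * t)‖ * a + ‖ω‖ * ‖Complex.sin (ω * t)‖ * b := by
          rw [h.conjTransform_zero hΨ hω, ← norm_mul, ← norm_mul, ← norm_mul]
          exact norm_sub_le _ _
      _ ≤ 1 * G * a + Q * G * b := by rw [one_mul]; gcongr
      _ ≤ Q * G * a + Q * G * b := by gcongr
      _ = Q * G * (a + b) := by ring
  · calc ‖conjTransform (cvec η ξ) fun x => Φ x 1‖
        ≤ ‖sinDiv ω t‖ * a + ‖Complex.cos (ω * t)‖ * b := by
          rw [h.conjTransform_one hΨ hω, ← norm_mul, ← norm_mul]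
          exact norm_add_le _ _
      _ ≤ |t| * G * a + 1 * G * b := by rw [one_mul]; gcongr
      _ ≤ Q * G * a + Q * G * b := by gcongr
      _ = Q * G * (a + b) := by ring

lemma IsAdjointEvolution.exists_one_add_norm_pow_mul_conjTransform_le {m t R : ℝ}
    {Ψ Φ : State n} (hΨ : IsTestPair Ψ) (hs : tsupport Ψ ⊆ Metric.closedBall 0 R)
    (h : IsAdjointEvolution m t Ψ Φ) (N : ℕ) :
    ∃ C, ∀ (i : Fin 2) (η ξ : E n),
      (1 + ‖ξ‖) ^ N * ‖conjTransform (cvec η ξ) fun x => Φ x i‖ ≤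
        C * (1 + |t| + |m| + ‖η‖) * Real.exp ((|t| + R) * ‖η‖) := by
  choose C _ hle using fun i => exists_one_add_norm_pow_mul_laplaceTransform_le
    (hΨ.contDiff_conj_component i) ((tsupport_conj_component_subset Ψ i).trans hs) (N + 1)
  refine ⟨C 0 + C 1, fun i η ξ => ?_⟩
  set a := ‖conjTransform (cvec η ξ) fun x => Ψ x 0‖
  set b := ‖conjTransform (cvec η ξ) fun x => Ψ x 1‖
  have ha : (1 + ‖ξ‖) ^ (N + 1) * a ≤ C 0 * Real.exp (R * ‖η‖) := hle 0 η ξ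
  have hb : (1 + ‖ξ‖) ^ (N + 1) * b ≤ C 1 * Real.exp (R * ‖η‖) := hle 1 η ξ
  calc (1 + ‖ξ‖) ^ N * ‖conjTransform (cvec η ξ) fun x => Φ x i‖
      ≤ (1 + ‖ξ‖) ^ N * ((1 + |t| + |m| + ‖η‖) * (1 + ‖ξ‖) * Real.exp (|t| * ‖η‖) *
          (a + b)) := by
        gcongr
        exact h.norm_conjTransform_le hΨ i η ξ
    _ = (1 + |t| + |m| + ‖η‖) * Real.exp (|t| * ‖η‖) *
        ((1 + ‖ξ‖) ^ (N + 1) * a + (1 + ‖ξ‖) ^ (N + 1) * b) := by ring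
    _ ≤ (1 + |t| + |m| + ‖η‖) * Real.exp (|t| * ‖η‖) *
        (C 0 * Real.exp (R * ‖η‖) + C 1 * Real.exp (R * ‖η‖)) := by gcongr
    _ = (C 0 + C 1) * (1 + |t| + |m| + ‖η‖) * Real.exp ((|t| + R) * ‖η‖) := by
        rw [add_mul |t| R, Real.exp_add]; ring

/-- Finite speed of propagation, in the Paley–Wiener manner: `e^{η·x} Φ(x)` grows at most like
`e^{(|t| + R) ‖η‖}` up to a linear factor, and one lets `η → ∞` in the direction of `x`. -/
theorem IsAdjointEvolution.eq_zero_of_lt_norm {m t R : ℝ} {Ψ Φ : State n} (hΨ : IsTestPair Ψ)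
    (hR : 0 ≤ R) (hs : tsupport Ψ ⊆ Metric.closedBall 0 R) (h : IsAdjointEvolution m t Ψ Φ)
    {x : E n} (hx : |t| + R < ‖x‖) : Φ x = 0 := by
  obtain ⟨C, hC⟩ := h.exists_one_add_norm_pow_mul_conjTransform_le hΨ hs (n + 1)
  set J := ∫ w : E n, decayWeight (n + 1) w
  set δ := ‖x‖ - (|t| + R) with hδ
  have hx₀ : 0 < ‖x‖ := by linarith [abs_nonneg t]
  ext i
  have hbound (l : ℝ) (hl : 0 ≤ l) : ‖Φ x i‖ ≤ C * J * ((1 + |t| + |m|) * Real.exp (-δ * l) +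
      l * Real.exp (-δ * l)) := by
    set η : E n := (l / ‖x‖) • x with hη
    have hη_norm : ‖η‖ = l := by
      rw [hη, norm_smul, norm_div, norm_norm, Real.norm_of_nonneg hl, div_mul_cancel₀ _ hx₀.ne']
    have hη_inner : inner ℝ η x = l * ‖x‖ := by
      rw [hη, real_inner_smul_left, real_inner_self_eq_norm_sq]
      field_simp
    have hweighted := exp_inner_mul_norm_le (h.1.contDiff_conj_component i)
      (h.1.hasCompactSupport_conj_component i)
      (fun w => le_mul_decayWeight (norm_nonneg _) (hC i η _)) x
    have hexp : Real.exp ((|t| + R) * l) = Real.exp (l * ‖x‖) * Real.exp (-δ * l) := by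
      rw [← Real.exp_add, hδ]
      ring_nf
    rw [hη_inner, hη_norm, RCLike.norm_conj, hexp] at hweighted
    refine le_of_mul_le_mul_left (hweighted.trans_eq ?_) (Real.exp_pos (l * ‖x‖))
    ring
  have hlim : Tendsto (fun l : ℝ => C * J * ((1 + |t| + |m|) * Real.exp (-δ * l) +
      l * Real.exp (-δ * l))) atTop (𝓝 0) := by
    have hδ₀ : 0 < δ := by linarith
    have hconst := tendsto_rpow_mul_exp_neg_mul_atTop_nhds_zero 0 δ hδ₀
    have hlinear := tendsto_rpow_mul_exp_neg_mul_atTop_nhds_zero 1 δ hδ₀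
    simp only [Real.rpow_zero, one_mul, Real.rpow_one] at hconst hlinear
    simpa using ((hconst.const_mul (1 + |t| + |m|)).add hlinear).const_mul (C * J)
  exact norm_le_zero_iff.1 (ge_of_tendsto hlim ((eventually_ge_atTop 0).mono hbound))

end FinitePropagation

section Frequency

variable {n : ℕ} {m : ℝ}

/-- `m² + 4π² (w + i η) · (w + i η)`, the square of the dispersion relation at the complex point
`w + i η`. The factor `4π²` belongs to Mathlib's normalization of the Fourier transform. -/
def freqSq (m : ℝ) (w η : E n) : ℂ :=
  ((m ^ 2 + 4 * Real.pi ^ 2 * (‖w‖ ^ 2 - ‖η‖ ^ 2) : ℝ) : ℂ) +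
    ((8 * Real.pi ^ 2 * inner ℝ w η : ℝ) : ℂ) * Complex.I

/-- The dispersion relation at the complex point `w + i η`, for the principal branch of the square
root, which is holomorphic for `4π ‖η‖ < m`. -/
def freq (m : ℝ) (w η : E n) : ℂ := Complex.sqrt (freqSq m w η)

lemma freqSq_re (w η : E n) :
    (freqSq m w η).re = m ^ 2 + 4 * Real.pi ^ 2 * (‖w‖ ^ 2 - ‖η‖ ^ 2) := by
  simp [freqSq, -Complex.ofReal_add, -Complex.ofReal_mul, -Complex.ofReal_pow, -Complex.ofReal_sub]

lemma freqSq_im (w η : E n) : (freqSq m w η).im = 8 * Real.pi ^ 2 * inner ℝ w η := by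
  simp [freqSq, -Complex.ofReal_add, -Complex.ofReal_mul, -Complex.ofReal_pow, -Complex.ofReal_sub]

lemma freq_sq (w η : E n) : freq m w η ^ 2 = freqSq m w η :=
  Complex.cpow_ofNat_inv_pow _ 2

lemma norm_freq_sq (w η : E n) : ‖freq m w η‖ ^ 2 = ‖freqSq m w η‖ := by
  rw [← norm_pow, freq_sq]

lemma mass_pos_of_lt {η : E n} (hη : 4 * Real.pi * ‖η‖ < m) : 0 < m :=
  lt_of_le_of_lt (by positivity) hη

lemma le_freqSq_re (w : E n) {η : E n} (hη : 4 * Real.pi * ‖η‖ < m) :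
    3 / 4 * m ^ 2 + 4 * Real.pi ^ 2 * ‖w‖ ^ 2 ≤ (freqSq m w η).re := by
  have hη₀ : 0 ≤ 4 * Real.pi * ‖η‖ := by positivity
  rw [freqSq_re]
  nlinarith

lemma freqSq_re_pos (w : E n) {η : E n} (hη : 4 * Real.pi * ‖η‖ < m) : 0 < (freqSq m w η).re := by
  have hm := mass_pos_of_lt hη
  exact lt_of_lt_of_le (by positivity) (le_freqSq_re w hη)

lemma freqSq_mem_slitPlane (w : E n) {η : E n} (hη : 4 * Real.pi * ‖η‖ < m) :
    freqSq m w η ∈ Complex.slitPlane :=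
  Or.inl (freqSq_re_pos w hη)

lemma freq_re_pos (w : E n) {η : E n} (hη : 4 * Real.pi * ‖η‖ < m) : 0 < (freq m w η).re := by
  have hpos := freqSq_re_pos w hη
  rw [freq, Complex.sqrt, Complex.cpow_inv_two_re]
  positivity

lemma freq_ne_zero (w : E n) {η : E n} (hη : 4 * Real.pi * ‖η‖ < m) : freq m w η ≠ 0 :=
  fun hzero => (freq_re_pos w hη).ne' (by rw [hzero, Complex.zero_re])

lemma half_mass_le_norm_freq (w : E n) {η : E n} (hη : 4 * Real.pi * ‖η‖ < m) :
    m / 2 ≤ ‖freq m w η‖ := by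
  have hsq := (le_freqSq_re w hη).trans (Complex.re_le_norm _)
  rw [← norm_freq_sq] at hsq
  have hw : 0 ≤ 4 * Real.pi ^ 2 * ‖w‖ ^ 2 := by positivity
  exact le_of_sq_le_sq (by nlinarith) (norm_nonneg _)

lemma norm_freq_le (w : E n) {η : E n} (hη : 4 * Real.pi * ‖η‖ < m) :
    ‖freq m w η‖ ≤ (2 * m + 2 * Real.pi) * (1 + ‖w‖) := by
  have hm := mass_pos_of_lt hη
  have hsq : ‖freq m w η‖ ^ 2 ≤ (m + 2 * Real.pi * (‖w‖ + ‖η‖)) ^ 2 := by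
    rw [norm_freq_sq]
    refine (Complex.norm_le_abs_re_add_abs_im _).trans ?_
    rw [freqSq_re, freqSq_im, abs_mul, abs_of_nonneg (by positivity : 0 ≤ 8 * Real.pi ^ 2)]
    have hre : |m ^ 2 + 4 * Real.pi ^ 2 * (‖w‖ ^ 2 - ‖η‖ ^ 2)| ≤
        m ^ 2 + 4 * Real.pi ^ 2 * (‖w‖ ^ 2 + ‖η‖ ^ 2) := by
      rw [abs_le]
      constructor <;> nlinarith [sq_nonneg m, mul_nonneg (sq_nonneg Real.pi) (sq_nonneg ‖w‖),
        mul_nonneg (sq_nonneg Real.pi) (sq_nonneg ‖η‖)]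
    have him : 8 * Real.pi ^ 2 * |inner ℝ w η| ≤ 8 * Real.pi ^ 2 * (‖w‖ * ‖η‖) := by
      gcongr
      exact abs_real_inner_le_norm w η
    have hcross : 0 ≤ m * (Real.pi * (‖w‖ + ‖η‖)) := by positivity
    nlinarith
  have hle := le_of_sq_le_sq hsq (by positivity)
  nlinarith [mul_nonneg hm.le (norm_nonneg w), Real.pi_pos]

lemma freq_zero_right (w : E n) :
    freq m w 0 = (Real.sqrt (m ^ 2 + 4 * Real.pi ^ 2 * ‖w‖ ^ 2) : ℂ) := by
  have hreal : freqSq m w 0 = ((m ^ 2 + 4 * Real.pi ^ 2 * ‖w‖ ^ 2 : ℝ) : ℂ) := by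
    simp [freqSq]
  rw [freq, hreal, Complex.sqrt_of_nonneg (by rw [Complex.zero_le_real]; positivity),
    Complex.ofReal_re]

lemma continuousOn_freq :
    ContinuousOn (fun p : E n × E n => freq m p.1 p.2) {p | 4 * Real.pi * ‖p.2‖ < m} := by
  have hcont : Continuous fun p : E n × E n => freqSq m p.1 p.2 := by
    unfold freqSq
    fun_prop
  intro p hp
  exact ((Complex.differentiableAt_sqrt (freqSq_mem_slitPlane p.1 hp)).continuousAt.comp
    (f := fun p : E n × E n => freqSq m p.1 p.2) hcont.continuousAt).continuousWithinAt

lemma norm_smul_of_norm_eq_one {e : E n} (he : ‖e‖ = 1) (τ : ℝ) : ‖τ • e‖ = |τ| := by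
  rw [norm_smul, he, mul_one, Real.norm_eq_abs]

lemma inner_add_smul_right_of_norm_eq_one (w : E n) {e : E n} (he : ‖e‖ = 1) (s : ℝ) :
    inner ℝ (w + s • e) e = inner ℝ w e + s := by
  rw [inner_add_left, real_inner_smul_left, real_inner_self_eq_norm_sq, he, one_pow, mul_one]

lemma freqSq_line (w : E n) {e : E n} (he : ‖e‖ = 1) (z : ℂ) :
    freqSq m (w + z.re • e) (z.im • e) =
      (m : ℂ) ^ 2 + 4 * Real.pi ^ 2 * ((‖w‖ : ℂ) ^ 2 + 2 * z * (inner ℝ w e : ℝ) + z ^ 2) := by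
  have hre : ‖w + z.re • e‖ ^ 2 = ‖w‖ ^ 2 + 2 * z.re * inner ℝ w e + z.re ^ 2 := by
    rw [norm_add_sq_real, norm_smul_of_norm_eq_one he, inner_smul_right, sq_abs]
    ring
  apply Complex.ext
  · rw [freqSq_re, hre, norm_smul_of_norm_eq_one he, sq_abs]
    simp [pow_two]
    ring
  · rw [freqSq_im, inner_smul_right, inner_add_smul_right_of_norm_eq_one w he]
    simp [pow_two]
    ring

lemma hasDerivAt_freqSq_line (w : E n) {e : E n} (he : ‖e‖ = 1) (z : ℂ) :
    HasDerivAt (fun z : ℂ => freqSq m (w + z.re • e) (z.im • e))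
      (4 * Real.pi ^ 2 * (2 * (inner ℝ w e : ℝ) + 2 * z)) z := by
  have hpoly : HasDerivAt (fun z : ℂ => (m : ℂ) ^ 2 + 4 * Real.pi ^ 2 *
      ((‖w‖ : ℂ) ^ 2 + 2 * z * (inner ℝ w e : ℝ) + z ^ 2))
      (4 * Real.pi ^ 2 * (2 * 1 * (inner ℝ w e : ℝ) + 2 * z)) z := by
    refine HasDerivAt.const_add _ (HasDerivAt.const_mul _ (HasDerivAt.add ?_ ?_))
    · exact HasDerivAt.const_add _ (((hasDerivAt_id z).const_mul _).mul_const _)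
    · simpa using hasDerivAt_pow 2 z
  rw [mul_one] at hpoly
  exact hpoly.congr_of_eventuallyEq (Eventually.of_forall fun z => freqSq_line w he z)

lemma hasDerivAt_freq_line (w : E n) {e : E n} (he : ‖e‖ = 1) {z : ℂ}
    (hz : 4 * Real.pi * |z.im| < m) :
    HasDerivAt (fun z : ℂ => freq m (w + z.re • e) (z.im • e))
      (4 * Real.pi ^ 2 * (((inner ℝ w e : ℝ) : ℂ) + z) / freq m (w + z.re • e) (z.im • e)) z := by
  have hη : 4 * Real.pi * ‖z.im • e‖ < m := by rwa [norm_smul_of_norm_eq_one he]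
  have hdiff : DifferentiableAt ℂ (fun z : ℂ => freq m (w + z.re • e) (z.im • e)) z :=
    ((Complex.differentiableAt_sqrt (freqSq_mem_slitPlane (w + z.re • e) hη)).hasDerivAt.comp z
      (hasDerivAt_freqSq_line w he z)).differentiableAt
  have hsq : HasDerivAt ((fun z : ℂ => freq m (w + z.re • e) (z.im • e)) ^ 2)
      (4 * Real.pi ^ 2 * (2 * (inner ℝ w e : ℝ) + 2 * z)) z :=
    (hasDerivAt_freqSq_line w he z).congr_of_eventuallyEq
      (Eventually.of_forall fun z => freq_sq _ _)
  have hderiv := (hdiff.hasDerivAt.pow 2).unique hsq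
  simp only [Nat.cast_ofNat, Nat.add_one_sub_one, pow_one] at hderiv
  refine hdiff.hasDerivAt.congr_deriv ?_
  rw [eq_div_iff (freq_ne_zero (w + z.re • e) hη)]
  linear_combination hderiv / 2

lemma hasDerivAt_freq_horizontal (w : E n) {e : E n} (he : ‖e‖ = 1) {τ : ℝ}
    (hτ : 4 * Real.pi * |τ| < m) (s : ℝ) :
    HasDerivAt (fun s : ℝ => freq m (w + s • e) (τ • e))
      (4 * Real.pi ^ 2 * ((inner ℝ (w + s • e) e : ℝ) + τ * Complex.I) /
        freq m (w + s • e) (τ • e)) s := by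
  have hfreq := hasDerivAt_freq_line (m := m) w he (z := (s : ℂ) + τ * Complex.I)
    (by simpa using hτ)
  have hline : HasDerivAt (fun s : ℝ => (s : ℂ) + τ * Complex.I) 1 s :=
    (hasDerivAt_id s).ofReal_comp.add_const _
  have hcomp := hfreq.scomp s hline
  rw [inner_add_smul_right_of_norm_eq_one w he, Complex.ofReal_add, add_assoc]
  simpa [Function.comp_def] using hcomp

lemma sq_inner_le_of_norm_eq_one (w : E n) {e : E n} (he : ‖e‖ = 1) :
    inner ℝ w e ^ 2 ≤ ‖w‖ ^ 2 := by
  have hcs := abs_real_inner_le_norm w e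
  rw [he, mul_one] at hcs
  exact sq_le_sq.2 (hcs.trans_eq (abs_norm w).symm)

lemma mul_im_div_eq (σ τ : ℝ) (f : ℂ) :
    (4 * Real.pi ^ 2 * ((σ : ℂ) + τ * Complex.I) / f).im =
      4 * Real.pi ^ 2 * (τ * f.re - σ * f.im) / ‖f‖ ^ 2 := by
  have hsplit : 4 * (Real.pi : ℂ) ^ 2 * ((σ : ℂ) + τ * Complex.I) =
      ((4 * Real.pi ^ 2 * σ : ℝ) : ℂ) + ((4 * Real.pi ^ 2 * τ : ℝ) : ℂ) * Complex.I := by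
    push_cast
    ring
  rw [hsplit, Complex.div_im, ← Complex.normSq_eq_norm_sq]
  simp only [Complex.add_re, Complex.add_im, Complex.re_ofReal_mul, Complex.im_ofReal_mul,
    Complex.ofReal_re, Complex.ofReal_im, Complex.I_re, Complex.I_im]
  ring

lemma le_freq_re_mul (w : E n) {e : E n} (he : ‖e‖ = 1) {τ : ℝ} (hτ₀ : 0 ≤ τ)
    (hτ : 4 * Real.pi * τ < m) :
    3 / 4 * τ * m ^ 2 ≤ (freq m w (τ • e)).re *
      (τ * (freq m w (τ • e)).re - inner ℝ w e * (freq m w (τ • e)).im) := by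
  have hre := congrArg Complex.re (freq_sq (m := m) w (τ • e))
  have him := congrArg Complex.im (freq_sq (m := m) w (τ • e))
  rw [freqSq_re, norm_smul_of_norm_eq_one he, sq_abs] at hre
  rw [freqSq_im, inner_smul_right] at him
  have hcs := sq_inner_le_of_norm_eq_one w he
  set f := freq m w (τ • e)
  set σ : ℝ := inner ℝ w e
  simp only [pow_two, Complex.mul_re, Complex.mul_im] at hre him
  have hprod : f.re * (τ * f.re - σ * f.im) =
      τ * (m ^ 2 - 4 * Real.pi ^ 2 * τ ^ 2 + 4 * Real.pi ^ 2 * (‖w‖ ^ 2 - σ ^ 2) + f.im ^ 2) := by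
    linear_combination τ * hre - σ / 2 * him
  have htransverse : 0 ≤ 4 * Real.pi ^ 2 * (‖w‖ ^ 2 - σ ^ 2) :=
    mul_nonneg (by positivity) (sub_nonneg.2 hcs)
  have hshift : 4 * Real.pi ^ 2 * τ ^ 2 ≤ m ^ 2 / 4 := by
    have : 0 ≤ 4 * Real.pi * τ := by positivity
    nlinarith
  rw [hprod]
  nlinarith [mul_nonneg hτ₀ htransverse, mul_nonneg hτ₀ (sq_nonneg f.im),
    mul_nonneg hτ₀ (sub_nonneg.2 hshift)]

lemma le_im_deriv_freq (w : E n) {e : E n} (he : ‖e‖ = 1) {τ : ℝ} (hτ₀ : 0 ≤ τ)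
    (hτ : 4 * Real.pi * τ < m) :
    3 * Real.pi ^ 2 * τ * m ^ 2 / ‖freq m w (τ • e)‖ ^ 3 ≤
      (4 * Real.pi ^ 2 * ((inner ℝ w e : ℝ) + τ * Complex.I) / freq m w (τ • e)).im := by
  have hη : 4 * Real.pi * ‖τ • e‖ < m := by
    rwa [norm_smul_of_norm_eq_one he, abs_of_nonneg hτ₀]
  have hre := freq_re_pos w hη
  have hprod := le_freq_re_mul w he hτ₀ hτ
  have hle := Complex.re_le_norm (freq m w (τ • e))
  rw [mul_im_div_eq]
  set f := freq m w (τ • e)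
  set D := τ * f.re - inner ℝ w e * f.im
  have hD : 0 ≤ D :=
    nonneg_of_mul_nonneg_right ((by positivity : 0 ≤ 3 / 4 * τ * m ^ 2).trans hprod) hre
  have hN : 0 < ‖f‖ := hre.trans_le hle
  rw [div_le_div_iff₀ (by positivity) (by positivity)]
  calc 3 * Real.pi ^ 2 * τ * m ^ 2 * ‖f‖ ^ 2
      = 4 * Real.pi ^ 2 * ‖f‖ ^ 2 * (3 / 4 * τ * m ^ 2) := by ring
    _ ≤ 4 * Real.pi ^ 2 * ‖f‖ ^ 2 * (‖f‖ * D) := by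
        have := hprod.trans (mul_le_mul_of_nonneg_right hle hD)
        gcongr
    _ = 4 * Real.pi ^ 2 * D * ‖f‖ ^ 3 := by ring

/-- The rate at which the imaginary part of the frequency grows along horizontal lines. -/
def dispersionRate (m : ℝ) : ℝ := 3 * Real.pi ^ 2 * m ^ 2 / (2 * m + 2 * Real.pi) ^ 3

lemma dispersionRate_pos (hm : 0 < m) : 0 < dispersionRate m := by
  unfold dispersionRate; positivity

lemma le_im_freq_sub (w : E n) {e : E n} (he : ‖e‖ = 1) {τ r : ℝ} (hτ₀ : 0 ≤ τ)
    (hτ : 4 * Real.pi * τ < m) (hr : 0 ≤ r) :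
    dispersionRate m * τ * r / (1 + ‖w‖ + r) ^ 3 ≤
      (freq m (w + r • e) (τ • e)).im - (freq m w (τ • e)).im := by
  have hη : 4 * Real.pi * ‖τ • e‖ < m := by
    rwa [norm_smul_of_norm_eq_one he, abs_of_nonneg hτ₀]
  have hm := mass_pos_of_lt hη
  have hderiv (s : ℝ) : HasDerivAt (fun s : ℝ => (freq m (w + s • e) (τ • e)).im)
      (4 * Real.pi ^ 2 * ((inner ℝ (w + s • e) e : ℝ) + τ * Complex.I) /
        freq m (w + s • e) (τ • e)).im s :=
    Complex.imCLM.hasFDerivAt.comp_hasDerivAt s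
      (hasDerivAt_freq_horizontal w he (by rwa [abs_of_nonneg hτ₀]) s)
  have hmean := Convex.mul_sub_le_image_sub_of_le_deriv (convex_Icc 0 r)
    (f := fun s : ℝ => (freq m (w + s • e) (τ • e)).im)
    (C := dispersionRate m * τ / (1 + ‖w‖ + r) ^ 3)
    (fun s _ => (hderiv s).continuousAt.continuousWithinAt)
    (fun s _ => (hderiv s).differentiableAt.differentiableWithinAt) ?_ 0 (left_mem_Icc.2 hr)
    r (right_mem_Icc.2 hr) hr
  · simp only [zero_smul, add_zero, sub_zero] at hmean
    exact (le_of_eq (by ring)).trans hmean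
  · intro s hs
    rw [interior_Icc] at hs
    rw [(hderiv s).deriv]
    refine le_trans ?_ (le_im_deriv_freq (w + s • e) he hτ₀ hτ)
    have hN : ‖freq m (w + s • e) (τ • e)‖ ≤ (2 * m + 2 * Real.pi) * (1 + ‖w‖ + r) := by
      refine (norm_freq_le _ hη).trans (mul_le_mul_of_nonneg_left ?_ (by positivity))
      have hnorm := norm_add_le w (s • e)
      rw [norm_smul_of_norm_eq_one he, abs_of_pos hs.1] at hnorm
      linarith [hs.2]
    have hpos : 0 < ‖freq m (w + s • e) (τ • e)‖ := norm_pos_iff.2 (freq_ne_zero _ hη)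
    calc dispersionRate m * τ / (1 + ‖w‖ + r) ^ 3
        = 3 * Real.pi ^ 2 * τ * m ^ 2 / ((2 * m + 2 * Real.pi) * (1 + ‖w‖ + r)) ^ 3 := by
          rw [dispersionRate]
          field_simp
      _ ≤ 3 * Real.pi ^ 2 * τ * m ^ 2 / ‖freq m (w + s • e) (τ • e)‖ ^ 3 := by gcongr

end Frequency

section Amplitude

variable {n : ℕ} {m : ℝ}

/-- An amplitude `a w η` is a function of the complex point `w + i η` that is holomorphic along
complex lines and rapidly decreasing in `w`, uniformly in the tube `4π ‖η‖ < m`. These are the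
integrands whose contour of integration may be shifted. -/
structure IsAmplitude (m : ℝ) (a : E n → E n → ℂ) : Prop where
  differentiableAt : ∀ w e : E n, ‖e‖ = 1 → ∀ z : ℂ, 4 * Real.pi * |z.im| < m →
    DifferentiableAt ℂ (fun z : ℂ => a (w + z.re • e) (z.im • e)) z
  continuousOn : ContinuousOn (fun p : E n × E n => a p.1 p.2) {p | 4 * Real.pi * ‖p.2‖ < m}
  bound : ∀ N : ℕ, ∃ C, 0 ≤ C ∧ ∀ w η : E n, 4 * Real.pi * ‖η‖ < m →
    ‖a w η‖ ≤ C * decayWeight N w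

lemma IsAmplitude.conj_neg {a : E n → E n → ℂ} (ha : IsAmplitude m a) :
    IsAmplitude m (fun w η => starRingEnd ℂ (a w (-η))) where
  differentiableAt w e he z hz := by
    have hconj := (ha.differentiableAt w e he (starRingEnd ℂ z) (by simpa using hz)).conj_conj
    simp only [Complex.conj_conj] at hconj
    exact hconj.congr_of_eventuallyEq (Eventually.of_forall fun z => by simp [Function.comp_def])
  continuousOn := by
    have hneg : ContinuousOn (fun p : E n × E n => a p.1 (-p.2)) {p | 4 * Real.pi * ‖p.2‖ < m} :=
      ha.continuousOn.comp (f := fun p : E n × E n => (p.1, -p.2)) (by fun_prop)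
        (fun p hp => by simpa using hp)
    exact Complex.continuous_conj.comp_continuousOn hneg
  bound N := by
    obtain ⟨C, hC, hle⟩ := ha.bound N
    refine ⟨C, hC, fun w η hη => ?_⟩
    rw [RCLike.norm_conj]
    exact hle w (-η) (by simpa using hη)

lemma decayWeight_eq_mul_succ (N : ℕ) (w : E n) :
    decayWeight N w = (1 + ‖w‖) * decayWeight (N + 1) w := by
  have hpos : 0 < 1 + ‖w‖ := by positivity
  rw [decayWeight, decayWeight, pow_succ', mul_inv, mul_inv_cancel_left₀ hpos.ne']

lemma IsAmplitude.freq_mul {a : E n → E n → ℂ} (hm : 0 < m) (ha : IsAmplitude m a) :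
    IsAmplitude m (fun w η => freq m w η * a w η) where
  differentiableAt w e he z hz :=
    (hasDerivAt_freq_line w he hz).differentiableAt.mul (ha.differentiableAt w e he z hz)
  continuousOn := continuousOn_freq.mul ha.continuousOn
  bound N := by
    obtain ⟨C, hC, hle⟩ := ha.bound (N + 1)
    refine ⟨(2 * m + 2 * Real.pi) * C, by positivity, fun w η hη => ?_⟩
    rw [norm_mul, decayWeight_eq_mul_succ]
    calc ‖freq m w η‖ * ‖a w η‖
        ≤ ((2 * m + 2 * Real.pi) * (1 + ‖w‖)) * (C * decayWeight (N + 1) w) :=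
          mul_le_mul (norm_freq_le w hη) (hle w η hη) (norm_nonneg _) (by positivity)
      _ = (2 * m + 2 * Real.pi) * C * ((1 + ‖w‖) * decayWeight (N + 1) w) := by ring

lemma IsAmplitude.inv_freq_mul {a : E n → E n → ℂ} (hm : 0 < m) (ha : IsAmplitude m a) :
    IsAmplitude m (fun w η => (freq m w η)⁻¹ * a w η) where
  differentiableAt w e he z hz :=
    ((hasDerivAt_freq_line w he hz).differentiableAt.inv
      (freq_ne_zero _ (by rwa [norm_smul_of_norm_eq_one he]))).mul (ha.differentiableAt w e he z hz)
  continuousOn := (continuousOn_freq.inv₀ fun p hp => freq_ne_zero p.1 hp).mul ha.continuousOn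
  bound N := by
    obtain ⟨C, hC, hle⟩ := ha.bound N
    refine ⟨(m / 2)⁻¹ * C, by positivity, fun w η hη => ?_⟩
    rw [norm_mul, mul_assoc, norm_inv]
    have hlower := half_mass_le_norm_freq w hη
    exact mul_le_mul (by gcongr) (hle w η hη) (norm_nonneg _) (by positivity)

lemma differentiable_integral_exp_mul {φ : E n → ℂ} (hφ : Continuous φ)
    (hc : HasCompactSupport φ) {α β : E n → ℂ} (hα : Continuous α) (hβ : Continuous β) :
    Differentiable ℂ fun z : ℂ => ∫ x, Complex.exp (α x + z * β x) * φ x := by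
  intro z
  have hcont (z : ℂ) : Continuous fun x => Complex.exp (α x + z * β x) * φ x := by fun_prop
  have hbound : Continuous fun x => Real.exp (‖α x‖ + (‖z‖ + 1) * ‖β x‖) * ‖β x‖ * ‖φ x‖ := by
    fun_prop
  refine (hasDerivAt_integral_of_dominated_loc_of_deriv_le (Metric.ball_mem_nhds z one_pos)
    (F := fun z x => Complex.exp (α x + z * β x) * φ x)
    (F' := fun z x => Complex.exp (α x + z * β x) * β x * φ x)
    (bound := fun x => Real.exp (‖α x‖ + (‖z‖ + 1) * ‖β x‖) * ‖β x‖ * ‖φ x‖)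
    (Eventually.of_forall fun z => (hcont z).aestronglyMeasurable)
    ((hcont z).integrable_of_hasCompactSupport hc.mul_left)
    (by fun_prop : Continuous fun x => Complex.exp (α x + z * β x) * β x * φ x).aestronglyMeasurable
    ?_ (hbound.integrable_of_hasCompactSupport hc.norm.mul_left) ?_).2.differentiableAt
  · refine Eventually.of_forall fun x y hy => ?_
    have hy_norm : ‖y‖ ≤ ‖z‖ + 1 := by
      have hdist : ‖y - z‖ < 1 := by simpa [dist_eq_norm] using hy
      linarith [norm_le_norm_add_norm_sub' y z]
    rw [norm_mul, norm_mul]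
    gcongr
    refine (Complex.norm_exp_le_exp_norm _).trans (Real.exp_le_exp.2 ?_)
    refine (norm_add_le _ _).trans ?_
    rw [norm_mul]
    gcongr
  · refine Eventually.of_forall fun x y _ => ?_
    have hphase : HasDerivAt (fun y : ℂ => α x + y * β x) (β x) y := by
      simpa using ((hasDerivAt_id y).mul_const (β x)).const_add (α x)
    exact hphase.cexp.mul_const _

lemma isAmplitude_laplaceTransform (m : ℝ) {φ : E n → ℂ}
    (hφ : ContDiff ℝ (⊤ : ℕ∞) φ) (hc : HasCompactSupport φ) :
    IsAmplitude m (fun w η : E n =>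
      laplaceTransform φ (cvec ((2 * Real.pi) • η) (-(2 * Real.pi) • w))) where
  differentiableAt w e _ z _ := by
    have hdiff := differentiable_integral_exp_mul hφ.continuous hc
      (α := fun x => ((-(2 * Real.pi) * inner ℝ w x : ℝ) : ℂ) * Complex.I)
      (β := fun x => ((-(2 * Real.pi) * inner ℝ e x : ℝ) : ℂ) * Complex.I)
      (by fun_prop) (by fun_prop) z
    refine hdiff.congr_of_eventuallyEq (Eventually.of_forall fun z => ?_)
    refine integral_congr_ae (Eventually.of_forall fun x => ?_)
    simp only [wave_cvec, real_inner_smul_left, inner_add_left]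
    congr 2
    push_cast
    linear_combination (-2 * Real.pi * (inner ℝ e x : ℝ) * Complex.I) * Complex.re_add_im z +
      2 * Real.pi * z.im * (inner ℝ e x : ℝ) * Complex.I_sq
  continuousOn :=
    ((continuous_laplaceTransform hφ.continuous hc).comp
      (f := fun p : E n × E n => ((2 * Real.pi) • p.2, -(2 * Real.pi) • p.1))
      (by fun_prop)).continuousOn
  bound N := by
    obtain ⟨R, hs⟩ := hc.isCompact.isBounded.subset_closedBall 0
    obtain ⟨C, hC, hle⟩ := exists_one_add_norm_pow_mul_laplaceTransform_le hφ hs N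
    refine ⟨C * Real.exp (|R| * m), by positivity, fun w η hη => ?_⟩
    refine le_mul_decayWeight (norm_nonneg _) ((hle _ _).trans ?_)
    gcongr
    · exact le_abs_self R
    · rw [norm_smul, Real.norm_of_nonneg (by positivity)]
      have : 0 ≤ Real.pi * ‖η‖ := by positivity
      linarith

end Amplitude

section ContourShift

variable {n : ℕ}

lemma decayWeight_add_le (N : ℕ) {w v : E n} (hv : ‖v‖ ≤ 1) :
    decayWeight N (w + v) ≤ 2 ^ N * decayWeight N w := by
  unfold decayWeight
  rw [← div_eq_mul_inv, inv_le_comm₀ (by positivity) (by positivity), inv_div,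
    div_le_iff₀ (by positivity), ← mul_pow]
  have htriangle : ‖w‖ ≤ ‖w + v‖ + ‖v‖ := by
    simpa using norm_sub_le (w + v) v
  gcongr
  linarith [norm_nonneg (w + v)]

lemma ae_prod_restrict_snd_mem {T : Set ℝ} (hT : MeasurableSet T) :
    ∀ᵐ p : E n × ℝ ∂(volume.prod (volume.restrict T)), p.2 ∈ T :=
  Measure.quasiMeasurePreserving_snd.ae (ae_restrict_mem hT)

lemma integrable_prod_of_norm_le_decayWeight {F : E n × ℝ → ℂ} {T : Set ℝ} (hT : MeasurableSet T)
    (hTv : volume T < ∞)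
    (hF : AEStronglyMeasurable F (volume.prod (volume.restrict T))) {C : ℝ}
    (hle : ∀ w, ∀ s ∈ T, ‖F (w, s)‖ ≤ C * decayWeight (n + 1) w) :
    Integrable F (volume.prod (volume.restrict T)) := by
  have : IsFiniteMeasure (volume.restrict T) := isFiniteMeasure_restrict.2 hTv.ne
  refine ((integrable_decayWeight.const_mul C).comp_fst (volume.restrict T)).mono' hF ?_
  filter_upwards [ae_prod_restrict_snd_mem hT] with p hp
  exact hle p.1 p.2 hp

lemma integral_integral_translate {g : E n → ℂ} (hg : Continuous g) {C : ℝ} (hC : 0 ≤ C)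
    (hle : ∀ w, ‖g w‖ ≤ C * decayWeight (n + 1) w) {e : E n} (he : ‖e‖ = 1) :
    Integrable (fun w => ∫ x in (0 : ℝ)..1, g (w + x • e)) ∧
      ∫ w, ∫ x in (0 : ℝ)..1, g (w + x • e) = ∫ w, g w := by
  have hint : Integrable (fun p : E n × ℝ => g (p.1 + p.2 • e))
      (volume.prod (volume.restrict (Ioc (0 : ℝ) 1))) := by
    refine integrable_prod_of_norm_le_decayWeight (C := C * 2 ^ (n + 1)) measurableSet_Ioc
      (by simp) (by fun_prop) fun w s hs => ?_
    rw [mul_assoc]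
    refine (hle _).trans (mul_le_mul_of_nonneg_left (decayWeight_add_le _ ?_) hC)
    rw [norm_smul_of_norm_eq_one he, abs_of_pos hs.1]
    exact hs.2
  simp only [intervalIntegral.integral_of_le zero_le_one]
  refine ⟨hint.integral_prod_left, ?_⟩
  rw [integral_integral_swap hint]
  simp only [integral_add_right_eq_self]
  simp

lemma integrable_intervalIntegral_of_norm_le_decayWeight {F : E n → ℝ → ℂ} {τ C : ℝ} (hτ : 0 ≤ τ)
    (hF : ContinuousOn (fun p : E n × ℝ => F p.1 p.2) (univ ×ˢ Icc 0 τ))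
    (hle : ∀ w, ∀ s ∈ Icc 0 τ, ‖F w s‖ ≤ C * decayWeight (n + 1) w) :
    Integrable fun w => ∫ s in (0 : ℝ)..τ, F w s := by
  simp only [intervalIntegral.integral_of_le hτ]
  have hrestrict : (volume : Measure (E n)).prod (volume.restrict (Ioc (0 : ℝ) τ)) =
      (volume.prod volume).restrict (univ ×ˢ Ioc (0 : ℝ) τ) := by
    rw [← Measure.prod_restrict, Measure.restrict_univ]
  refine (integrable_prod_of_norm_le_decayWeight (F := fun p => F p.1 p.2) measurableSet_Ioc
    (by simp) ?_ fun w s hs => hle w s (Ioc_subset_Icc_self hs)).integral_prod_left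
  rw [hrestrict]
  exact (hF.mono (prod_mono_right Ioc_subset_Icc_self)).aestronglyMeasurable
    (MeasurableSet.univ.prod measurableSet_Ioc)

lemma rectangle_integral_eq_zero {F : E n → ℝ → ℂ} {e : E n} {τ : ℝ} (hτ : 0 ≤ τ) (w : E n)
    (hd : ∀ z : ℂ, z.im ∈ Icc 0 τ → DifferentiableAt ℂ (fun z : ℂ => F (w + z.re • e) z.im) z) :
    (∫ x in (0 : ℝ)..1, F (w + x • e) 0) - (∫ x in (0 : ℝ)..1, F (w + x • e) τ) +
      Complex.I * ((∫ y in (0 : ℝ)..τ, F (w + e) y) - ∫ y in (0 : ℝ)..τ, F w y) = 0 := by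
  have hcauchy := Complex.integral_boundary_rect_eq_zero_of_differentiableOn
    (fun z : ℂ => F (w + z.re • e) z.im) 0 (1 + τ * Complex.I) fun z hz => by
      have him := (Complex.mem_reProdIm.1 hz).2
      exact (hd z (by simpa [uIcc_of_le hτ] using him)).differentiableWithinAt
  simp only [Complex.zero_re, Complex.zero_im, Complex.add_re, Complex.one_re, Complex.mul_re,
    Complex.ofReal_re, Complex.I_re, mul_zero, Complex.ofReal_im, Complex.I_im, mul_one, sub_self,
    add_zero, Complex.add_im, Complex.one_im, Complex.mul_im, zero_add, Complex.ofReal_zero,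
    zero_mul, zero_smul, Complex.ofReal_one, one_smul, smul_eq_mul] at hcauchy
  linear_combination hcauchy

/- Cauchy's theorem on the unit rectangles over `w` is integrated over all `w`: the two vertical
sides are translates of each other, so they cancel, and no limit of long rectangles is needed. -/
lemma integral_eq_integral_shift {F : E n → ℝ → ℂ} {e : E n} (he : ‖e‖ = 1) {τ C : ℝ}
    (hτ : 0 ≤ τ) (hC : 0 ≤ C)
    (hd : ∀ w, ∀ z : ℂ, z.im ∈ Icc 0 τ →
      DifferentiableAt ℂ (fun z : ℂ => F (w + z.re • e) z.im) z)
    (hF : ContinuousOn (fun p : E n × ℝ => F p.1 p.2) (univ ×ˢ Icc 0 τ))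
    (hle : ∀ w, ∀ s ∈ Icc 0 τ, ‖F w s‖ ≤ C * decayWeight (n + 1) w) :
    ∫ w, F w 0 = ∫ w, F w τ := by
  have hslice (s : ℝ) (hs : s ∈ Icc 0 τ) : Continuous fun w => F w s := by
    rw [← continuousOn_univ]
    exact hF.comp (f := fun w => (w, s)) (by fun_prop) fun w _ => ⟨mem_univ _, hs⟩
  obtain ⟨hint_bot, hbot⟩ := integral_integral_translate (hslice 0 (left_mem_Icc.2 hτ)) hC
    (fun w => hle w 0 (left_mem_Icc.2 hτ)) he
  obtain ⟨hint_top, htop⟩ := integral_integral_translate (hslice τ (right_mem_Icc.2 hτ)) hC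
    (fun w => hle w τ (right_mem_Icc.2 hτ)) he
  have hside : Integrable fun w => ∫ y in (0 : ℝ)..τ, F w y :=
    integrable_intervalIntegral_of_norm_le_decayWeight hτ hF hle
  have hside_translate : ∫ w, ∫ y in (0 : ℝ)..τ, F (w + e) y = ∫ w, ∫ y in (0 : ℝ)..τ, F w y :=
    integral_add_right_eq_self (fun w => ∫ y in (0 : ℝ)..τ, F w y) e
  have hside_sub :
      Integrable fun w => (∫ y in (0 : ℝ)..τ, F (w + e) y) - ∫ y in (0 : ℝ)..τ, F w y :=
    (hside.comp_add_right e).sub hside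
  have hrow_sub : Integrable fun w =>
      (∫ x in (0 : ℝ)..1, F (w + x • e) 0) - ∫ x in (0 : ℝ)..1, F (w + x • e) τ :=
    hint_bot.sub hint_top
  have hsum : ∫ w, ((∫ x in (0 : ℝ)..1, F (w + x • e) 0) - (∫ x in (0 : ℝ)..1, F (w + x • e) τ) +
      Complex.I * ((∫ y in (0 : ℝ)..τ, F (w + e) y) - ∫ y in (0 : ℝ)..τ, F w y)) = 0 := by
    simp only [rectangle_integral_eq_zero hτ _ (hd _), integral_zero]
  rw [integral_add hrow_sub (hside_sub.const_mul Complex.I),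
    integral_sub hint_bot hint_top, integral_const_mul,
    integral_sub (hside.comp_add_right e) hside, hside_translate, hbot, htop] at hsum
  simpa [sub_eq_zero] using hsum

end ContourShift

section Correlation

variable {n : ℕ} {m : ℝ}

lemma decayWeight_antitone {N N' : ℕ} (h : N ≤ N') (w : E n) :
    decayWeight N' w ≤ decayWeight N w := by
  unfold decayWeight
  gcongr
  linarith [norm_nonneg w]

lemma decayWeight_le_one (N : ℕ) (w : E n) : decayWeight N w ≤ 1 := by
  simpa [decayWeight] using decayWeight_antitone (Nat.zero_le N) w

lemma decayWeight_mul_pow_le (k : ℕ) (w u : E n) :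
    decayWeight (4 * k) (w + u) * decayWeight (4 * k) w * (1 + ‖w‖ + ‖u‖) ^ (3 * k) ≤
      8 ^ k * decayWeight k w := by
  have hw := norm_nonneg w
  have hwu := norm_nonneg (w + u)
  have hpeetre : 1 + ‖w‖ + ‖u‖ ≤ 2 * ((1 + ‖w‖) * (1 + ‖w + u‖)) := by
    have hu : ‖u‖ ≤ ‖w + u‖ + ‖w‖ := by simpa using norm_sub_le (w + u) w
    nlinarith [mul_nonneg hw hwu]
  unfold decayWeight
  rw [← mul_inv, ← div_eq_inv_mul, div_le_iff₀ (by positivity)]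
  calc (1 + ‖w‖ + ‖u‖) ^ (3 * k) ≤ (2 * ((1 + ‖w‖) * (1 + ‖w + u‖))) ^ (3 * k) := by gcongr
    _ = 8 ^ k * ((1 + ‖w‖) ^ (3 * k) * (1 + ‖w + u‖) ^ (3 * k)) := by
        rw [mul_pow, mul_pow, pow_mul]; norm_num
    _ ≤ 8 ^ k * ((1 + ‖w‖) ^ (3 * k) * (1 + ‖w + u‖) ^ (4 * k)) := by
        gcongr
        · linarith
        · norm_num
    _ = 8 ^ k * ((1 + ‖w‖) ^ k)⁻¹ * ((1 + ‖w + u‖) ^ (4 * k) * (1 + ‖w‖) ^ (4 * k)) := by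
        have hsplit : (1 + ‖w‖) ^ (4 * k) = (1 + ‖w‖) ^ k * (1 + ‖w‖) ^ (3 * k) := by
          rw [← pow_add]; congr 1; ring
        rw [hsplit]
        field_simp

lemma exp_neg_div_le (k : ℕ) {W y : ℝ} (hW : 1 ≤ W) (hy : 0 ≤ y) :
    Real.exp (-(y / W ^ 3)) ≤ k.factorial * Real.exp 1 * W ^ (3 * k) * ((1 + y) ^ k)⁻¹ := by
  have hbase : 1 + y ≤ W ^ 3 * (1 + y / W ^ 3) := by
    rw [mul_add, mul_one, mul_div_cancel₀ _ (by positivity)]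
    linarith [one_le_pow₀ hW (n := 3)]
  have hexp : (1 + y / W ^ 3) ^ k ≤ k.factorial * Real.exp (1 + y / W ^ 3) := by
    rw [← div_le_iff₀' (by positivity)]
    exact Real.pow_div_factorial_le_exp _ (by positivity) k
  rw [← div_eq_mul_inv, le_div_iff₀ (by positivity)]
  calc Real.exp (-(y / W ^ 3)) * (1 + y) ^ k
      ≤ Real.exp (-(y / W ^ 3)) * (W ^ 3 * (1 + y / W ^ 3)) ^ k := by gcongr
    _ = Real.exp (-(y / W ^ 3)) * W ^ (3 * k) * (1 + y / W ^ 3) ^ k := by rw [mul_pow]; ring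
    _ ≤ Real.exp (-(y / W ^ 3)) * W ^ (3 * k) * (k.factorial * Real.exp (1 + y / W ^ 3)) := by
        gcongr
    _ = k.factorial * Real.exp (-(y / W ^ 3) + (1 + y / W ^ 3)) * W ^ (3 * k) := by
        rw [Real.exp_add (-(y / W ^ 3))]; ring
    _ = k.factorial * Real.exp 1 * W ^ (3 * k) := by rw [add_left_comm, neg_add_cancel, add_zero]

lemma exists_norm_eq_one_and_eq_norm_smul (hn : 1 ≤ n) (u : E n) :
    ∃ e : E n, ‖e‖ = 1 ∧ u = ‖u‖ • e := by
  rcases eq_or_ne u 0 with rfl | hu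
  · exact ⟨EuclideanSpace.single ⟨0, hn⟩ 1, by simp, by simp⟩
  · exact ⟨‖u‖⁻¹ • u, norm_smul_inv_norm hu, by
      rw [smul_smul, mul_inv_cancel₀ (norm_ne_zero_iff.2 hu), one_smul]⟩

/-- The half-wave `e^{itω(w)} a(w)`: the Fourier transform at time `t` of the solution of
`-i∂ₜφ = ω(D)φ` whose initial value has Fourier transform `a`. -/
def oscillating (m : ℝ) (a : E n → E n → ℂ) (t : ℝ) (w : E n) : ℂ :=
  Complex.exp (t * freq m w 0 * Complex.I) * a w 0

/-- The analytic continuation, from `τ = 0`, of the correlation integrand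
`oscillating m a t (w + u) * conj (oscillating m a t w)` to the imaginary direction `e`. -/
def correlation (m : ℝ) (a : E n → E n → ℂ) (t : ℝ) (u e w : E n) (τ : ℝ) : ℂ :=
  Complex.exp (t * (freq m (w + u) (τ • e) - freq m w (τ • e)) * Complex.I) *
    (a (w + u) (τ • e) * starRingEnd ℂ (a w (-(τ • e))))

lemma correlation_zero (a : E n → E n → ℂ) (t : ℝ) (u e w : E n) :
    correlation m a t u e w 0 =
      oscillating m a t (w + u) * starRingEnd ℂ (oscillating m a t w) := by
  simp only [correlation, oscillating, zero_smul, neg_zero, freq_zero_right, map_mul,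
    ← Complex.exp_conj, Complex.conj_ofReal, Complex.conj_I]
  rw [mul_mul_mul_comm, ← Complex.exp_add]
  congr 2
  ring

variable {a : E n → E n → ℂ} {t τ C : ℝ} {N : ℕ} {u e : E n}

/- Off the real domain the phase difference acquires the positive imaginary part of
`le_im_freq_sub`, so the oscillation turns into damping. -/
lemma norm_correlation_le (ht : 0 ≤ t) (he : ‖e‖ = 1) (hu : u = ‖u‖ • e) (hτ₀ : 0 ≤ τ)
    (hτ : 4 * Real.pi * τ < m)
    (ha : ∀ w η : E n, 4 * Real.pi * ‖η‖ < m → ‖a w η‖ ≤ C * decayWeight N w) (w : E n) :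
    ‖correlation m a t u e w τ‖ ≤
      Real.exp (-(dispersionRate m * τ * t * ‖u‖ / (1 + ‖w‖ + ‖u‖) ^ 3)) *
        (C ^ 2 * (decayWeight N (w + u) * decayWeight N w)) := by
  have hη : 4 * Real.pi * ‖τ • e‖ < m := by
    rwa [norm_smul_of_norm_eq_one he, abs_of_nonneg hτ₀]
  rw [correlation, norm_mul, norm_mul, Complex.norm_exp, RCLike.norm_conj]
  gcongr ?_ * ?_
  · rw [Real.exp_le_exp, mul_assoc, Complex.re_ofReal_mul, Complex.mul_I_re, Complex.sub_im,
      mul_neg, neg_le_neg_iff]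
    have hdamping := le_im_freq_sub (m := m) w he hτ₀ hτ (norm_nonneg u)
    rw [← hu] at hdamping
    refine Eq.trans_le ?_ (mul_le_mul_of_nonneg_left hdamping ht)
    ring
  · calc ‖a (w + u) (τ • e)‖ * ‖a w (-(τ • e))‖
        ≤ (C * decayWeight N (w + u)) * (C * decayWeight N w) :=
          mul_le_mul (ha _ _ hη) (ha _ _ (by rwa [norm_neg])) (norm_nonneg _)
            ((norm_nonneg _).trans (ha _ _ hη))
      _ = _ := by ring

lemma IsAmplitude.integral_correlation_shift (ha : IsAmplitude m a) (ht : 0 ≤ t) (he : ‖e‖ = 1)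
    (hu : u = ‖u‖ • e) (hτ₀ : 0 ≤ τ) (hτ : 4 * Real.pi * τ < m) :
    ∫ w, correlation m a t u e w 0 = ∫ w, correlation m a t u e w τ := by
  obtain ⟨C, -, hle⟩ := ha.bound (n + 1)
  have hstrip {s : ℝ} (hs : s ∈ Icc 0 τ) : 4 * Real.pi * s < m :=
    (mul_le_mul_of_nonneg_left hs.2 (by positivity)).trans_lt hτ
  have htube {s : ℝ} (hs : s ∈ Icc 0 τ) : 4 * Real.pi * ‖s • e‖ < m := by
    rw [norm_smul_of_norm_eq_one he, abs_of_nonneg hs.1]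
    exact hstrip hs
  refine integral_eq_integral_shift he hτ₀ (sq_nonneg C) (fun w z hz => ?_) ?_ fun w s hs => ?_
  · have hz' : 4 * Real.pi * |z.im| < m := by
      rw [abs_of_nonneg hz.1]
      exact hstrip hz
    have hfreq (v : E n) := (hasDerivAt_freq_line (m := m) v he hz').differentiableAt
    simp only [correlation, add_right_comm w _ u]
    exact ((((hfreq (w + u)).sub (hfreq w)).const_mul (t : ℂ)).mul_const Complex.I).cexp.mul
      ((ha.differentiableAt (w + u) e he z hz').mul (ha.conj_neg.differentiableAt w e he z hz'))
  · have hmaps (v : E n) : MapsTo (fun p : E n × ℝ => (p.1 + v, p.2 • e)) (univ ×ˢ Icc 0 τ)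
        {p | 4 * Real.pi * ‖p.2‖ < m} := fun p hp => htube hp.2
    have hfreq (v : E n) := continuousOn_freq.comp (by fun_prop) (hmaps v)
    have hamp := ha.continuousOn.comp (by fun_prop) (hmaps u)
    have hamp_conj := ha.conj_neg.continuousOn.comp (by fun_prop) (hmaps 0)
    have hcont := (((hfreq u).sub (hfreq 0)).const_smul (t : ℂ)).mul
      (continuousOn_const (c := Complex.I)) |>.cexp.mul (hamp.mul hamp_conj)
    simpa [correlation, Function.comp_def, Pi.mul_def] using hcont
  · have hrate := (dispersionRate_pos (mass_pos_of_lt (htube hs))).le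
    have hs₀ := hs.1
    refine (norm_correlation_le ht he hu hs₀ (hstrip hs) hle w).trans ?_
    refine (mul_le_of_le_one_left ?_ (Real.exp_le_one_iff.2 (neg_nonpos.2 (by positivity)))).trans
      (mul_le_mul_of_nonneg_left ?_ (sq_nonneg C))
    · exact mul_nonneg (sq_nonneg C) (mul_nonneg (decayWeight_nonneg _ _) (decayWeight_nonneg _ _))
    · exact mul_le_of_le_one_left (decayWeight_nonneg _ w) (decayWeight_le_one _ _)

lemma norm_correlation_le_decayWeight (k : ℕ) (ht : 0 ≤ t) (he : ‖e‖ = 1) (hu : u = ‖u‖ • e)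
    (hτ₀ : 0 < τ) (hτ : 4 * Real.pi * τ < m)
    (ha : ∀ w η : E n, 4 * Real.pi * ‖η‖ < m → ‖a w η‖ ≤ C * decayWeight (4 * k) w) (w : E n) :
    ‖correlation m a t u e w τ‖ ≤ k.factorial * Real.exp 1 * C ^ 2 * 8 ^ k *
      decayWeight k ((dispersionRate m * τ * t) • u) * decayWeight k w := by
  have hm : 0 < m := lt_trans (by positivity) hτ
  have hrate := dispersionRate_pos hm
  have hfar : decayWeight k ((dispersionRate m * τ * t) • u) =
      ((1 + dispersionRate m * τ * t * ‖u‖) ^ k)⁻¹ := by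
    rw [decayWeight, norm_smul, Real.norm_of_nonneg (by positivity)]
  have hW : 1 ≤ 1 + ‖w‖ + ‖u‖ := by linarith [norm_nonneg w, norm_nonneg u]
  have hexp := exp_neg_div_le k hW (y := dispersionRate m * τ * t * ‖u‖) (by positivity)
  have hweights : 0 ≤ C ^ 2 * (decayWeight (4 * k) (w + u) * decayWeight (4 * k) w) :=
    mul_nonneg (sq_nonneg C) (mul_nonneg (decayWeight_nonneg _ _) (decayWeight_nonneg _ _))
  rw [hfar]
  calc ‖correlation m a t u e w τ‖
      ≤ k.factorial * Real.exp 1 * (1 + ‖w‖ + ‖u‖) ^ (3 * k) *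
          ((1 + dispersionRate m * τ * t * ‖u‖) ^ k)⁻¹ *
          (C ^ 2 * (decayWeight (4 * k) (w + u) * decayWeight (4 * k) w)) :=
        (norm_correlation_le ht he hu hτ₀.le hτ ha w).trans
          (mul_le_mul_of_nonneg_right hexp hweights)
    _ = k.factorial * Real.exp 1 * ((1 + dispersionRate m * τ * t * ‖u‖) ^ k)⁻¹ * C ^ 2 *
          (decayWeight (4 * k) (w + u) * decayWeight (4 * k) w *
            (1 + ‖w‖ + ‖u‖) ^ (3 * k)) := by ring
    _ ≤ k.factorial * Real.exp 1 * ((1 + dispersionRate m * τ * t * ‖u‖) ^ k)⁻¹ * C ^ 2 *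
          (8 ^ k * decayWeight k w) :=
        mul_le_mul_of_nonneg_left (decayWeight_mul_pow_le k w u) (by positivity)
    _ = _ := by ring

lemma IsAmplitude.exists_norm_integral_correlation_le (hn : 1 ≤ n) (hm : 0 < m)
    (ha : IsAmplitude m a) : ∃ C c : ℝ, 0 < c ∧ ∀ t : ℝ, 0 ≤ t → ∀ u : E n,
      ‖∫ w, oscillating m a t (w + u) * starRingEnd ℂ (oscillating m a t w)‖ ≤
        C * decayWeight (n + 1) ((c * t) • u) := by
  obtain ⟨C, -, hle⟩ := ha.bound (4 * (n + 1))
  set τ : ℝ := m / (8 * Real.pi) with hτ_def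
  have hτ₀ : 0 < τ := by positivity
  have hτ : 4 * Real.pi * τ < m := by
    rw [hτ_def]
    field_simp
    linarith
  refine ⟨(n + 1).factorial * Real.exp 1 * C ^ 2 * 8 ^ (n + 1) * ∫ w : E n, decayWeight (n + 1) w,
    dispersionRate m * τ, mul_pos (dispersionRate_pos hm) hτ₀, fun t ht u => ?_⟩
  obtain ⟨e, he, hu⟩ := exists_norm_eq_one_and_eq_norm_smul hn u
  simp only [← correlation_zero (m := m) a t u e]
  rw [ha.integral_correlation_shift ht he hu hτ₀.le hτ]
  refine (norm_integral_le_of_norm_le (integrable_decayWeight.const_mul _) (Eventually.of_forall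
    (norm_correlation_le_decayWeight (n + 1) ht he hu hτ₀ hτ hle))).trans_eq ?_
  rw [integral_const_mul]
  ring

end Correlation

section Dispersion

variable {n : ℕ} {m : ℝ}

lemma norm_integral_sq_le {g : E n → ℂ} (hg : Integrable g) :
    ‖∫ w, g w‖ ^ 2 ≤ ∫ u, ‖∫ w, g (w + u) * starRingEnd ℂ (g w)‖ := by
  have hconj : Integrable fun w => starRingEnd ℂ (g w) :=
    Complex.conjCLE.toContinuousLinearMap.integrable_comp hg
  have hshear := measurePreserving_prod_add (volume : Measure (E n)) (volume : Measure (E n))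
  have hshifted : Integrable (fun p : E n × E n => starRingEnd ℂ (g p.1) * g (p.1 + p.2))
      (volume.prod volume) := hshear.integrable_comp_of_integrable (hconj.mul_prod hg)
  calc ‖∫ w, g w‖ ^ 2
      = ‖∫ p : E n × E n, starRingEnd ℂ (g p.1) * g p.2 ∂(volume.prod volume)‖ := by
        rw [integral_prod_mul (fun w => starRingEnd ℂ (g w)) g, integral_conj, norm_mul,
          RCLike.norm_conj, sq]
    _ = ‖∫ p : E n × E n, starRingEnd ℂ (g p.1) * g (p.1 + p.2) ∂(volume.prod volume)‖ := by
        rw [← hshear.integral_comp (Homeomorph.shearAddRight (E n)).measurableEmbedding]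
    _ = ‖∫ u, ∫ w, starRingEnd ℂ (g w) * g (w + u)‖ := by rw [integral_prod_symm _ hshifted]
    _ ≤ ∫ u, ‖∫ w, g (w + u) * starRingEnd ℂ (g w)‖ := by
        simp only [mul_comm (starRingEnd ℂ _)]
        exact norm_integral_le_integral_norm _

lemma continuous_character (x : E n) : Continuous fun w => character w x := by
  unfold character
  fun_prop

lemma conj_character (w x : E n) : starRingEnd ℂ (character w x) = character w (-x) := by
  simp only [character, ← Complex.exp_conj, map_mul, Complex.conj_ofReal, Complex.conj_I,
    inner_neg_right, mul_neg, neg_mul, Complex.ofReal_neg]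

lemma character_add_mul_conj (w u x : E n) :
    character (w + u) x * starRingEnd ℂ (character w x) = character u x := by
  rw [conj_character, character, character, character, ← Complex.exp_add, inner_add_left,
    inner_neg_right]
  congr 1
  push_cast
  ring

lemma integrable_character_mul {g : E n → ℂ} (hg : Integrable g) (x : E n) :
    Integrable fun w => character w x * g w :=
  hg.bdd_mul (c := 1) (continuous_character x).aestronglyMeasurable
    (Eventually.of_forall fun w => (norm_character w x).le)

lemma norm_oscillating (a : E n → E n → ℂ) (t : ℝ) (w : E n) :
    ‖oscillating m a t w‖ = ‖a w 0‖ := by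
  rw [oscillating, norm_mul, freq_zero_right, ← Complex.ofReal_mul,
    Complex.norm_exp_ofReal_mul_I, one_mul]

variable {a : E n → E n → ℂ}

lemma IsAmplitude.continuous_oscillating (hm : 0 < m) (ha : IsAmplitude m a) (t : ℝ) :
    Continuous (oscillating m a t) := by
  have hmaps : MapsTo (fun w : E n => (w, (0 : E n))) univ {p | 4 * Real.pi * ‖p.2‖ < m} :=
    fun w _ => by simpa using hm
  have hfreq : Continuous fun w : E n => freq m w 0 := by
    rw [← continuousOn_univ]
    exact continuousOn_freq.comp (f := fun w : E n => (w, (0 : E n))) (by fun_prop) hmaps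
  have hamp : Continuous fun w : E n => a w 0 := by
    rw [← continuousOn_univ]
    exact ha.continuousOn.comp (f := fun w : E n => (w, (0 : E n))) (by fun_prop) hmaps
  unfold oscillating
  fun_prop

lemma IsAmplitude.integrable_oscillating (hm : 0 < m) (ha : IsAmplitude m a) (t : ℝ) :
    Integrable (oscillating m a t) := by
  obtain ⟨C, -, hle⟩ := ha.bound (n + 1)
  refine (integrable_decayWeight.const_mul C).mono'
    (ha.continuous_oscillating hm t).aestronglyMeasurable (Eventually.of_forall fun w => ?_)
  rw [norm_oscillating]
  exact hle w 0 (by simpa using hm)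

lemma oscillating_neg (a : E n → E n → ℂ) (t : ℝ) (w : E n) :
    oscillating m a (-t) w =
      starRingEnd ℂ (oscillating m (fun w η => starRingEnd ℂ (a w (-η))) t w) := by
  simp only [oscillating, freq_zero_right, map_mul, ← Complex.exp_conj, Complex.conj_ofReal,
    Complex.conj_I, Complex.conj_conj, Complex.ofReal_neg, neg_mul, mul_neg, neg_zero]

/-- A family `f t` of Fourier transforms is dispersive if the functions with these transforms are
`O(|t|^{-n/2})` uniformly in space. -/
structure IsDispersive (f : ℝ → E n → ℂ) : Prop where
  integrable : ∀ t, Integrable (f t)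
  bound : ∃ C, ∀ t ≠ 0, ∀ x, ‖∫ w, character w x * f t w‖ ≤ C / √(|t| ^ n)

lemma IsDispersive.add {f g : ℝ → E n → ℂ} (hf : IsDispersive f) (hg : IsDispersive g) :
    IsDispersive fun t w => f t w + g t w where
  integrable t := (hf.integrable t).add (hg.integrable t)
  bound := by
    obtain ⟨C, hC⟩ := hf.bound
    obtain ⟨D, hD⟩ := hg.bound
    refine ⟨C + D, fun t ht x => ?_⟩
    simp only [mul_add]
    rw [integral_add (integrable_character_mul (hf.integrable t) x)
      (integrable_character_mul (hg.integrable t) x), add_div]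
    exact (norm_add_le _ _).trans (add_le_add (hC t ht x) (hD t ht x))

lemma IsDispersive.const_mul {f : ℝ → E n → ℂ} (hf : IsDispersive f) (c : ℂ) :
    IsDispersive fun t w => c * f t w where
  integrable t := (hf.integrable t).const_mul c
  bound := by
    obtain ⟨C, hC⟩ := hf.bound
    refine ⟨‖c‖ * C, fun t ht x => ?_⟩
    simp only [mul_left_comm _ c]
    rw [integral_const_mul, norm_mul, mul_div_assoc]
    exact mul_le_mul_of_nonneg_left (hC t ht x) (norm_nonneg c)

lemma IsDispersive.comp_neg {f : ℝ → E n → ℂ} (hf : IsDispersive f) :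
    IsDispersive fun t => f (-t) where
  integrable t := hf.integrable (-t)
  bound := hf.bound.imp fun C hC t ht x => by simpa using hC (-t) (neg_ne_zero.2 ht) x

/- The square of the integral is bounded by the integrated autocorrelation, whose integrand decays
on the scale `1 / t` in `u ∈ ℝⁿ`. -/
lemma IsAmplitude.exists_norm_integral_oscillating_sq_le (hn : 1 ≤ n) (hm : 0 < m)
    (ha : IsAmplitude m a) : ∃ C : ℝ, ∀ t : ℝ, 0 < t → ∀ x : E n,
      ‖∫ w, character w x * oscillating m a t w‖ ^ 2 ≤ C / t ^ n := by
  obtain ⟨C, c, hc, hle⟩ := ha.exists_norm_integral_correlation_le hn hm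
  refine ⟨C * (∫ w : E n, decayWeight (n + 1) w) / c ^ n, fun t ht x => ?_⟩
  have hct : 0 < c * t := mul_pos hc ht
  have hcorrelation (u : E n) : ‖∫ w, character (w + u) x * oscillating m a t (w + u) *
      starRingEnd ℂ (character w x * oscillating m a t w)‖ ≤
      C * decayWeight (n + 1) ((c * t) • u) := by
    simp only [map_mul, mul_mul_mul_comm, character_add_mul_conj]
    rw [integral_const_mul, norm_mul, norm_character, one_mul]
    exact hle t ht.le u
  calc ‖∫ w, character w x * oscillating m a t w‖ ^ 2
      ≤ ∫ u, ‖∫ w, character (w + u) x * oscillating m a t (w + u) *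
          starRingEnd ℂ (character w x * oscillating m a t w)‖ :=
        norm_integral_sq_le (integrable_character_mul (ha.integrable_oscillating hm t) x)
    _ ≤ ∫ u : E n, C * decayWeight (n + 1) ((c * t) • u) :=
        integral_mono_of_nonneg (Eventually.of_forall fun u => norm_nonneg _)
          ((integrable_decayWeight.comp_smul hct.ne').const_mul C)
          (Eventually.of_forall hcorrelation)
    _ = C * (∫ w : E n, decayWeight (n + 1) w) / c ^ n / t ^ n := by
        rw [integral_const_mul, Measure.integral_comp_smul, finrank_euclideanSpace_fin,
          abs_of_pos (by positivity), smul_eq_mul, mul_pow]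
        field_simp

lemma IsAmplitude.isDispersive_oscillating (hn : 1 ≤ n) (hm : 0 < m) (ha : IsAmplitude m a) :
    IsDispersive (oscillating m a) where
  integrable := ha.integrable_oscillating hm
  bound := by
    have hsqrt {C t b : ℝ} (hle : b ^ 2 ≤ C / |t| ^ n) : b ≤ √C / √(|t| ^ n) := by
      rw [← Real.sqrt_div' _ (by positivity)]
      exact Real.le_sqrt_of_sq_le hle
    obtain ⟨C, hC⟩ := ha.exists_norm_integral_oscillating_sq_le hn hm
    obtain ⟨D, hD⟩ := ha.conj_neg.exists_norm_integral_oscillating_sq_le hn hm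
    refine ⟨max √C √D, fun t ht x => ?_⟩
    rcases ht.lt_or_gt with hneg | hpos
    · have hle := hsqrt (by rw [abs_of_neg hneg]; exact hD (-t) (neg_pos.2 hneg) (-x))
      rw [← RCLike.norm_conj, ← integral_conj] at hle
      simp only [map_mul, conj_character, neg_neg, ← oscillating_neg] at hle
      exact hle.trans (by gcongr; exact le_max_right _ _)
    · have hle := hsqrt (by rw [abs_of_pos hpos]; exact hC t hpos x)
      exact hle.trans (by gcongr; exact le_max_left _ _)

lemma IsAmplitude.isDispersive_cos_mul (hn : 1 ≤ n) (hm : 0 < m) (ha : IsAmplitude m a) :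
    IsDispersive fun t w => Complex.cos (freq m w 0 * t) * a w 0 := by
  have hosc := ha.isDispersive_oscillating hn hm
  convert (hosc.add hosc.comp_neg).const_mul 2⁻¹ using 3 with t w
  simp only [oscillating, Complex.cos, Complex.ofReal_neg, neg_mul, mul_comm (t : ℂ)]
  ring

lemma IsAmplitude.isDispersive_sin_mul (hn : 1 ≤ n) (hm : 0 < m) (ha : IsAmplitude m a) :
    IsDispersive fun t w => Complex.sin (freq m w 0 * t) * a w 0 := by
  have hosc := ha.isDispersive_oscillating hn hm
  convert (hosc.const_mul (-(Complex.I / 2))).add (hosc.comp_neg.const_mul (Complex.I / 2))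
    using 3 with t w
  simp only [oscillating, Complex.sin, Complex.ofReal_neg, neg_mul, mul_comm (t : ℂ)]
  ring

/-- The Laplace transform of the conjugate of the `i`-th component of `Ψ` at the complex frequency
`w + iη`, normalised so that at `η = 0` it is the Fourier transform with kernel
`e^{-2πi⟨w, x⟩}`. -/
def conjAmplitude (Ψ : State n) (i : Fin 2) (w η : E n) : ℂ :=
  conjTransform (cvec ((2 * Real.pi) • η) (-(2 * Real.pi) • w)) fun x => Ψ x i

lemma IsTestPair.isAmplitude_conjAmplitude {Ψ : State n} (h : IsTestPair Ψ) (m : ℝ) (i : Fin 2) :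
    IsAmplitude m (conjAmplitude Ψ i) :=
  isAmplitude_laplaceTransform m (h.contDiff_conj_component i)
    (h.hasCompactSupport_conj_component i)

lemma IsTestPair.conj_eq_integral_conjAmplitude {Φ : State n} (h : IsTestPair Φ) (i : Fin 2)
    (x : E n) : starRingEnd ℂ (Φ x i) = ∫ w, character w x * conjAmplitude Φ i w 0 := by
  have hinversion := wave_mul_eq_integral (h.contDiff_conj_component i)
    (h.hasCompactSupport_conj_component i) 0 x
  simpa [wave_cvec, conjAmplitude, conjTransform] using hinversion

lemma isFrequency_freq (w : E n) :
    IsFrequency m (cvec ((2 * Real.pi) • (0 : E n)) (-(2 * Real.pi) • w)) (freq m w 0) := by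
  rw [IsFrequency, freq_sq, sum_cvec_sq, freqSq, neg_smul, norm_neg, norm_smul _ w,
    Real.norm_of_nonneg (by positivity), smul_zero, norm_zero, inner_zero_left, inner_zero_right]
  push_cast
  ring

lemma IsAdjointEvolution.conjAmplitude_zero {t : ℝ} {Ψ Φ : State n} (hΨ : IsTestPair Ψ)
    (h : IsAdjointEvolution m t Ψ Φ) (w : E n) :
    conjAmplitude Φ 0 w 0 = Complex.cos (freq m w 0 * t) * conjAmplitude Ψ 0 w 0 +
      -1 * (Complex.sin (freq m w 0 * t) * (freq m w 0 * conjAmplitude Ψ 1 w 0)) := by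
  rw [conjAmplitude, h.conjTransform_zero hΨ (isFrequency_freq w), conjAmplitude, conjAmplitude]
  ring

lemma IsAdjointEvolution.conjAmplitude_one (hm : 0 < m) {t : ℝ} {Ψ Φ : State n}
    (hΨ : IsTestPair Ψ) (h : IsAdjointEvolution m t Ψ Φ) (w : E n) :
    conjAmplitude Φ 1 w 0 =
      Complex.sin (freq m w 0 * t) * ((freq m w 0)⁻¹ * conjAmplitude Ψ 0 w 0) +
        Complex.cos (freq m w 0 * t) * conjAmplitude Ψ 1 w 0 := by
  have hne : freq m w 0 ≠ 0 := freq_ne_zero w (by simpa using hm)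
  rw [conjAmplitude, h.conjTransform_one hΨ (isFrequency_freq w), ← mul_sinDiv, mul_assoc,
    mul_left_comm (sinDiv _ _), mul_inv_cancel_left₀ hne, conjAmplitude, conjAmplitude]

theorem IsAdjointEvolution.exists_norm_le (hn : 1 ≤ n) (hm : 0 < m) {Ψ : State n}
    (hΨ : IsTestPair Ψ) : ∃ C : ℝ, ∀ t ≠ 0, ∀ Φ : State n, IsAdjointEvolution m t Ψ Φ →
      ∀ x, ‖Φ x‖ ≤ C / √(|t| ^ n) := by
  have hΨ₀ := hΨ.isAmplitude_conjAmplitude m 0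
  have hΨ₁ := hΨ.isAmplitude_conjAmplitude m 1
  obtain ⟨C₀, hC₀⟩ := ((hΨ₀.isDispersive_cos_mul hn hm).add
    (((hΨ₁.freq_mul hm).isDispersive_sin_mul hn hm).const_mul (-1))).bound
  obtain ⟨C₁, hC₁⟩ := (((hΨ₀.inv_freq_mul hm).isDispersive_sin_mul hn hm).add
    (hΨ₁.isDispersive_cos_mul hn hm)).bound
  refine ⟨max C₀ C₁, fun t ht Φ hΦ x => ?_⟩
  have hcomponent : ∀ i, ‖Φ x i‖ ≤ max C₀ C₁ / √(|t| ^ n) := by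
    refine Fin.forall_fin_two.2 ⟨?_, ?_⟩
    · rw [← RCLike.norm_conj, hΦ.1.conj_eq_integral_conjAmplitude]
      simp only [hΦ.conjAmplitude_zero hΨ]
      exact (hC₀ t ht x).trans (by gcongr; exact le_max_left _ _)
    · rw [← RCLike.norm_conj, hΦ.1.conj_eq_integral_conjAmplitude]
      simp only [hΦ.conjAmplitude_one hm hΨ]
      exact (hC₁ t ht x).trans (by gcongr; exact le_max_right _ _)
  exact (pi_norm_le_iff_of_nonneg ((norm_nonneg _).trans (hcomponent 0))).2 hcomponent

end Dispersion

section Rooms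

variable {n : ℕ} {m : ℝ} {Ψ : State n}

lemma adjointGroup_eq_zero_or_isAdjointEvolution (m t : ℝ) (Ψ : State n) :
    adjointGroup m t Ψ = 0 ∨ IsAdjointEvolution m t Ψ (adjointGroup m t Ψ) := by
  by_cases h : ∃ Φ, IsAdjointEvolution m t Ψ Φ
  · right
    rw [adjointGroup, dif_pos h]
    exact h.choose_spec
  · exact Or.inl (dif_neg h)

lemma continuous_adjointGroup (m t : ℝ) (Ψ : State n) : Continuous (adjointGroup m t Ψ) := by
  rcases adjointGroup_eq_zero_or_isAdjointEvolution m t Ψ with h | h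
  · rw [h]
    exact continuous_zero
  · exact h.1.1.continuous

lemma exists_norm_adjointGroup_le (hn : 1 ≤ n) (hm : 0 < m) (hΨ : IsTestPair Ψ) :
    ∃ A : ℝ, ∀ t > 0, ∀ x, ‖adjointGroup m t Ψ x‖ ≤ A / √(t ^ n) := by
  obtain ⟨A, hA⟩ := IsAdjointEvolution.exists_norm_le hn hm hΨ
  refine ⟨max A 0, fun t ht x => ?_⟩
  rcases adjointGroup_eq_zero_or_isAdjointEvolution m t Ψ with h | h
  · rw [h, Pi.zero_apply, norm_zero]
    positivity
  · calc ‖adjointGroup m t Ψ x‖ ≤ A / √(|t| ^ n) := hA t ht.ne' _ h x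
      _ ≤ max A 0 / √(t ^ n) := by
        rw [abs_of_pos ht]
        gcongr
        exact le_max_left _ _

lemma exists_adjointGroup_eq_zero (m : ℝ) (hΨ : IsTestPair Ψ) :
    ∃ R : ℝ, 0 ≤ R ∧ ∀ t > 0, ∀ x, t + R < ‖x‖ → adjointGroup m t Ψ x = 0 := by
  obtain ⟨R, hR⟩ := hΨ.2.isCompact.isBounded.subset_closedBall (0 : E n)
  refine ⟨max R 0, le_max_right _ _, fun t ht x hx => ?_⟩
  rcases adjointGroup_eq_zero_or_isAdjointEvolution m t Ψ with h | h
  · rw [h, Pi.zero_apply]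
  · refine h.eq_zero_of_lt_norm hΨ (le_max_right R 0)
      (hR.trans (Metric.closedBall_subset_closedBall (le_max_left _ _))) ?_
    rwa [abs_of_pos ht]

lemma volume_real_slab_inter_closedBall_le (i : Fin n) (a : ℝ) {d T : ℝ} (hd : 0 ≤ d)
    (hT : 0 ≤ T) :
    volume.real ({x : E n | a ≤ x i ∧ x i ≤ a + d} ∩ Metric.closedBall 0 T) ≤
      d * (2 * T) ^ (n - 1) := by
  set lo : Fin n → ℝ := Function.update (fun _ => -T) i a
  set hi : Fin n → ℝ := Function.update (fun _ => T) i (a + d)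
  have lo_le_hi : lo ≤ hi :=
    update_le_update_iff.2 ⟨le_add_of_nonneg_right hd, fun _ _ => by linarith⟩
  have subset_box : {x : E n | a ≤ x i ∧ x i ≤ a + d} ∩ Metric.closedBall 0 T ⊆
      (WithLp.ofLp : E n → Fin n → ℝ) ⁻¹' Icc lo hi := by
    rintro x ⟨hxi, hxT⟩
    have abs_coord_le (k : Fin n) : |x k| ≤ T :=
      (PiLp.norm_apply_le x k).trans (mem_closedBall_zero_iff.1 hxT)
    exact ⟨update_le_iff.2 ⟨hxi.1, fun k _ => (abs_le.1 (abs_coord_le k)).1⟩,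
      le_update_iff.2 ⟨hxi.2, fun k _ => (abs_le.1 (abs_coord_le k)).2⟩⟩
  have volume_box : volume ((WithLp.ofLp : E n → Fin n → ℝ) ⁻¹' Icc lo hi) = volume (Icc lo hi) :=
    (PiLp.volume_preserving_ofLp (Fin n)).measure_preimage measurableSet_Icc.nullMeasurableSet
  calc volume.real ({x : E n | a ≤ x i ∧ x i ≤ a + d} ∩ Metric.closedBall 0 T)
    _ ≤ (volume (Icc lo hi)).toReal := by
      rw [← volume_box]
      exact measureReal_mono subset_box (by rw [volume_box]; exact isCompact_Icc.measure_ne_top)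
    _ = ∏ k, (hi k - lo k) := Real.volume_Icc_pi_toReal lo_le_hi
    _ = d * (2 * T) ^ (n - 1) := by
      have side (k) (hk : k ∈ Finset.univ.erase i) : hi k - lo k = 2 * T := by
        simp only [lo, hi, Function.update_of_ne (Finset.ne_of_mem_erase hk)]
        ring
      have thickness : hi i - lo i = d := by simp [lo, hi]
      rw [← Finset.mul_prod_erase _ _ (Finset.mem_univ i), thickness, Finset.prod_congr rfl side,
        Finset.prod_const, Finset.card_erase_of_mem (Finset.mem_univ i), Finset.card_univ,
        Fintype.card_fin]

lemma measurableSet_room (hn : 1 ≤ n) (d ρ : ℝ) (j : ℤ) : MeasurableSet (room hn d ρ j) := by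
  have measurable_last : Measurable fun x : E n => x ⟨n - 1, by omega⟩ := by fun_prop
  exact (measurableSet_le measurable_const measurable_last).inter
    (measurableSet_le measurable_last measurable_const)

/-- The `j`-th room lies at distance at least `(|j| - 1) * d` from the origin. -/
lemma roomVar_eq_zero (hn : 1 ≤ n) {T t : ℝ}
    (hsupp : ∀ x, T < ‖x‖ → adjointGroup m t Ψ x = 0) {d ρ : ℝ} (hd : 0 ≤ d) (hρ : 0 ≤ ρ) {j : ℤ}
    (hj : T + d < |(j : ℝ)| * d) (Y : State n) : roomVar hn m Ψ Y d ρ t j = 0 := by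
  have norm_gt : ∀ x ∈ room hn d ρ j, T < ‖x‖ := by
    rintro x ⟨lower, upper⟩
    have abs_last_le : |x ⟨n - 1, by omega⟩| ≤ ‖x‖ := PiLp.norm_apply_le x _
    rcases le_total 0 (j : ℝ) with hj0 | hj0
    · rw [abs_of_nonneg hj0] at hj
      nlinarith [le_abs_self (x ⟨n - 1, by omega⟩), mul_nonneg hj0 hρ]
    · rw [abs_of_nonpos hj0] at hj
      nlinarith [neg_le_abs (x ⟨n - 1, by omega⟩), mul_nonneg (neg_nonneg.2 hj0) hρ]
  have indicator_eq_zero : (room hn d ρ j).indicator (adjointGroup m t Ψ) = 0 :=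
    indicator_eq_zero'.2 <| disjoint_left.2 fun x hx hxr => hx (hsupp x (norm_gt x hxr))
  rw [roomVar, indicator_eq_zero]
  simp [pairing]

lemma tsum_int_le_of_support {f : ℤ → ℝ≥0∞} {N B : ℝ} (hN : 0 ≤ N)
    (hf : ∀ j, f j ≤ ENNReal.ofReal B) (h0 : ∀ j : ℤ, N < |(j : ℝ)| → f j = 0) :
    ∑' j, f j ≤ ENNReal.ofReal ((2 * N + 1) * B) := by
  have floor_nonneg : 0 ≤ ⌊N⌋ := Int.floor_nonneg.2 hN
  have eq_zero_of_notMem : ∀ j ∉ Finset.Icc (-⌊N⌋) ⌊N⌋, f j = 0 := by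
    intro j hj
    refine h0 j (lt_of_not_ge fun hle => hj (Finset.mem_Icc.2 (abs_le.1 (Int.le_floor.2 ?_))))
    rwa [Int.cast_abs]
  have card_le : ((Finset.Icc (-⌊N⌋) ⌊N⌋).card : ℝ) ≤ 2 * N + 1 := by
    have card_eq : ((Finset.Icc (-⌊N⌋) ⌊N⌋).card : ℤ) = 2 * ⌊N⌋ + 1 := by
      rw [Int.card_Icc]
      omega
    calc ((Finset.Icc (-⌊N⌋) ⌊N⌋).card : ℝ) = 2 * (⌊N⌋ : ℝ) + 1 := by exact_mod_cast card_eq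
      _ ≤ 2 * N + 1 := by linarith [Int.floor_le N]
  calc ∑' j, f j = ∑ j ∈ Finset.Icc (-⌊N⌋) ⌊N⌋, f j := tsum_eq_sum eq_zero_of_notMem
    _ ≤ (Finset.Icc (-⌊N⌋) ⌊N⌋).card • ENNReal.ofReal B :=
      Finset.sum_le_card_nsmul _ _ _ fun j _ => hf j
    _ ≤ ENNReal.ofReal (2 * N + 1) * ENNReal.ofReal B := by
      rw [nsmul_eq_mul, ← ENNReal.ofReal_natCast]
      gcongr
    _ = ENNReal.ofReal ((2 * N + 1) * B) := (ENNReal.ofReal_mul (by positivity)).symm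

variable {Ω : Type*} [MeasurableSpace Ω] {P : Measure Ω} {Y₀ : Ω → State n}

lemma lintegral_enorm_pow_le_of_integral_abs_pow_le {r : Ω → ℝ} {k : ℕ} {B : ℝ}
    (hr : Integrable (fun ω => |r ω| ^ k) P) (hB : ∫ ω, |r ω| ^ k ∂P ≤ B) :
    ∫⁻ ω, ‖r ω‖ₑ ^ k ∂P ≤ ENNReal.ofReal B := by
  calc ∫⁻ ω, ‖r ω‖ₑ ^ k ∂P = ∫⁻ ω, ENNReal.ofReal (|r ω| ^ k) ∂P := by
        refine lintegral_congr fun ω => ?_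
        rw [ENNReal.ofReal_pow (abs_nonneg _), ← Real.norm_eq_abs, ofReal_norm]
    _ = ENNReal.ofReal (∫ ω, |r ω| ^ k ∂P) :=
        (ofReal_integral_eq_lintegral_ofReal hr (ae_of_all _ fun ω => by positivity)).symm
    _ ≤ ENNReal.ofReal B := ENNReal.ofReal_le_ofReal hB

lemma tsum_lintegral_roomVar_le (hn : 1 ≤ n) {C R t d ρ : ℝ} (hC : 0 ≤ C) (hR : 0 ≤ R)
    (ht : 1 < t) (hd : 0 < d) (hρ : 0 ≤ ρ)
    (hsupp : ∀ x, t + R < ‖x‖ → adjointGroup m t Ψ x = 0)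
    (hmom : ∀ j : ℤ, Integrable (fun ω => |roomVar hn m Ψ (Y₀ ω) d ρ t j| ^ 4) P ∧
      ∫ ω, |roomVar hn m Ψ (Y₀ ω) d ρ t j| ^ 4 ∂P ≤ C * d ^ 2 / t ^ 2) :
    ∑' j : ℤ, ∫⁻ ω, ‖roomVar hn m Ψ (Y₀ ω) d ρ t j‖ₑ ^ 4 ∂P ≤
      ENNReal.ofReal (C * (2 * (1 + R) * (d / t) + 3 * (d / t) ^ 2)) := by
  have t_pos : 0 < t := by linarith
  have radius_le : (t + R) / t ≤ 1 + R := by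
    rw [div_le_iff₀ t_pos]
    nlinarith
  have eq_zero_of_far (j : ℤ) (hj : (t + R + d) / d < |(j : ℝ)|) :
      ∫⁻ ω, ‖roomVar hn m Ψ (Y₀ ω) d ρ t j‖ₑ ^ 4 ∂P = 0 := by
    rw [div_lt_iff₀ hd] at hj
    simp [roomVar_eq_zero hn hsupp hd.le hρ hj]
  calc ∑' j : ℤ, ∫⁻ ω, ‖roomVar hn m Ψ (Y₀ ω) d ρ t j‖ₑ ^ 4 ∂P
    _ ≤ ENNReal.ofReal ((2 * ((t + R + d) / d) + 1) * (C * d ^ 2 / t ^ 2)) :=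
      tsum_int_le_of_support (by positivity)
        (fun j => lintegral_enorm_pow_le_of_integral_abs_pow_le (hmom j).1 (hmom j).2)
        eq_zero_of_far
    _ = ENNReal.ofReal (C * (2 * ((t + R) / t) * (d / t) + 3 * (d / t) ^ 2)) := by
      congr 1
      field_simp
      ring
    _ ≤ ENNReal.ofReal (C * (2 * (1 + R) * (d / t) + 3 * (d / t) ^ 2)) := by gcongr

lemma tendsto_tsum_lintegral_roomVar (hn : 1 ≤ n) {C R : ℝ} (hC : 0 ≤ C) (hR : 0 ≤ R)
    {d ρ : ℝ → ℝ} (hd : ∀ t, 0 < t → 0 < d t) (hρ : ∀ t, 0 < t → 0 ≤ ρ t)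
    (hdt : d =o[atTop] fun t => t)
    (hsupp : ∀ t > 0, ∀ x, t + R < ‖x‖ → adjointGroup m t Ψ x = 0)
    (hmom : ∀ t, 1 < t → ∀ j : ℤ,
      Integrable (fun ω => |roomVar hn m Ψ (Y₀ ω) (d t) (ρ t) t j| ^ 4) P ∧
      ∫ ω, |roomVar hn m Ψ (Y₀ ω) (d t) (ρ t) t j| ^ 4 ∂P ≤ C * d t ^ 2 / t ^ 2) :
    Tendsto (fun t => ∑' j : ℤ, ∫⁻ ω, ‖roomVar hn m Ψ (Y₀ ω) (d t) (ρ t) t j‖ₑ ^ 4 ∂P)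
      atTop (𝓝 0) := by
  have ratio_tendsto : Tendsto (fun t => d t / t) atTop (𝓝 0) := hdt.tendsto_div_nhds_zero
  have bound_tendsto : Tendsto (fun t => ENNReal.ofReal
      (C * (2 * (1 + R) * (d t / t) + 3 * (d t / t) ^ 2))) atTop (𝓝 0) := by
    simpa using ENNReal.tendsto_ofReal
      (((ratio_tendsto.const_mul (2 * (1 + R))).add
        ((ratio_tendsto.pow 2).const_mul 3)).const_mul C)
  refine tendsto_of_tendsto_of_tendsto_of_le_of_le' tendsto_const_nhds bound_tendsto
    (Eventually.of_forall fun _ => bot_le) ?_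
  filter_upwards [eventually_gt_atTop 1] with t ht
  have t_pos : 0 < t := by linarith
  exact tsum_lintegral_roomVar_le hn hC hR ht (hd t t_pos) (hρ t t_pos) (hsupp t t_pos) (hmom t ht)

variable [IsProbabilityMeasure P] {Λ : ℝ}

lemma integral_pairing_indicator_room_fourth_le (hn : 1 ≤ n) {K : ℝ≥0}
    (hK : mixingIntegral P Y₀ ≤ K)
    (hY : AEMeasurable (fun p : Ω × E n => Y₀ p.1 p.2) (P.prod volume)) (h0 : CondS0 P Y₀)
    (hb : BoundedBy P Y₀ Λ) {Φ : State n} {M T : ℝ} (hΦ : Continuous Φ) (hM : ∀ x, ‖Φ x‖ ≤ M)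
    (hT : 0 ≤ T) (hΦT : ∀ x, T < ‖x‖ → Φ x = 0) {d : ℝ} (hd : 0 ≤ d) (ρ : ℝ) (j : ℤ) :
    Integrable (fun ω => |pairing (Y₀ ω) ((room hn d ρ j).indicator Φ)| ^ 4) P ∧
      ∫ ω, |pairing (Y₀ ω) ((room hn d ρ j).indicator Φ)| ^ 4 ∂P ≤
        480 * (Λ * M) ^ 4 * (d * (2 * T) ^ (n - 1) * pairBound n K) ^ 2 := by
  set S := room hn d ρ j ∩ Metric.closedBall 0 T
  have measurable_indicator :
      AEStronglyMeasurable ((room hn d ρ j).indicator Φ) volume :=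
    hΦ.aestronglyMeasurable.indicator (measurableSet_room hn d ρ j)
  have norm_indicator_le (x : E n) : ‖(room hn d ρ j).indicator Φ x‖ ≤ M :=
    (norm_indicator_le_norm_self _ _).trans (hM x)
  have indicator_eq_zero : ∀ x ∉ S, (room hn d ρ j).indicator Φ x = 0 := by
    intro x hx
    refine indicator_apply_eq_zero.2 fun hxr => hΦT x (lt_of_not_ge fun hxT => ?_)
    exact hx ⟨hxr, mem_closedBall_zero_iff.2 hxT⟩
  have isBounded_S : Bornology.IsBounded S := Metric.isBounded_closedBall.subset inter_subset_right
  have measurableSet_S : MeasurableSet S :=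
    (measurableSet_room hn d ρ j).inter measurableSet_closedBall
  refine ⟨integrable_abs_pairing_pow hY hb measurable_indicator norm_indicator_le
    isBounded_S.measure_lt_top indicator_eq_zero 4, ?_⟩
  have volume_le : volume.real S ≤ d * (2 * T) ^ (n - 1) :=
    volume_real_slab_inter_closedBall_le _ _ hd hT
  have := pairBound_nonneg n K.2
  simp only [(by decide : Even 4).pow_abs]
  calc ∫ ω, pairing (Y₀ ω) ((room hn d ρ j).indicator Φ) ^ 4 ∂P
    _ ≤ 480 * (Λ * M) ^ 4 * (volume.real S * pairBound n K) ^ 2 :=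
      integral_pairing_fourth_le hY hn hK h0 hb measurable_indicator norm_indicator_le
        measurableSet_S isBounded_S indicator_eq_zero
    _ ≤ 480 * (Λ * M) ^ 4 * (d * (2 * T) ^ (n - 1) * pairBound n K) ^ 2 := by gcongr

lemma integral_roomVar_fourth_le (hn : 1 ≤ n) {K : ℝ≥0} (hK : mixingIntegral P Y₀ ≤ K)
    (hY : AEMeasurable (fun p : Ω × E n => Y₀ p.1 p.2) (P.prod volume)) (h0 : CondS0 P Y₀)
    (hb : BoundedBy P Y₀ Λ) {A R t : ℝ} (hR : 0 ≤ R) (ht : 1 < t)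
    (hA : ∀ x, ‖adjointGroup m t Ψ x‖ ≤ A / √(t ^ n))
    (hsupp : ∀ x, t + R < ‖x‖ → adjointGroup m t Ψ x = 0) {d : ℝ} (hd : 0 ≤ d) (ρ : ℝ) (j : ℤ) :
    Integrable (fun ω => |roomVar hn m Ψ (Y₀ ω) d ρ t j| ^ 4) P ∧
      ∫ ω, |roomVar hn m Ψ (Y₀ ω) d ρ t j| ^ 4 ∂P ≤
        480 * A ^ 4 * ((2 * (1 + R)) ^ (n - 1) * pairBound n K) ^ 2 * Λ ^ 4 * d ^ 2 / t ^ 2 := by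
  have := pairBound_nonneg n K.2
  have : 0 < t := by linarith
  have radius_le : 2 * (t + R) ≤ 2 * (1 + R) * t := by nlinarith
  have sqrt_pow_four : √(t ^ n) ^ 4 = (t ^ (n - 1) * t) ^ 2 := by
    rw [← pow_succ, Nat.sub_add_cancel hn, (by rfl : 4 = 2 * 2), pow_mul,
      Real.sq_sqrt (by positivity)]
  obtain ⟨integrable, integral_le⟩ := integral_pairing_indicator_room_fourth_le hn hK hY h0 hb
    (continuous_adjointGroup m t Ψ) hA (by positivity) hsupp hd ρ j
  refine ⟨integrable, integral_le.trans ?_⟩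
  calc 480 * (Λ * (A / √(t ^ n))) ^ 4 * (d * (2 * (t + R)) ^ (n - 1) * pairBound n K) ^ 2
    _ ≤ 480 * (Λ * (A / √(t ^ n))) ^ 4 *
        (d * (2 * (1 + R) * t) ^ (n - 1) * pairBound n K) ^ 2 := by gcongr
    _ = _ := by
      rw [mul_pow Λ, div_pow A, sqrt_pow_four, mul_pow (2 * (1 + R))]
      field_simp

end Rooms

section Lindeberg

variable {Ω : Type*} [MeasurableSpace Ω] {P : Measure Ω}

lemma lintegral_indicator_sq_le (r : Ω → ℝ) {ε : ℝ} (hε : 0 < ε) :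
    ∫⁻ ω, {ω | ε < |r ω|}.indicator (fun ω => ‖r ω‖ₑ ^ 2) ω ∂P ≤
      (ENNReal.ofReal ε ^ 2)⁻¹ * ∫⁻ ω, ‖r ω‖ₑ ^ 4 ∂P := by
  have ofReal_sq_ne_zero : ENNReal.ofReal ε ^ 2 ≠ 0 := by simpa using hε
  have ofReal_sq_ne_top : ENNReal.ofReal ε ^ 2 ≠ ∞ := by finiteness
  rw [← lintegral_const_mul' _ _ (ENNReal.inv_ne_top.2 ofReal_sq_ne_zero)]
  refine lintegral_mono fun ω => indicator_apply_le' (fun hω => ?_) fun _ => bot_le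
  have le_enorm : ENNReal.ofReal ε ≤ ‖r ω‖ₑ := by
    rw [← ofReal_norm, Real.norm_eq_abs]
    exact ENNReal.ofReal_le_ofReal (le_of_lt hω)
  rw [← ENNReal.div_eq_inv_mul,
    ENNReal.le_div_iff_mul_le (Or.inl ofReal_sq_ne_zero) (Or.inl ofReal_sq_ne_top)]
  calc ‖r ω‖ₑ ^ 2 * ENNReal.ofReal ε ^ 2 ≤ ‖r ω‖ₑ ^ 2 * ‖r ω‖ₑ ^ 2 := by gcongr
    _ = ‖r ω‖ₑ ^ 4 := by rw [← pow_add]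

lemma tendsto_tsum_lintegral_indicator_sq {α ι : Type*} {l : Filter α} {r : α → ι → Ω → ℝ}
    (hr : Tendsto (fun t => ∑' j, ∫⁻ ω, ‖r t j ω‖ₑ ^ 4 ∂P) l (𝓝 0)) {ε : ℝ} (hε : 0 < ε) :
    Tendsto (fun t => ∑' j, ∫⁻ ω, {ω | ε < |r t j ω|}.indicator (fun ω => ‖r t j ω‖ₑ ^ 2) ω ∂P)
      l (𝓝 0) := by
  have inv_ne_top : (ENNReal.ofReal ε ^ 2)⁻¹ ≠ ∞ := by simpa using hε
  have scaled := ENNReal.Tendsto.const_mul hr (Or.inr inv_ne_top)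
  rw [mul_zero] at scaled
  refine tendsto_of_tendsto_of_tendsto_of_le_of_le tendsto_const_nhds scaled
    (fun _ => bot_le) fun t => ?_
  simp only [← ENNReal.tsum_mul_left]
  exact ENNReal.tsum_le_tsum fun j => lintegral_indicator_sq_le _ hε

lemma isLittleO_id_of_isEquivalent_div_log {d : ℝ → ℝ}
    (hd : Asymptotics.IsEquivalent atTop d (fun t => t / Real.log t)) :
    d =o[atTop] fun t => t := by
  refine hd.isBigO.trans_isLittleO ?_
  have inv_log : (fun t : ℝ => (Real.log t)⁻¹) =o[atTop] fun _ => (1 : ℝ) :=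
    (Asymptotics.isLittleO_one_iff ℝ).2 Real.tendsto_log_atTop.inv_tendsto_atTop
  simpa [div_eq_mul_inv] using
    (Asymptotics.isBigO_refl (fun t : ℝ => t) atTop).mul_isLittleO inv_log

end Lindeberg

end KleinGordon

end

theorem theoremp5p1_general {n : ℕ} (hn : 1 ≤ n) (m : ℝ) (hm : 0 < m)
    (Ψ : KleinGordon.State n) (hΨ : KleinGordon.IsTestPair Ψ) (K : ℝ≥0) :
    ∃ C : ℝ, 0 < C ∧
      ∀ (Ω : Type*) [MeasurableSpace Ω] (P : Measure Ω) [IsProbabilityMeasure P]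
        (Y₀ : Ω → KleinGordon.State n) (Λ : ℝ) (d ρ : ℝ → ℝ),
        AEMeasurable (fun p : Ω × KleinGordon.E n => Y₀ p.1 p.2) (P.prod volume) →
        KleinGordon.CondS0 P Y₀ →
        KleinGordon.mixingIntegral P Y₀ ≤ K →
        KleinGordon.BoundedBy P Y₀ Λ →
        (∀ t, 0 < t → 0 < d t) →
        (∀ t, 0 < t → 0 ≤ ρ t) →
        (∀ t, 1 < t → ∀ j : ℤ,
          Integrable
            (fun ω => |KleinGordon.roomVar hn m Ψ (Y₀ ω) (d t) (ρ t) t j| ^ 4) P ∧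
          ∫ ω, |KleinGordon.roomVar hn m Ψ (Y₀ ω) (d t) (ρ t) t j| ^ 4 ∂P
            ≤ C * Λ ^ 4 * d t ^ 2 / t ^ 2) ∧
        (d =o[atTop] (fun t => t) →
          Tendsto (fun t => ∑' j : ℤ,
              ∫⁻ ω, ‖KleinGordon.roomVar hn m Ψ (Y₀ ω) (d t) (ρ t) t j‖ₑ ^ 4 ∂P)
            atTop (𝓝 0) ∧
          ∀ ε : ℝ, 0 < ε →
            Tendsto (fun t => ∑' j : ℤ,
                ∫⁻ ω, {ω | ε < |KleinGordon.roomVar hn m Ψ (Y₀ ω) (d t) (ρ t) t j|}.indicator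
                  (fun ω => ‖KleinGordon.roomVar hn m Ψ (Y₀ ω) (d t) (ρ t) t j‖ₑ ^ 2) ω ∂P)
              atTop (𝓝 0)) := by
  obtain ⟨A, decay⟩ := KleinGordon.exists_norm_adjointGroup_le hn hm hΨ
  obtain ⟨R, hR, support⟩ := KleinGordon.exists_adjointGroup_eq_zero m hΨ
  set C : ℝ := 480 * A ^ 4 * ((2 * (1 + R)) ^ (n - 1) * KleinGordon.pairBound n K) ^ 2
  refine ⟨C + 1, by positivity, fun Ω _ P _ Y₀ Λ d ρ hY h0 hK hb hd hρ => ?_⟩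
  have fourth_moment_le (t : ℝ) (ht : 1 < t) (j : ℤ) :
      Integrable (fun ω => |KleinGordon.roomVar hn m Ψ (Y₀ ω) (d t) (ρ t) t j| ^ 4) P ∧
      ∫ ω, |KleinGordon.roomVar hn m Ψ (Y₀ ω) (d t) (ρ t) t j| ^ 4 ∂P
        ≤ (C + 1) * Λ ^ 4 * d t ^ 2 / t ^ 2 := by
    have t_pos : 0 < t := zero_lt_one.trans ht
    obtain ⟨integrable, integral_le⟩ := KleinGordon.integral_roomVar_fourth_le hn hK hY h0 hb hR ht
      (decay t t_pos) (support t t_pos) (hd t t_pos).le (ρ t) j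
    refine ⟨integrable, integral_le.trans ?_⟩
    gcongr
    exact le_add_of_nonneg_right zero_le_one
  refine ⟨fourth_moment_le, fun hdt => ?_⟩
  have sum_tendsto := KleinGordon.tendsto_tsum_lintegral_roomVar hn (by positivity) hR hd hρ hdt
    support fourth_moment_le
  exact ⟨sum_tendsto, fun ε hε => KleinGordon.tendsto_tsum_lintegral_indicator_sq sum_tendsto hε⟩

theorem theoremp5p1 {n : ℕ} (hn : 1 ≤ n) (m : ℝ) (hm : 0 < m)
    (Ψ : KleinGordon.State n) (hΨ : KleinGordon.IsTestPair Ψ) (K : ℝ≥0) :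
    ∃ C : ℝ, 0 < C ∧
      ∀ (Ω : Type*) [MeasurableSpace Ω] (P : Measure Ω) [IsProbabilityMeasure P]
        (Y₀ : Ω → KleinGordon.State n) (Λ : ℝ) (d ρ : ℝ → ℝ),
        KleinGordon.IsRandomState m P Y₀ →
        KleinGordon.CondS0 P Y₀ →
        KleinGordon.CondS1 P Y₀ →
        KleinGordon.CondS2 m P Y₀ →
        KleinGordon.CondS3 P Y₀ →
        KleinGordon.mixingIntegral P Y₀ ≤ K →
        KleinGordon.BoundedBy P Y₀ Λ →
        (∀ t, 0 < t → 1 ≤ d t) →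
        (∀ t, 0 < t → 0 < ρ t) →
        -- the fourth moment bound
        (∀ t, 1 < t → ∀ j : ℤ,
          Integrable
            (fun ω => |KleinGordon.roomVar hn m Ψ (Y₀ ω) (d t) (ρ t) t j| ^ 4) P ∧
          ∫ ω, |KleinGordon.roomVar hn m Ψ (Y₀ ω) (d t) (ρ t) t j| ^ 4 ∂P
            ≤ C * Λ ^ 4 * d t ^ 2 / t ^ 2) ∧
        -- the Lindeberg condition
        (∀ δ : ℝ, 0 < δ → δ < 1 →
          Asymptotics.IsEquivalent atTop d (fun t => t / Real.log t) →
          Asymptotics.IsEquivalent atTop ρ (fun t => t ^ (1 - δ)) →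
          Tendsto (fun t => ∑' j : ℤ,
              ∫⁻ ω, ‖KleinGordon.roomVar hn m Ψ (Y₀ ω) (d t) (ρ t) t j‖ₑ ^ 4 ∂P)
            atTop (𝓝 0) ∧
          ∀ ε : ℝ, 0 < ε →
            Tendsto (fun t => ∑' j : ℤ,
                ∫⁻ ω, {ω | ε < |KleinGordon.roomVar hn m Ψ (Y₀ ω) (d t) (ρ t) t j|}.indicator
                  (fun ω => ‖KleinGordon.roomVar hn m Ψ (Y₀ ω) (d t) (ρ t) t j‖ₑ ^ 2) ω ∂P)
              atTop (𝓝 0)) := by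
  obtain ⟨C, hC, h⟩ := theoremp5p1_general hn m hm Ψ hΨ K
  exact ⟨C, hC, fun Ω _ P _ Y₀ Λ d ρ hY h0 _ _ _ hK hb hd hρ =>
    (h Ω P Y₀ Λ d ρ hY.1 h0 hK hb (fun t ht => zero_lt_one.trans_le (hd t ht))
      fun t ht => (hρ t ht).le).imp_right
      fun lindeberg _ _ _ hdt _ => lindeberg (KleinGordon.isLittleO_id_of_isEquivalent_div_log hdt)⟩
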